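/- Let $d\ge 0$ and $\delta>0$. Let $\mathcal X$ be a subset of the closed unit ball of $\mathbb R^d$ with $\langle x,y\rangle\in[0,1]$ for all $x,y\in\mathcal X$, and let $F$ be a probability measure concentrated on $\mathcal X$ such that, for $X\sim F$, the eigenvalues $\lambda_1\ge\dots\ge\lambda_d$ of the second moment matrix $\mathbb E[XX^\top]$ satisfy $2\delta<|\lambda_i-\lambda_j|$ for all $i\ne j$ and $2\delta<\lambda_d$. Let $n\ge\max(d,1)$, let $X_1,\dots,X_n$ be i.i.d. with law $F$, and let $\mathbf X$ be the $n\times d$ matrix with rows $X_1^\top,\dots,X_n^\top$. Let $\mathbf A$ be a random symmetric $n\times n$ matrix with entries in $\{0,1\}$ and zero diagonal such that, conditionally on $X_1,\dots,X_n$, the entries $\mathbf A_{ij}$, $i<j$, are independent Bernoulli variables with $\Pr[\mathbf A_{ij}=1\mid X_1,\dots,X_n]=\langle X_i,X_j\rangle$. Let $|\mathbf A|=(\mathbf A\mathbf A^\top)^{1/2}=\tilde{\mathbf U}\tilde{\mathbf S}\tilde{\mathbf U}^\top$ be an eigendecomposition with $\tilde{\mathbf U}$ orthogonal and $\tilde{\mathbf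 S}$ diagonal with nonnegative entries in decreasing order. Let $\mathbf U_{\mathbf A}$ consist of the first $d$ columns of $\tilde{\mathbf U}$, and let $\mathbf S_{\mathbf A}$ be the upper left $d\times d$ block of $\tilde{\mathbf S}$. (1) With probability greater than $1-\frac{2(d^2+1)}{n^2}$ the following holds: for every such eigendecomposition of $|\mathbf A|$ there is an orthogonal matrix $\mathbf W\in\mathbb R^{d\times d}$ with $$\|\mathbf U_{\mathbf A}\mathbf S_{\mathbf A}^{1/2}\mathbf W-\mathbf X\|_F\le 2d\sqrt{\frac{3\log n}{\delta^3}}\qquad(\ast)$$ (where $\|\cdot\|_F$ is the Frobenius norm). (2) For each outcome choose an eigendecomposition of $|\mathbf A|$ as above and an orthogonal matrix $\mathbf W$, in any way such that $(\ast)$ holds whenever it holds for some orthogonal matrix. Let $\hat X_i$ be row $i$ of $\hat{\mathbf X}=\mathbf U_{\mathbf A}\mathbf S_{\mathbf A}^{1/2}\mathbf W$. Then for each $i\in\{1,\dots,n\}$ and every $\gamma<1$, as $n\to\infty$, $$\Pr\big[\|\hat X_i-X_i\|^2>n^{-\gamma}\big]=O\big(n^{\gamma-1}\log n\big),$$ where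 the implied constant depends only on $d$, $\delta$ and $\gamma$. -/

import Mathlib

open MeasureTheory ProbabilityTheory Matrix

noncomputable section

/-- Admissible latent spaces: subsets of the closed unit ball of `ℝ^d`, any two elements of which
have an inner product in `[0, 1]`. -/
def IsLatentSpace {d : ℕ} (S : Set (EuclideanSpace ℝ (Fin d))) : Prop :=
  S ⊆ Metric.closedBall 0 1 ∧ ∀ x ∈ S, ∀ y ∈ S, inner ℝ x y ∈ Set.Icc (0 : ℝ) 1

/-- The second moment matrix `E[X Xᵀ]` of a random vector `X` with law `F`. -/
def secondMoment {d : ℕ} (F : Measure (EuclideanSpace ℝ (Fin d))) : Matrix (Fin d) (Fin d) ℝ :=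
  Matrix.of fun k l => ∫ x, x k * x l ∂F

theorem secondMoment_isHermitian {d : ℕ} (F : Measure (EuclideanSpace ℝ (Fin d))) :
    (secondMoment F).IsHermitian := by
  ext k l
  simp [secondMoment, Matrix.conjTranspose_apply, mul_comm]

/-- The eigenvalues of `E[X Xᵀ]`, listed with multiplicity, are pairwise more than `2δ` apart and
all of them (equivalently, the smallest one) are larger than `2δ`. -/
def HasSpectralGap {d : ℕ} (F : Measure (EuclideanSpace ℝ (Fin d))) (δ : ℝ) : Prop :=
  (∀ i j, i ≠ j → 2 * δ <
    |(secondMoment_isHermitian F).eigenvalues i - (secondMoment_isHermitian F).eigenvalues j|) ∧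
  ∀ i, 2 * δ < (secondMoment_isHermitian F).eigenvalues i

/-- Random dot product graph on `n` vertices with i.i.d. latent positions `X i` of law `F` and
adjacency matrix `A`. Conditionally on the positions, the entries of `A` above the diagonal are
independent Bernoulli variables with parameters `⟪X i, X j⟫`: this is `cond_law`, which gives the
joint law of the positions and of these entries. -/
structure IsRDPG {d n : ℕ} {Ω : Type*} [MeasurableSpace Ω]
    (F : Measure (EuclideanSpace ℝ (Fin d))) (μ : Measure Ω)
    (X : Fin n → Ω → EuclideanSpace ℝ (Fin d)) (A : Ω → Matrix (Fin n) (Fin n) ℝ) : Prop where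
  measurable_position : ∀ i, Measurable (X i)
  indep : iIndepFun X μ
  law : ∀ i, μ.map (X i) = F
  measurable_entry : ∀ i j, Measurable fun ω => A ω i j
  zero_or_one : ∀ ω i j, A ω i j = 0 ∨ A ω i j = 1
  symm : ∀ ω, (A ω).IsSymm
  hollow : ∀ ω i, A ω i i = 0
  cond_law : ∀ (B : Set (Fin n → EuclideanSpace ℝ (Fin d))), MeasurableSet B →
    ∀ a : Fin n → Fin n → Bool,
      μ ({ω | (fun i => X i ω) ∈ B} ∩
          {ω | ∀ i j, i < j → A ω i j = if a i j then 1 else 0}) =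
        ∫⁻ ω in {ω | (fun i => X i ω) ∈ B},
          ∏ p : Fin n × Fin n with p.1 < p.2,
            ENNReal.ofReal (if a p.1 p.2 then inner ℝ (X p.1 ω) (X p.2 ω)
              else 1 - inner ℝ (X p.1 ω) (X p.2 ω)) ∂μ

open scoped MatrixOrder in
/-- `|A| = (A Aᵀ)^{1/2}`, the positive semidefinite square root of `A Aᵀ`. -/
def matrixAbs {n : ℕ} (A : Matrix (Fin n) (Fin n) ℝ) : Matrix (Fin n) (Fin n) ℝ :=
  CFC.sqrt (A * Aᵀ)

/-- `U diag(s) Uᵀ` is an eigendecomposition of `|A|` with decreasing nonnegative eigenvalues. -/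
structure IsAbsEigendecomposition {n : ℕ} (A U : Matrix (Fin n) (Fin n) ℝ) (s : Fin n → ℝ) :
    Prop where
  orthogonal : U ∈ Matrix.orthogonalGroup (Fin n) ℝ
  antitone : Antitone s
  nonneg : ∀ i, 0 ≤ s i
  eq : matrixAbs A = U * Matrix.diagonal s * Uᵀ

/-- The `n × d` matrix `U_A S_A^{1/2}` built from the first `d` columns of `U` and the first `d`
entries of `s`. -/
def spectralEmbedding {d n : ℕ} (hdn : d ≤ n) (U : Matrix (Fin n) (Fin n) ℝ) (s : Fin n → ℝ) :
    Matrix (Fin n) (Fin d) ℝ :=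
  U.submatrix id (Fin.castLE hdn) * Matrix.diagonal fun k => Real.sqrt (s (Fin.castLE hdn k))

/-- The `n × d` matrix whose rows are the given vectors. -/
def positionMatrix {d n : ℕ} (x : Fin n → EuclideanSpace ℝ (Fin d)) : Matrix (Fin n) (Fin d) ℝ :=
  Matrix.of fun i k => x i k

open scoped Matrix.Norms.Frobenius in
/-- The Frobenius norm. -/
def frobNorm {d n : ℕ} (M : Matrix (Fin n) (Fin d) ℝ) : ℝ := ‖M‖

/-- The estimate `X̂ = U_A S_A^{1/2} W`. -/
def positionEstimate {d n : ℕ} (hdn : d ≤ n) (U : Matrix (Fin n) (Fin n) ℝ) (s : Fin n → ℝ)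
    (W : Matrix (Fin d) (Fin d) ℝ) : Matrix (Fin n) (Fin d) ℝ :=
  spectralEmbedding hdn U s * W

/-- `‖U_A S_A^{1/2} W - X‖_F ≤ 2 d √(3 log n / δ³)`, where `X` has the rows `x i`. -/
def Aligns {d n : ℕ} (δ : ℝ) (hdn : d ≤ n) (U : Matrix (Fin n) (Fin n) ℝ) (s : Fin n → ℝ)
    (x : Fin n → EuclideanSpace ℝ (Fin d)) (W : Matrix (Fin d) (Fin d) ℝ) : Prop :=
  frobNorm (positionEstimate hdn U s W - positionMatrix x) ≤
    2 * d * Real.sqrt (3 * Real.log n / δ ^ 3)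

end

/-! ### Frobenius norms, singular values, Weyl and Procrustes inequalities -/

section LinearAlgebra

open scoped Matrix.Norms.Frobenius

/-! Both claims rest on comparing `A² = |A|²` with `(XXᵀ)²`. Given the positions, an off-diagonal
entry of `A²` counts common neighbours and is a sum of independent indicators. Hoeffding and a union
bound give `‖A² - (XXᵀ)²‖² ≤ 4n³ log n`, and Hoeffding for the i.i.d. products of coordinates brings
`XᵀX` within `2d√(n log n)` of `nM`, where `M = E[XXᵀ]`. `IsTypical` records these estimates. In
`IsRDPG.measureReal_not_isTypical_lt` the `d²` moments cost `2/n²` each and the `n(n-1)` ordered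
pairs `2/n⁴` each.

Claim (1) is deterministic on typical outcomes. Write `A² = U diag(s²) Uᵀ`, `X = V_d diag(σ) Qᵀ`, `G
= UᵀV`, and extend `σ` and `f = (√s_a)_{a<d}` by zeros. Then `‖A² - (XXᵀ)²‖² = ∑ (s_a² - σ_b⁴)²
G_ab²` (`norm_sq_sub_eq_sum`), while Procrustes (`exists_orthogonal_norm_sub_le`) gives alignment
with squared error at most `∑ (f_a - σ_b)² G_ab²`. The doubly stochastic weights `G_ab²` are the
same, so a scalar comparison of summands suffices and eigenvectors need not be matched. Put `m = δn`
and `c² = 3 log n/(δ⁴n)`. If `c ≤ 1`, Weyl's inequality separates the first `d` eigenvalues from the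
rest and the comparison has constant `3/m³`. If `c > 1`, the claimed bound is so weak that a
comparison without a gap is enough.

For claim (2) one would average the Frobenius error over exchangeable rows, but `X̂` depends on
arbitrary choices of `U` and `W`, so its rows need not be exchangeable. For large `n`, however,
`X̂X̂ᵀ` is `|A|` with the eigenvalues below `δn` removed: a function of `A` that commutes with
relabelling vertices. Hence the rows of `D = X̂X̂ᵀX - nXM = X̂(X̂ᵀX - nM) + n(X̂ - X)M` are
exchangeable on typical outcomes. Its Frobenius norm is `O(n√(log n))`, and since `M ≥ 2δ`, a row of
`X̂ - X` longer than `n^(-γ/2)` forces the same row of `D` to exceed `δ n n^(-γ/2)`. Markov's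
inequality averaged over the rows finishes. -/

theorem frobenius_norm_sq {m n : Type*} [Fintype m] [Fintype n] (M : Matrix m n ℝ) :
    ‖M‖ ^ 2 = ∑ i, ∑ j, M i j ^ 2 := by
  rw [Matrix.frobenius_norm_def, ← Real.sqrt_eq_rpow, Real.sq_sqrt]
  · simp
  · positivity

theorem frobenius_norm_sq_eq_trace {m n : Type*} [Fintype m] [Fintype n] (M : Matrix m n ℝ) :
    ‖M‖ ^ 2 = (Mᵀ * M).trace := by
  rw [frobenius_norm_sq, Finset.sum_comm]
  simp [Matrix.trace, Matrix.mul_apply, sq]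

theorem frobenius_norm_orthogonal_mul {m n l : Type*} [Fintype m] [Fintype n] [Fintype l]
    [DecidableEq m] {U : Matrix n m ℝ} (hU : Uᵀ * U = 1) (M : Matrix m l ℝ) :
    ‖U * M‖ = ‖M‖ := by
  rw [← sq_eq_sq₀ (norm_nonneg _) (norm_nonneg _), frobenius_norm_sq_eq_trace,
    frobenius_norm_sq_eq_trace, Matrix.transpose_mul, Matrix.mul_assoc, ← Matrix.mul_assoc Uᵀ, hU,
    Matrix.one_mul]

theorem frobenius_norm_mul_orthogonal {m n l : Type*} [Fintype m] [Fintype n] [Fintype l]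
    [DecidableEq n] {V : Matrix n m ℝ} (hV : V * Vᵀ = 1) (M : Matrix l n ℝ) :
    ‖M * V‖ = ‖M‖ := by
  rw [← Matrix.frobenius_norm_transpose, Matrix.transpose_mul,
    frobenius_norm_orthogonal_mul (by simpa using hV), Matrix.frobenius_norm_transpose]

theorem dotProduct_self_mulVec {m n : Type*} [Fintype m] [Fintype n]
    (M : Matrix m n ℝ) (y : n → ℝ) : (M *ᵥ y) ⬝ᵥ (M *ᵥ y) = y ⬝ᵥ ((Mᵀ * M) *ᵥ y) := by
  rw [← Matrix.mulVec_mulVec, Matrix.dotProduct_mulVec y, Matrix.vecMul_transpose]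

theorem dotProduct_sq_le {n : Type*} [Fintype n] (x y : n → ℝ) :
    (x ⬝ᵥ y) ^ 2 ≤ (x ⬝ᵥ x) * (y ⬝ᵥ y) := by
  simpa [dotProduct, sq] using Finset.sum_mul_sq_le_sq_mul_sq Finset.univ x y

theorem dotProduct_self_mulVec_le {m n : Type*} [Fintype m] [Fintype n]
    (M : Matrix m n ℝ) (y : n → ℝ) : (M *ᵥ y) ⬝ᵥ (M *ᵥ y) ≤ ‖M‖ ^ 2 * (y ⬝ᵥ y) := by
  rw [frobenius_norm_sq, Finset.sum_mul]
  refine Finset.sum_le_sum fun i _ => ?_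
  have := dotProduct_sq_le (M i) y
  simpa [dotProduct, Matrix.mulVec, sq] using this

theorem abs_dotProduct_mulVec_le {n : Type*} [Fintype n]
    (M : Matrix n n ℝ) (y : n → ℝ) : |y ⬝ᵥ (M *ᵥ y)| ≤ ‖M‖ * (y ⬝ᵥ y) := by
  have h0 : 0 ≤ y ⬝ᵥ y := Finset.sum_nonneg fun i _ => mul_self_nonneg _
  apply abs_le_of_sq_le_sq _ (by positivity)
  calc _ ≤ (y ⬝ᵥ y) * ((M *ᵥ y) ⬝ᵥ (M *ᵥ y)) := dotProduct_sq_le _ _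
    _ ≤ (y ⬝ᵥ y) * (‖M‖ ^ 2 * (y ⬝ᵥ y)) := by gcongr; exact dotProduct_self_mulVec_le M y
    _ = _ := by ring

/-- Extension of a vector by zeros. -/
def zeroExtend {d : ℕ} (n : ℕ) (σ : Fin d → ℝ) (j : Fin n) : ℝ :=
  if h : (j : ℕ) < d then σ ⟨j, h⟩ else 0

theorem zeroExtend_castLE {d n : ℕ} (hdn : d ≤ n) (σ : Fin d → ℝ) (k : Fin d) :
    zeroExtend n σ (Fin.castLE hdn k) = σ k := by
  simp [zeroExtend]

theorem zeroExtend_pow {d n : ℕ} (σ : Fin d → ℝ) (j : Fin n) {k : ℕ} (hk : k ≠ 0) :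
    zeroExtend n (fun i => σ i ^ k) j = zeroExtend n σ j ^ k := by
  unfold zeroExtend; split_ifs <;> simp [hk]

theorem sum_eq_sum_castLE {d n : ℕ} (hdn : d ≤ n) (g : Fin n → ℝ)
    (hg : ∀ j : Fin n, d ≤ (j : ℕ) → g j = 0) :
    ∑ j, g j = ∑ k : Fin d, g (Fin.castLE hdn k) := by
  obtain ⟨m, rfl⟩ := Nat.exists_eq_add_of_le hdn
  rw [Fin.sum_univ_add, Finset.sum_eq_zero (s := Finset.univ) (f := fun i : Fin m => _), add_zero]
  · rfl
  · intro i _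
    exact hg _ (by simp)

theorem sum_zeroExtend_mul {d n : ℕ} (hdn : d ≤ n) (σ : Fin d → ℝ) (g : Fin n → ℝ) :
    ∑ j, zeroExtend n σ j * g j = ∑ k, σ k * g (Fin.castLE hdn k) := by
  rw [sum_eq_sum_castLE hdn]
  · simp [zeroExtend_castLE]
  · intro j hj
    simp [zeroExtend, hj]

theorem submatrix_castLE_transpose_mul {d n : ℕ} (hdn : d ≤ n) {U : Matrix (Fin n) (Fin n) ℝ}
    (hU : Uᵀ * U = 1) :
    (U.submatrix id (Fin.castLE hdn))ᵀ * U.submatrix id (Fin.castLE hdn) = 1 := by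
  ext a b
  have := congrFun (congrFun hU (Fin.castLE hdn a)) (Fin.castLE hdn b)
  simpa [Matrix.mul_apply, Matrix.one_apply] using this

theorem submatrix_castLE_mul_diagonal_mul_transpose {d n : ℕ} (hdn : d ≤ n)
    (U : Matrix (Fin n) (Fin n) ℝ) (σ : Fin d → ℝ) :
    U.submatrix id (Fin.castLE hdn) * diagonal σ * (U.submatrix id (Fin.castLE hdn))ᵀ =
      U * diagonal (zeroExtend n σ) * Uᵀ := by
  ext i j
  rw [Matrix.mul_apply, Matrix.mul_apply]
  simp only [Matrix.mul_diagonal, Matrix.transpose_apply, Matrix.submatrix_apply, id]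
  have := sum_zeroExtend_mul hdn σ (fun k => U i k * U j k)
  simp only [mul_assoc, mul_left_comm (U i _)]
  exact this.symm

/-- Singular value decomposition of a matrix with at least as many rows as columns. -/
theorem exists_svd {d n : ℕ} (hdn : d ≤ n) (X : Matrix (Fin n) (Fin d) ℝ) :
    ∃ V : Matrix (Fin n) (Fin n) ℝ, Vᵀ * V = 1 ∧ ∃ Q : Matrix (Fin d) (Fin d) ℝ, Qᵀ * Q = 1 ∧
      ∃ σ : Fin d → ℝ, (∀ k, 0 ≤ σ k) ∧
        X = V.submatrix id (Fin.castLE hdn) * diagonal σ * Qᵀ := by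
  have hM : (Xᵀ * X).PosSemidef := by
    simpa using Matrix.posSemidef_conjTranspose_mul_self X
  set Q : Matrix (Fin d) (Fin d) ℝ := (hM.1.eigenvectorUnitary : Matrix (Fin d) (Fin d) ℝ) with hQ
  have hQQ : Qᵀ * Q = 1 := (Matrix.mem_orthogonalGroup_iff' _ _).1 hM.1.eigenvectorUnitary.2
  have hQQ' : Q * Qᵀ = 1 := (Matrix.mem_orthogonalGroup_iff _ _).1 hM.1.eigenvectorUnitary.2
  set μ := hM.1.eigenvalues with hμ
  have hμ0 : ∀ k, 0 ≤ μ k := hM.eigenvalues_nonneg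
  have hsp : Xᵀ * X = Q * diagonal μ * Qᵀ := by
    have := hM.1.spectral_theorem
    rw [Unitary.conjStarAlgAut_apply] at this
    exact this
  have hYY : (X * Q)ᵀ * (X * Q) = diagonal μ := by
    rw [Matrix.transpose_mul, Matrix.mul_assoc, ← Matrix.mul_assoc Xᵀ, hsp, Matrix.mul_assoc,
      Matrix.mul_assoc, hQQ, Matrix.mul_one, ← Matrix.mul_assoc, hQQ, Matrix.one_mul]
  have hcol : ∀ k l, ∑ i, (X * Q) i k * (X * Q) i l = if k = l then μ k else 0 := by
    intro k l
    have := congrFun (congrFun hYY k) l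
    rw [Matrix.mul_apply, Matrix.diagonal_apply] at this
    exact this
  -- The columns of `XQ` are orthogonal. Those that do not vanish are normalised and completed to an
  -- orthonormal basis without changing their index; a column with singular value `0` may be
  -- completed arbitrarily.
  let v : Fin n → EuclideanSpace ℝ (Fin n) := fun j =>
    WithLp.toLp 2 fun i => if h : (j : ℕ) < d then (√(μ ⟨j, h⟩))⁻¹ * (X * Q) i ⟨j, h⟩ else 0
  let s : Set (Fin n) := {j | ∃ h : (j : ℕ) < d, μ ⟨j, h⟩ ≠ 0}
  have hv : Orthonormal ℝ (s.domRestrict v) := by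
    rw [orthonormal_iff_ite]
    rintro ⟨i, hi, hi0⟩ ⟨j, hj, hj0⟩
    have key : inner ℝ (v i) (v j) = (√(μ ⟨i, hi⟩))⁻¹ * (√(μ ⟨j, hj⟩))⁻¹ *
        ∑ x, (X * Q) x ⟨i, hi⟩ * (X * Q) x ⟨j, hj⟩ := by
      simp only [v, PiLp.inner_apply, hi, hj, dif_pos, Finset.mul_sum]
      refine Finset.sum_congr rfl fun x _ => ?_
      simp
      ring
    change inner ℝ (v i) (v j) = _
    rw [key, hcol]
    by_cases hij : i = j
    · subst hij
      have : √(μ ⟨i, hi⟩) ≠ 0 := by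
        rw [Real.sqrt_ne_zero (hμ0 _)]; exact hi0
      simp only [if_true]
      nth_rewrite 3 [← Real.mul_self_sqrt (hμ0 ⟨i, hi⟩)]
      field_simp
    · have h1 : (⟨i, hi⟩ : Fin d) ≠ ⟨j, hj⟩ := by
        simpa [Fin.ext_iff] using hij
      simp [h1, hij]
  obtain ⟨b, hb⟩ := hv.exists_orthonormalBasis_extension_of_card_eq (by simp)
  refine ⟨Matrix.of fun i j => b j i, ?_, Q, hQQ, fun k => √(μ k), fun k => Real.sqrt_nonneg _, ?_⟩
  · ext i j
    have := orthonormal_iff_ite.1 b.orthonormal i j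
    simp only [PiLp.inner_apply] at this
    simp only [Matrix.mul_apply, Matrix.transpose_apply, Matrix.of_apply, Matrix.one_apply]
    rw [← this]
    exact Finset.sum_congr rfl fun x _ => by simp [mul_comm]
  · have : X * Q = (Matrix.of fun i j => b j i).submatrix id (Fin.castLE hdn) *
        diagonal fun k => √(μ k) := by
      ext i k
      simp only [Matrix.mul_diagonal, Matrix.submatrix_apply, Matrix.of_apply, id]
      by_cases hk : μ k = 0
      · have h2 := hcol k k
        simp only [if_true, hk] at h2
        have h3 := (Finset.sum_eq_zero_iff_of_nonneg fun x _ => mul_self_nonneg _).1 h2 i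
          (Finset.mem_univ i)
        rw [mul_self_eq_zero.1 h3, hk]
        simp
      · have hmem : Fin.castLE hdn k ∈ s := ⟨k.2, hk⟩
        rw [hb _ hmem]
        have : √(μ k) ≠ 0 := by
          rw [Real.sqrt_ne_zero (hμ0 _)]; exact hk
        simp [v]
        field_simp
    rw [← this, Matrix.mul_assoc, hQQ', Matrix.mul_one]

/-- A Weyl inequality for the eigenvalues of two symmetric matrices. -/
theorem sub_le_norm_sub_of_card_lt {n : ℕ} {U V : Matrix (Fin n) (Fin n) ℝ} (hU : Uᵀ * U = 1)
    (hV : Vᵀ * V = 1) {h k : Fin n → ℝ} {I J : Finset (Fin n)} {p q : ℝ}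
    (hp : ∀ a ∈ I, p ≤ h a) (hq : ∀ b ∉ J, k b ≤ q) (hIJ : J.card < I.card) :
    p - q ≤ ‖U * diagonal h * Uᵀ - V * diagonal k * Vᵀ‖ := by
  have hV' : V * Vᵀ = 1 := mul_eq_one_comm.1 hV
  -- By dimension, some nonzero combination `y` of the columns of `U` indexed by `I` is orthogonal
  -- to all columns of `V` indexed by `J`. On `y` the first quadratic form is at least `p` and the
  -- second at most `q`.
  let T : (I → ℝ) →ₗ[ℝ] (J → ℝ) :=
    (Matrix.of fun (b : J) (a : I) => (Vᵀ * U) b a).mulVecLin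
  have hker : T.ker ≠ ⊥ := LinearMap.ker_ne_bot_of_finrank_lt (by simpa using hIJ)
  obtain ⟨c, hc, hc0⟩ := (Submodule.ne_bot_iff _).1 hker
  set z : Fin n → ℝ := fun a => if ha : a ∈ I then c ⟨a, ha⟩ else 0 with hz
  set w : Fin n → ℝ := (Vᵀ * U) *ᵥ z with hw
  set y : Fin n → ℝ := U *ᵥ z with hy
  have hyz : y ⬝ᵥ y = z ⬝ᵥ z := by rw [hy, dotProduct_self_mulVec, hU, Matrix.one_mulVec]
  have hVy : Vᵀ *ᵥ y = w := by rw [hy, hw, Matrix.mulVec_mulVec]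
  have hUy : Uᵀ *ᵥ y = z := by rw [hy, Matrix.mulVec_mulVec, hU, Matrix.one_mulVec]
  have hwy : w ⬝ᵥ w = y ⬝ᵥ y := by
    rw [← hVy, dotProduct_self_mulVec, Matrix.transpose_transpose, hV', Matrix.one_mulVec]
  have hwJ : ∀ b ∈ J, w b = 0 := by
    intro b hb
    have h1 := congrFun (LinearMap.mem_ker.1 hc) ⟨b, hb⟩
    simp only [T, Matrix.mulVecLin_apply, Matrix.mulVec, dotProduct, Matrix.of_apply,
      Pi.zero_apply] at h1
    rw [hw]
    simp only [Matrix.mulVec, dotProduct]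
    rw [← Finset.sum_subset (Finset.subset_univ I), ← h1, ← Finset.sum_coe_sort I]
    · exact Finset.sum_congr rfl fun a _ => by simp [hz]
    · intro a _ ha; simp [hz, ha]
  have hpos : 0 < y ⬝ᵥ y := by
    rw [hyz]
    obtain ⟨a, ha⟩ := Function.ne_iff.1 hc0
    have : z a ≠ 0 := by simpa [hz] using ha
    exact Finset.sum_pos' (fun i _ => mul_self_nonneg _) ⟨a, Finset.mem_univ _, mul_self_pos.2 this⟩
  have quad : ∀ (O : Matrix (Fin n) (Fin n) ℝ) (e : Fin n → ℝ),
      y ⬝ᵥ ((O * diagonal e * Oᵀ) *ᵥ y) = ∑ i, e i * (Oᵀ *ᵥ y) i ^ 2 := by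
    intro O e
    rw [← Matrix.mulVec_mulVec, ← Matrix.mulVec_mulVec, Matrix.dotProduct_mulVec,
      ← Matrix.mulVec_transpose]
    simp only [dotProduct, Matrix.mulVec_diagonal]
    exact Finset.sum_congr rfl fun i _ => by ring
  have hH : p * (y ⬝ᵥ y) ≤ y ⬝ᵥ ((U * diagonal h * Uᵀ) *ᵥ y) := by
    rw [quad, hUy, hyz, dotProduct, Finset.mul_sum]
    refine Finset.sum_le_sum fun a _ => ?_
    by_cases ha : a ∈ I
    · rw [← sq]; gcongr; exact hp a ha
    · simp [hz, ha]
  have hK : y ⬝ᵥ ((V * diagonal k * Vᵀ) *ᵥ y) ≤ q * (y ⬝ᵥ y) := by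
    rw [quad, hVy, ← hwy, dotProduct, Finset.mul_sum]
    refine Finset.sum_le_sum fun b _ => ?_
    by_cases hb : b ∈ J
    · simp [hwJ b hb]
    · rw [← sq]; gcongr; exact hq b hb
  have hE := (le_abs_self _).trans
    (abs_dotProduct_mulVec_le (U * diagonal h * Uᵀ - V * diagonal k * Vᵀ) y)
  rw [Matrix.sub_mulVec, dotProduct_sub] at hE
  have : (p - q) * (y ⬝ᵥ y) ≤ ‖U * diagonal h * Uᵀ - V * diagonal k * Vᵀ‖ * (y ⬝ᵥ y) := by
    linarith
  exact le_of_mul_le_mul_right this hpos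

/-- Multiplying by `Uᵀ` on the left and `V` on the right preserves the norm and turns the difference
into `diag(h) G - G diag(k)` with `G = UᵀV`. -/
theorem norm_sq_sub_eq_sum {n : ℕ} {U V : Matrix (Fin n) (Fin n) ℝ} (hU : Uᵀ * U = 1)
    (hV : Vᵀ * V = 1) (h k : Fin n → ℝ) :
    ‖U * diagonal h * Uᵀ - V * diagonal k * Vᵀ‖ ^ 2 =
      ∑ a, ∑ b, (h a - k b) ^ 2 * (Uᵀ * V) a b ^ 2 := by
  have hU' : U * Uᵀ = 1 := mul_eq_one_comm.1 hU
  have hV' : V * Vᵀ = 1 := mul_eq_one_comm.1 hV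
  rw [← frobenius_norm_orthogonal_mul (U := Uᵀ) (by simpa using hU'),
    ← frobenius_norm_mul_orthogonal hV', frobenius_norm_sq]
  refine Finset.sum_congr rfl fun a _ => Finset.sum_congr rfl fun b _ => ?_
  have : Uᵀ * (U * diagonal h * Uᵀ - V * diagonal k * Vᵀ) * V =
      diagonal h * (Uᵀ * V) - (Uᵀ * V) * diagonal k := by
    rw [Matrix.mul_sub, Matrix.sub_mul]
    congr 1
    · rw [← Matrix.mul_assoc, ← Matrix.mul_assoc, hU, Matrix.one_mul, Matrix.mul_assoc]
    · rw [Matrix.mul_assoc, Matrix.mul_assoc, hV, Matrix.mul_one, Matrix.mul_assoc]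
  rw [this, Matrix.sub_apply, Matrix.diagonal_mul, Matrix.mul_diagonal]
  ring

/-- Orthogonal Procrustes bound. -/
theorem exists_orthogonal_norm_sub_le {d n : ℕ} (hdn : d ≤ n) {U V : Matrix (Fin n) (Fin n) ℝ}
    (hU : Uᵀ * U = 1) (hV : Vᵀ * V = 1) {Q : Matrix (Fin d) (Fin d) ℝ} (hQ : Qᵀ * Q = 1)
    (f σ : Fin d → ℝ) :
    ∃ W ∈ Matrix.orthogonalGroup (Fin d) ℝ,
      ‖U.submatrix id (Fin.castLE hdn) * diagonal f * W -
        V.submatrix id (Fin.castLE hdn) * diagonal σ * Qᵀ‖ ^ 2 ≤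
      ∑ a, ∑ b, (zeroExtend n f a - zeroExtend n σ b) ^ 2 * (Uᵀ * V) a b ^ 2 := by
  set Ud := U.submatrix id (Fin.castLE hdn) with hUd
  set Vd := V.submatrix id (Fin.castLE hdn) with hVd
  have hUdd : Udᵀ * Ud = 1 := submatrix_castLE_transpose_mul hdn hU
  have hVdd : Vdᵀ * Vd = 1 := submatrix_castLE_transpose_mul hdn hV
  set G := Udᵀ * Vd with hG
  set K := diagonal f * G * diagonal σ with hK
  obtain ⟨Z, hZ, R, hR, τ, hτ, hKd⟩ := exists_svd le_rfl K
  have hcast : Z.submatrix id (Fin.castLE le_rfl) = Z := by ext; simp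
  rw [hcast] at hKd
  have hZ' : Z * Zᵀ = 1 := mul_eq_one_comm.1 hZ
  -- `ZRᵀ` is an orthogonal polar factor of `K`; it makes the cross term in the squared distance
  -- equal to the nuclear norm `∑ τ`.
  refine ⟨Z * Rᵀ * Qᵀ, ?_, ?_⟩
  · rw [Matrix.mem_orthogonalGroup_iff]
    simp only [Matrix.transpose_mul, Matrix.transpose_transpose]
    calc _ = Z * (Rᵀ * (Qᵀ * Q) * R) * Zᵀ := by simp only [Matrix.mul_assoc]
      _ = 1 := by rw [hQ, Matrix.mul_one, hR, Matrix.mul_one, hZ']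
  · have e1 : Ud * diagonal f * (Z * Rᵀ * Qᵀ) - Vd * diagonal σ * Qᵀ =
        (Ud * diagonal f * (Z * Rᵀ) - Vd * diagonal σ) * Qᵀ := by
      rw [Matrix.sub_mul]; simp only [Matrix.mul_assoc]
    rw [e1, frobenius_norm_mul_orthogonal (by simpa using hQ), frobenius_norm_sq_eq_trace]
    have e2 : (Ud * diagonal f * (Z * Rᵀ) - Vd * diagonal σ)ᵀ *
        (Ud * diagonal f * (Z * Rᵀ) - Vd * diagonal σ) =
        (Z * Rᵀ)ᵀ * (diagonal f * (Udᵀ * Ud) * diagonal f) * (Z * Rᵀ) +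
          diagonal σ * (Vdᵀ * Vd) * diagonal σ - ((Z * Rᵀ)ᵀ * K) - ((Z * Rᵀ)ᵀ * K)ᵀ := by
      rw [hK, hG]
      simp only [Matrix.transpose_sub, Matrix.transpose_mul, Matrix.diagonal_transpose,
        Matrix.transpose_transpose, Matrix.mul_sub, Matrix.sub_mul, Matrix.mul_assoc]
      abel
    have t1 : ((Z * Rᵀ)ᵀ * (diagonal f * (Udᵀ * Ud) * diagonal f) * (Z * Rᵀ)).trace =
        ∑ k, f k ^ 2 := by
      rw [Matrix.trace_mul_comm, ← Matrix.mul_assoc, hUdd]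
      have : Z * Rᵀ * (Z * Rᵀ)ᵀ = 1 := by
        simp only [Matrix.transpose_mul, Matrix.transpose_transpose]
        rw [Matrix.mul_assoc, ← Matrix.mul_assoc Rᵀ, hR, Matrix.one_mul, hZ']
      rw [this]
      simp [Matrix.trace, sq]
    have t2 : (diagonal σ * (Vdᵀ * Vd) * diagonal σ).trace = ∑ k, σ k ^ 2 := by
      rw [hVdd]; simp [Matrix.trace, sq]
    have t3 : ((Z * Rᵀ)ᵀ * K).trace = ∑ k, τ k := by
      have : (Z * Rᵀ)ᵀ * K = R * (Zᵀ * Z) * diagonal τ * Rᵀ := by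
        nth_rewrite 1 [hKd]
        simp only [Matrix.transpose_mul, Matrix.transpose_transpose, Matrix.mul_assoc]
      rw [this, hZ, Matrix.mul_one, Matrix.trace_mul_comm, ← Matrix.mul_assoc, hR, Matrix.one_mul]
      simp [Matrix.trace]
    -- The left side is `tr(KGᵀ)`. In the singular basis of `K` it pairs `τ` with inner products of
    -- unit vectors, which are at most `1`.
    have t4 : ∑ a, ∑ b, f a * σ b * G a b ^ 2 ≤ ∑ k, τ k := by
      have h1 : ∑ a, ∑ b, f a * σ b * G a b ^ 2 = (K * Gᵀ).trace := by
        refine Finset.sum_congr rfl fun a _ => ?_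
        rw [Matrix.diag_apply, Matrix.mul_apply]
        refine Finset.sum_congr rfl fun b _ => ?_
        rw [hK, Matrix.mul_diagonal, Matrix.diagonal_mul, Matrix.transpose_apply]
        ring
      have h2 : (K * Gᵀ).trace = (diagonal τ * (Rᵀ * Gᵀ * Z)).trace := by
        rw [hKd, Matrix.mul_assoc, Matrix.mul_assoc, Matrix.trace_mul_comm, Matrix.mul_assoc,
          Matrix.mul_assoc]
      rw [h1, h2]
      simp only [Matrix.trace, Matrix.diag_apply, Matrix.diagonal_mul]
      refine Finset.sum_le_sum fun k _ => mul_le_of_le_one_right (hτ k) ?_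
      have h3 : Rᵀ * Gᵀ * Z = (Vd * R)ᵀ * (Ud * Z) := by
        rw [hG]
        simp only [Matrix.transpose_mul, Matrix.transpose_transpose, Matrix.mul_assoc]
      have h4 : (Rᵀ * Gᵀ * Z) k k = (fun i => (Vd * R) i k) ⬝ᵥ (fun i => (Ud * Z) i k) := by
        rw [h3, Matrix.mul_apply]; rfl
      have unit : ∀ (O : Matrix (Fin n) (Fin d) ℝ), Oᵀ * O = 1 →
          (fun i => O i k) ⬝ᵥ (fun i => O i k) = 1 := by
        intro O hO
        have := congrFun (congrFun hO k) k
        rw [Matrix.mul_apply] at this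
        simpa using! this
      have h5 := dotProduct_sq_le (fun i => (Vd * R) i k) (fun i => (Ud * Z) i k)
      rw [unit, unit, ← h4] at h5
      · exact (abs_le_one_iff_mul_self_le_one.2 (by linarith [sq ((Rᵀ * Gᵀ * Z) k k)]) |> abs_le.1).2
      · rw [Matrix.transpose_mul, Matrix.mul_assoc, ← Matrix.mul_assoc Udᵀ, hUdd, Matrix.one_mul, hZ]
      · rw [Matrix.transpose_mul, Matrix.mul_assoc, ← Matrix.mul_assoc Vdᵀ, hVdd, Matrix.one_mul, hR]
    rw [e2, Matrix.trace_sub, Matrix.trace_sub, Matrix.trace_add, Matrix.trace_transpose, t1, t2, t3]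
    -- The squared entries of the orthogonal matrix `UᵀV` form a doubly stochastic matrix, so `∑ f²`
    -- and `∑ σ²` can be spread over all pairs `(a, b)`.
    have hW : (Uᵀ * V) * (Uᵀ * V)ᵀ = 1 := by
      rw [Matrix.transpose_mul, Matrix.transpose_transpose, Matrix.mul_assoc, ← Matrix.mul_assoc V,
        mul_eq_one_comm.1 hV, Matrix.one_mul, hU]
    have hW' : (Uᵀ * V)ᵀ * (Uᵀ * V) = 1 := mul_eq_one_comm.1 hW
    have r1 : ∀ a, ∑ b, (Uᵀ * V) a b ^ 2 = 1 := fun a => by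
      have := congrFun (congrFun hW a) a
      rw [Matrix.mul_apply] at this
      simpa [sq] using this
    have r2 : ∀ b, ∑ a, (Uᵀ * V) a b ^ 2 = 1 := fun b => by
      have := congrFun (congrFun hW' b) b
      rw [Matrix.mul_apply] at this
      simpa [sq] using this
    have s1 : ∑ a, ∑ b, zeroExtend n f a ^ 2 * (Uᵀ * V) a b ^ 2 = ∑ k, f k ^ 2 := by
      simp only [← Finset.mul_sum, r1, mul_one, ← zeroExtend_pow f _ two_ne_zero]
      simpa using sum_zeroExtend_mul hdn (fun k => f k ^ 2) 1
    have s2 : ∑ a, ∑ b, zeroExtend n σ b ^ 2 * (Uᵀ * V) a b ^ 2 = ∑ k, σ k ^ 2 := by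
      rw [Finset.sum_comm]
      simp only [← Finset.mul_sum, r2, mul_one, ← zeroExtend_pow σ _ two_ne_zero]
      simpa using sum_zeroExtend_mul hdn (fun k => σ k ^ 2) 1
    have s3 : ∑ a, ∑ b, zeroExtend n f a * (zeroExtend n σ b * (Uᵀ * V) a b ^ 2) =
        ∑ a, ∑ b, f a * σ b * G a b ^ 2 := by
      simp only [← Finset.mul_sum, sum_zeroExtend_mul hdn]
      simp only [Finset.mul_sum]
      refine Finset.sum_congr rfl fun a _ => Finset.sum_congr rfl fun b _ => ?_
      have : G a b = (Uᵀ * V) (Fin.castLE hdn a) (Fin.castLE hdn b) := by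
        simp [hG, hUd, hVd, Matrix.mul_apply]
      rw [this]; ring
    have : ∑ a, ∑ b, (zeroExtend n f a - zeroExtend n σ b) ^ 2 * (Uᵀ * V) a b ^ 2 =
        ∑ k, f k ^ 2 + ∑ k, σ k ^ 2 - 2 * ∑ a, ∑ b, f a * σ b * G a b ^ 2 := by
      rw [← s1, ← s2, ← s3, Finset.mul_sum, ← Finset.sum_add_distrib, ← Finset.sum_sub_distrib]
      refine Finset.sum_congr rfl fun a _ => ?_
      rw [Finset.mul_sum, ← Finset.sum_add_distrib, ← Finset.sum_sub_distrib]
      exact Finset.sum_congr rfl fun b _ => by ring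
    linarith

end LinearAlgebra

/-! ### The square of `|A|` -/

section Absolute

open scoped MatrixOrder in
theorem matrixAbs_mul_self {n : ℕ} (A : Matrix (Fin n) (Fin n) ℝ) :
    matrixAbs A * matrixAbs A = A * Aᵀ := by
  unfold matrixAbs
  refine CFC.sqrt_mul_sqrt_self _ ?_
  rw [Matrix.nonneg_iff_posSemidef]
  simpa using Matrix.posSemidef_self_mul_conjTranspose A

theorem mul_diagonal_mul_transpose_mul_self {n : ℕ} {U : Matrix (Fin n) (Fin n) ℝ}
    (hU : Uᵀ * U = 1) (s : Fin n → ℝ) :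
    (U * diagonal s * Uᵀ) * (U * diagonal s * Uᵀ) = U * diagonal (fun a => s a ^ 2) * Uᵀ := by
  have : diagonal (fun a => s a ^ 2) = diagonal s * diagonal s := by
    simp [sq]
  rw [this]
  calc _ = U * diagonal s * (Uᵀ * U) * diagonal s * Uᵀ := by simp only [Matrix.mul_assoc]
    _ = _ := by rw [hU, Matrix.mul_one, Matrix.mul_assoc U]

theorem IsAbsEigendecomposition.transpose_mul_self {n : ℕ} {A U : Matrix (Fin n) (Fin n) ℝ}
    {s : Fin n → ℝ} (h : IsAbsEigendecomposition A U s) : Uᵀ * U = 1 :=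
  (Matrix.mem_orthogonalGroup_iff' _ _).1 h.orthogonal

/-- Squaring forgets the signs of the eigenvalues of `A`, so `|A|` is controlled through the
polynomial `A²` in the entries. -/
theorem IsAbsEigendecomposition.mul_self_eq {n : ℕ} {A U : Matrix (Fin n) (Fin n) ℝ}
    {s : Fin n → ℝ} (h : IsAbsEigendecomposition A U s) (hA : A.IsSymm) :
    A * A = U * diagonal (fun a => s a ^ 2) * Uᵀ := by
  have := matrixAbs_mul_self A
  rw [hA.eq, h.eq, mul_diagonal_mul_transpose_mul_self h.transpose_mul_self] at this
  exact this.symm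

end Absolute

/-! ### Deterministic alignment bound -/

section Deterministic

open scoped Matrix.Norms.Frobenius

theorem frobNorm_eq_norm {d n : ℕ} (M : Matrix (Fin n) (Fin d) ℝ) : frobNorm M = ‖M‖ := rfl

theorem mul_transpose_eq_of_svd {d n : ℕ} (hdn : d ≤ n) {V : Matrix (Fin n) (Fin n) ℝ}
    {Q : Matrix (Fin d) (Fin d) ℝ} (hQ : Qᵀ * Q = 1) {σ : Fin d → ℝ}
    {X : Matrix (Fin n) (Fin d) ℝ}
    (hX : X = V.submatrix id (Fin.castLE hdn) * diagonal σ * Qᵀ) :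
    X * Xᵀ = V * diagonal (fun b => zeroExtend n σ b ^ 2) * Vᵀ := by
  simp only [← zeroExtend_pow σ _ two_ne_zero]
  rw [← submatrix_castLE_mul_diagonal_mul_transpose hdn]
  have : diagonal (fun a => σ a ^ 2) = diagonal σ * diagonal σ := by
    simp [sq]
  rw [this, hX]
  simp only [Matrix.transpose_mul, Matrix.transpose_transpose, Matrix.diagonal_transpose]
  calc _ = V.submatrix id (Fin.castLE hdn) * diagonal σ * (Qᵀ * Q) * diagonal σ *
      (V.submatrix id (Fin.castLE hdn))ᵀ := by simp only [Matrix.mul_assoc]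
    _ = _ := by rw [hQ, Matrix.mul_one]; simp only [Matrix.mul_assoc]

theorem gram_eq_of_svd {d n : ℕ} (hdn : d ≤ n) {V : Matrix (Fin n) (Fin n) ℝ}
    (hV : Vᵀ * V = 1) {Q : Matrix (Fin d) (Fin d) ℝ} {σ : Fin d → ℝ}
    {X : Matrix (Fin n) (Fin d) ℝ}
    (hX : X = V.submatrix id (Fin.castLE hdn) * diagonal σ * Qᵀ) :
    Xᵀ * X = Q * diagonal (fun b => σ b ^ 2) * Qᵀ := by
  have : diagonal (fun a => σ a ^ 2) = diagonal σ * diagonal σ := by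
    simp [sq]
  rw [this, hX]
  simp only [Matrix.transpose_mul, Matrix.transpose_transpose, Matrix.diagonal_transpose]
  calc _ = Q * diagonal σ * ((V.submatrix id (Fin.castLE hdn))ᵀ *
      V.submatrix id (Fin.castLE hdn)) * diagonal σ * Qᵀ := by simp only [Matrix.mul_assoc]
    _ = _ := by
      rw [submatrix_castLE_transpose_mul hdn hV, Matrix.mul_one]; simp only [Matrix.mul_assoc]

theorem le_sq_of_forall_le_quadratic {d : ℕ} {Q : Matrix (Fin d) (Fin d) ℝ} (hQ : Qᵀ * Q = 1)
    {e : Fin d → ℝ} {κ : ℝ}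
    (h : ∀ y : Fin d → ℝ, κ * (y ⬝ᵥ y) ≤ y ⬝ᵥ ((Q * diagonal e * Qᵀ) *ᵥ y)) (k : Fin d) :
    κ ≤ e k := by
  have h1 := h (Q *ᵥ Pi.single k 1)
  rw [dotProduct_self_mulVec, hQ, Matrix.one_mulVec, Matrix.mulVec_mulVec, Matrix.mul_assoc, hQ,
    Matrix.mul_one, Matrix.dotProduct_mulVec, Matrix.vecMul_mulVec, ← Matrix.mul_assoc] at h1
  simpa [hQ] using h1

/-- Weyl's inequality: `(XXᵀ)²` has rank at most `d`, while the indices up to `a` give more than `d`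
eigenvalues that are at least `s_a²`. -/
theorem sq_le_norm_of_le {d n : ℕ} (hdn : d ≤ n) {U : Matrix (Fin n) (Fin n) ℝ} {s : Fin n → ℝ}
    (hU : Uᵀ * U = 1) (hs : Antitone s) (hs0 : ∀ a, 0 ≤ s a) (X : Matrix (Fin n) (Fin d) ℝ)
    {a : Fin n} (ha : d ≤ (a : ℕ)) :
    s a ^ 2 ≤ ‖U * diagonal (fun a => s a ^ 2) * Uᵀ - X * Xᵀ * (X * Xᵀ)‖ := by
  obtain ⟨V, hV, Q, hQ, σ, -, hX⟩ := exists_svd hdn X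
  rw [mul_transpose_eq_of_svd hdn hQ hX, mul_diagonal_mul_transpose_mul_self hV]
  have := sub_le_norm_sub_of_card_lt hU hV (h := fun a => s a ^ 2)
    (k := fun b => (zeroExtend n σ b ^ 2) ^ 2) (I := Finset.Iic a)
    (J := Finset.univ.map (Fin.castLEEmb hdn)) (p := s a ^ 2) (q := 0) ?_ ?_ ?_
  · simpa using this
  · intro b hb
    have := hs (Finset.mem_Iic.1 hb)
    have := hs0 a
    gcongr
  · intro b hb
    have hbd : ¬ (b : ℕ) < d := fun hlt => hb (by
      simp only [Finset.mem_map, Finset.mem_univ, true_and]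
      exact ⟨⟨b, hlt⟩, rfl⟩)
    simp [zeroExtend, hbd]
  · simp [Fin.card_Iic]
    omega

/-- Weyl's inequality in the other direction: `(XXᵀ)²` has `d` eigenvalues at least `κ²`, and only
the `a < d` indices before `a` can carry values above `s_a²`. -/
theorem sub_sq_le_norm_of_lt {d n : ℕ} (hdn : d ≤ n) {U : Matrix (Fin n) (Fin n) ℝ}
    {s : Fin n → ℝ} (hU : Uᵀ * U = 1) (hs : Antitone s) (hs0 : ∀ a, 0 ≤ s a)
    {X : Matrix (Fin n) (Fin d) ℝ} {κ : ℝ} (hκ : 0 ≤ κ)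
    (hX : ∀ y : Fin d → ℝ, κ * (y ⬝ᵥ y) ≤ y ⬝ᵥ ((Xᵀ * X) *ᵥ y))
    {a : Fin n} (ha : (a : ℕ) < d) :
    κ ^ 2 - s a ^ 2 ≤ ‖U * diagonal (fun a => s a ^ 2) * Uᵀ - X * Xᵀ * (X * Xᵀ)‖ := by
  obtain ⟨V, hV, Q, hQ, σ, -, hXs⟩ := exists_svd hdn X
  rw [gram_eq_of_svd hdn hV hXs] at hX
  have hσ := le_sq_of_forall_le_quadratic hQ hX
  rw [mul_transpose_eq_of_svd hdn hQ hXs, mul_diagonal_mul_transpose_mul_self hV, norm_sub_rev]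
  refine sub_le_norm_sub_of_card_lt hV hU (k := fun a => s a ^ 2)
    (h := fun b => (zeroExtend n σ b ^ 2) ^ 2) (J := Finset.Iio a)
    (I := Finset.univ.map (Fin.castLEEmb hdn)) (p := κ ^ 2) (q := s a ^ 2) ?_ ?_ ?_
  · intro b hb
    simp only [Finset.mem_map, Finset.mem_univ, true_and] at hb
    obtain ⟨k, rfl⟩ := hb
    rw [Fin.castLEEmb_apply, zeroExtend_castLE]
    have := hσ k
    gcongr
  · intro b hb
    have := hs (not_lt.1 fun h => hb (Finset.mem_Iio.2 h))
    have := hs0 b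
    gcongr
  · simp [Fin.card_Iio]
    omega

/-- The passage from scalar comparisons to matrices. As the weights are doubly stochastic, a slack
`x` on the first `d` rows costs `dx` in total, and likewise `y` on columns. -/
theorem sum_mul_sq_le_of_forall_le {d n : ℕ} (hdn : d ≤ n) {U V : Matrix (Fin n) (Fin n) ℝ}
    (hU : Uᵀ * U = 1) (hV : Vᵀ * V = 1) (h k : Fin n → ℝ) (T : Fin n → Fin n → ℝ) {α x y : ℝ}
    (hT : ∀ a b, T a b ≤ α * (h a - k b) ^ 2 + (if (a : ℕ) < d then x else 0) +
      if (b : ℕ) < d then y else 0) :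
    ∑ a, ∑ b, T a b * (Uᵀ * V) a b ^ 2 ≤
      α * ‖U * diagonal h * Uᵀ - V * diagonal k * Vᵀ‖ ^ 2 + d * (x + y) := by
  have hW : (Uᵀ * V) * (Uᵀ * V)ᵀ = 1 := by
    rw [Matrix.transpose_mul, Matrix.transpose_transpose, Matrix.mul_assoc, ← Matrix.mul_assoc V,
      mul_eq_one_comm.1 hV, Matrix.one_mul, hU]
  have hW' : (Uᵀ * V)ᵀ * (Uᵀ * V) = 1 := mul_eq_one_comm.1 hW
  have r1 : ∀ a, ∑ b, (Uᵀ * V) a b ^ 2 = 1 := fun a => by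
    have := congrFun (congrFun hW a) a
    rw [Matrix.mul_apply] at this
    simpa [sq] using this
  have r2 : ∀ b, ∑ a, (Uᵀ * V) a b ^ 2 = 1 := fun b => by
    have := congrFun (congrFun hW' b) b
    rw [Matrix.mul_apply] at this
    simpa [sq] using this
  have cnt : ∀ z : ℝ, ∑ a : Fin n, (if (a : ℕ) < d then z else 0) = d * z := by
    intro z
    rw [sum_eq_sum_castLE hdn]
    · simp
    · intro j hj
      simp [hj]
  calc _ ≤ ∑ a, ∑ b, (α * (h a - k b) ^ 2 + (if (a : ℕ) < d then x else 0) +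
      if (b : ℕ) < d then y else 0) * (Uᵀ * V) a b ^ 2 := by
        gcongr with a _ b _; exact hT a b
    _ = α * ∑ a, ∑ b, (h a - k b) ^ 2 * (Uᵀ * V) a b ^ 2 +
        ∑ a : Fin n, (if (a : ℕ) < d then x else 0) * ∑ b, (Uᵀ * V) a b ^ 2 +
        ∑ b : Fin n, (if (b : ℕ) < d then y else 0) * ∑ a, (Uᵀ * V) a b ^ 2 := by
        simp only [add_mul, Finset.sum_add_distrib, Finset.mul_sum, mul_assoc]
        congr 1
        rw [Finset.sum_comm]
    _ = _ := by
        rw [norm_sq_sub_eq_sum hU hV]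
        simp only [r1, r2, mul_one, cnt]
        ring

theorem sq_sub_le_abs_sq_sub_sq {x y : ℝ} (hx : 0 ≤ x) (hy : 0 ≤ y) :
    (x - y) ^ 2 ≤ |x ^ 2 - y ^ 2| := by
  rw [sq_sub_sq, abs_mul, ← sq_abs, sq, mul_comm |x + y|, abs_of_nonneg (add_nonneg hx hy)]
  gcongr
  rw [abs_le]; constructor <;> linarith

/-- The convex function `z⁴/(4r³)` lies above its tangent at `z = r`. -/
theorem le_pow_four_div_add {z r : ℝ} (hr : 0 < r) : z ≤ z ^ 4 / (4 * r ^ 3) + 3 / 4 * r := by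
  have : z ^ 4 / (4 * r ^ 3) + 3 / 4 * r - z =
      (z - r) ^ 2 * ((z + r) ^ 2 + 2 * r ^ 2) / (4 * r ^ 3) := by
    field_simp; ring
  have h : 0 ≤ (z - r) ^ 2 * ((z + r) ^ 2 + 2 * r ^ 2) / (4 * r ^ 3) := by positivity
  linarith

/-- Perturbation bound without a spectral gap. -/
theorem sq_sub_le_without_gap {s σ r : ℝ} (hs : 0 ≤ s) (hr : 0 < r) :
    |s - σ ^ 2| ≤ 1 / (4 * r ^ 3) * (s ^ 2 - (σ ^ 2) ^ 2) ^ 2 + 3 / 4 * r := by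
  have h1 := le_pow_four_div_add (z := |s - σ ^ 2|) hr
  have h2 := sq_sub_le_abs_sq_sub_sq hs (sq_nonneg σ)
  have h3 : |s - σ ^ 2| ^ 4 ≤ (s ^ 2 - (σ ^ 2) ^ 2) ^ 2 := by
    rw [← sq_abs (s ^ 2 - _), show (4 : ℕ) = 2 * 2 from rfl, pow_mul, sq_abs]
    gcongr
  have h4 : |s - σ ^ 2| ^ 4 / (4 * r ^ 3) ≤ 1 / (4 * r ^ 3) * (s ^ 2 - (σ ^ 2) ^ 2) ^ 2 := by
    rw [one_div, inv_mul_eq_div]; gcongr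
  linarith

/-- From `g⁴ - t⁴ = (g - t)(g + t)(g² + t²)`, where the gap bounds the last two factors below. This
is the case of both indices below `d`; the next two lemmas treat one index below `d` and the other
not. -/
theorem sq_sub_mul_le_of_gap {m g t : ℝ} (hm : 0 < m) (hg : 0 ≤ g) (ht : 0 ≤ t)
    (h1 : 0.9 * m ≤ g ^ 2) (h2 : 1.42 * m ≤ t ^ 2) :
    (g - t) ^ 2 * m ^ 3 ≤ 3 * ((g ^ 2) ^ 2 - (t ^ 2) ^ 2) ^ 2 := by
  have e2 : m ≤ (g + t) ^ 2 := by nlinarith [mul_nonneg hg ht]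
  have e3 : m ^ 2 ≤ (g ^ 2 + t ^ 2) ^ 2 := by
    gcongr; linarith
  have e5 : (g - t) ^ 2 * m ^ 3 ≤ (g - t) ^ 2 * ((g + t) ^ 2 * (g ^ 2 + t ^ 2) ^ 2) := by
    gcongr
    calc m ^ 3 = m * m ^ 2 := by ring
      _ ≤ _ := by gcongr
  have : 0 ≤ (g - t) ^ 2 * ((g + t) ^ 2 * (g ^ 2 + t ^ 2) ^ 2) := by positivity
  linarith

theorem sq_mul_le_of_gap {m g : ℝ} (hm : 0 < m) (h1 : 0.9 * m ≤ g ^ 2) :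
    g ^ 2 * m ^ 3 ≤ 3 * ((g ^ 2) ^ 2) ^ 2 := by
  have h2 : (0.9 * m) ^ 3 ≤ (g ^ 2) ^ 3 := by gcongr
  have h3 : m ^ 3 ≤ 3 * (g ^ 2) ^ 3 := by
    have := pow_pos hm 3
    rw [mul_pow] at h2
    linarith
  calc g ^ 2 * m ^ 3 ≤ g ^ 2 * (3 * (g ^ 2) ^ 3) := by gcongr
    _ = _ := by ring

theorem mul_le_of_gap {m l s : ℝ} (hm : 0 < m) (h2 : 1.42 * m ≤ l) (hs : s ^ 2 ≤ 1.155 * m ^ 2) :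
    l * m ^ 3 ≤ 3 * (s ^ 2 - l ^ 2) ^ 2 := by
  -- Numerically `1 - 1.155/1.42² > 0.427`, `1/1.42³ < 0.5` and `3 · 0.427² > 0.5`.
  have hl : 0 < l := by linarith
  have e1 : (1.42 * m) ^ 2 ≤ l ^ 2 := by gcongr
  have e2 : 0.427 * l ^ 2 ≤ l ^ 2 - s ^ 2 := by
    have := pow_pos hm 2
    rw [mul_pow] at e1
    linarith
  have e3 : (0.427 * l ^ 2) ^ 2 ≤ (l ^ 2 - s ^ 2) ^ 2 := by gcongr
  have e4 : (1.42 * m) ^ 3 ≤ l ^ 3 := by gcongr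
  have e5 : m ^ 3 ≤ 0.5 * l ^ 3 := by
    have := pow_pos hm 3
    rw [mul_pow] at e4
    linarith
  have e6 : l * m ^ 3 ≤ l * (0.5 * l ^ 3) := by gcongr
  have e8 : (0.427 * l ^ 2) ^ 2 = 0.427 ^ 2 * l ^ 4 := by ring
  have e9 : (s ^ 2 - l ^ 2) ^ 2 = (l ^ 2 - s ^ 2) ^ 2 := by ring
  have e10 : 0 < l ^ 4 := by positivity
  rw [e8] at e3
  rw [e9]
  linarith

theorem large_noise_bound {m c D r : ℝ} (hm : 0 < m) (hc : 1 < c) (hD : 1 ≤ D) (hr : 0 < r)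
    (hr4 : r ^ 4 = 4 / 3 * c ^ 2 * m ^ 4) :
    r / 4 + D * (3 / 4 * r + 7 / 4 * r) ≤ 4 * D ^ 2 * c ^ 2 * m := by
  -- Here `2.75 = 1/4 + 3/4 + 7/4`. As `r` grows only like `√c · m`, the assumption `c > 1` leaves
  -- room after taking fourth powers.
  have h3 : r * 2.75 ≤ 4 * c ^ 2 * m := by
    refine le_of_pow_le_pow_left₀ four_ne_zero (by positivity) ?_
    rw [mul_pow, hr4]
    have h5 : c ^ 2 * 1 ≤ c ^ 2 * c ^ 6 := by
      gcongr; exact one_le_pow₀ hc.le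
    have h6 : c ^ 2 * m ^ 4 ≤ c ^ 8 * m ^ 4 := by
      rw [show c ^ 8 = c ^ 2 * c ^ 6 by ring]
      gcongr; linarith
    have h7 : 0 ≤ c ^ 8 * m ^ 4 := by positivity
    have e : (4 * c ^ 2 * m) ^ 4 = 256 * (c ^ 8 * m ^ 4) := by ring
    rw [e]
    linarith
  have h4 : D ≤ D ^ 2 := by nlinarith
  have h5 : r * 2.75 * D ^ 2 ≤ 4 * c ^ 2 * m * D ^ 2 := by gcongr
  have h6 : r * D ≤ r * D ^ 2 := by gcongr
  have h7 : r * 1 ≤ r * D := by gcongr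
  linarith

/-- Alignment of the spectral embedding of a symmetric matrix with `X`, given that its square is
close to `(X Xᵀ) ^ 2`. -/
theorem exists_norm_spectralEmbedding_sub_le {d n : ℕ} (hd : 1 ≤ d) (hdn : d ≤ n)
    {U : Matrix (Fin n) (Fin n) ℝ} {s : Fin n → ℝ} (hU : Uᵀ * U = 1) (hs : Antitone s)
    (hs0 : ∀ a, 0 ≤ s a) {X : Matrix (Fin n) (Fin d) ℝ} {m c : ℝ} (hm : 0 < m) (hc : 0 ≤ c)
    (hE : ‖U * diagonal (fun a => s a ^ 2) * Uᵀ - X * Xᵀ * (X * Xᵀ)‖ ^ 2 ≤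
      4 / 3 * c ^ 2 * m ^ 4)
    (hX : c ≤ 1 → ∀ y : Fin d → ℝ, 1.42 * m * (y ⬝ᵥ y) ≤ y ⬝ᵥ ((Xᵀ * X) *ᵥ y)) :
    ∃ W ∈ Matrix.orthogonalGroup (Fin d) ℝ,
      ‖spectralEmbedding hdn U s * W - X‖ ^ 2 ≤ 4 * d ^ 2 * c ^ 2 * m := by
  have hd' : (1 : ℝ) ≤ d := by exact_mod_cast hd
  have hup := fun (a : Fin n) (ha : d ≤ (a : ℕ)) => sq_le_norm_of_le hdn hU hs hs0 X ha
  have hlow := fun (hc1 : c ≤ 1) (a : Fin n) (ha : (a : ℕ) < d) =>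
    sub_sq_le_norm_of_lt hdn hU hs hs0 (by positivity) (hX hc1) ha
  have hupE : ∀ a : Fin n, d ≤ (a : ℕ) → s a ^ 4 ≤ 4 / 3 * c ^ 2 * m ^ 4 := by
    intro a ha
    refine le_trans ?_ hE
    rw [show (4 : ℕ) = 2 * 2 from rfl, pow_mul]
    have := hup a ha
    gcongr
  obtain ⟨V, hV, Q, hQ, σ, hσ0, hXs⟩ := exists_svd hdn X
  obtain ⟨W, hW, hWle⟩ := exists_orthogonal_norm_sub_le hdn hU hV hQ
    (fun k => √(s (Fin.castLE hdn k))) σ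
  refine ⟨W, hW, ?_⟩
  rw [← hXs] at hWle
  refine hWle.trans ?_
  have hEV := hE
  rw [mul_transpose_eq_of_svd hdn hQ hXs, mul_diagonal_mul_transpose_mul_self hV] at hEV
  have hf1 : ∀ a : Fin n, (a : ℕ) < d →
      zeroExtend n (fun k => √(s (Fin.castLE hdn k))) a = √(s a) := by
    intro a ha
    simp [zeroExtend, ha]
  have hf2 : ∀ (g : Fin d → ℝ) (a : Fin n), ¬ (a : ℕ) < d → zeroExtend n g a = 0 := by
    intro g a ha
    simp [zeroExtend, ha]
  have hσ0' : ∀ b, 0 ≤ zeroExtend n σ b := by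
    intro b; unfold zeroExtend; split_ifs
    · exact hσ0 _
    · rfl
  set τ := zeroExtend n σ with hτ
  set g := zeroExtend n (fun k => √(s (Fin.castLE hdn k))) with hg
  have hgτ : ∀ a b : Fin n, (a : ℕ) < d → (g a - τ b) ^ 2 ≤ |s a - τ b ^ 2| := by
    intro a b ha
    have := sq_sub_le_abs_sq_sub_sq (Real.sqrt_nonneg (s a)) (hσ0' b)
    rwa [Real.sq_sqrt (hs0 a), ← hf1 a ha] at this
  rcases le_or_gt c 1 with hc1 | hc1
  · -- the small noise regime
    have hlow1 := hlow hc1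
    have hc2 : c ^ 2 ≤ 1 := pow_le_one₀ hc hc1
    -- `1.155` exceeds `√(4/3)`. Weyl then gives `s_a ≥ 0.9m` for `a < d`, because `1.42² - 1.155 >
    -- 0.9²`.
    have hE1 : ‖U * diagonal (fun a => s a ^ 2) * Uᵀ - X * Xᵀ * (X * Xᵀ)‖ ≤ 1.155 * m ^ 2 := by
      refine le_of_sq_le_sq ?_ (by positivity)
      refine hE.trans ?_
      have : c ^ 2 * m ^ 4 ≤ 1 * m ^ 4 := by gcongr
      nlinarith [pow_pos hm 4]
    have hgram := hX hc1
    rw [gram_eq_of_svd hdn hV hXs] at hgram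
    have hσ2 := le_sq_of_forall_le_quadratic hQ hgram
    have hτ2 : ∀ b : Fin n, (b : ℕ) < d → 1.42 * m ≤ τ b ^ 2 := by
      intro b hb
      have := hσ2 ⟨b, hb⟩
      simpa [hτ, zeroExtend, hb] using this
    have hs2 : ∀ a : Fin n, (a : ℕ) < d → 0.9 * m ≤ s a := by
      intro a ha
      have := hlow1 a ha
      have h3 : (0.9 * m) ^ 2 ≤ s a ^ 2 := by nlinarith [pow_pos hm 2]
      exact le_of_sq_le_sq h3 (hs0 a)
    have key := sum_mul_sq_le_of_forall_le hdn hU hV (fun a => s a ^ 2) (fun b => (τ b ^ 2) ^ 2)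
      (fun a b => (g a - τ b) ^ 2) (α := 3 / m ^ 3) (x := 0) (y := 0) ?_
    · refine key.trans ?_
      have : 3 / m ^ 3 * ‖U * diagonal (fun a => s a ^ 2) * Uᵀ -
          V * diagonal (fun b => (τ b ^ 2) ^ 2) * Vᵀ‖ ^ 2 ≤
          3 / m ^ 3 * (4 / 3 * c ^ 2 * m ^ 4) := by gcongr
      have e : 3 / m ^ 3 * (4 / 3 * c ^ 2 * m ^ 4) = 4 * 1 * c ^ 2 * m := by field_simp
      have : 4 * 1 * c ^ 2 * m ≤ 4 * (d : ℝ) ^ 2 * c ^ 2 * m := by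
        gcongr; exact one_le_pow₀ hd'
      linarith
    · intro a b
      simp only [ite_self, add_zero]
      rw [div_mul_eq_mul_div, le_div_iff₀ (by positivity)]
      by_cases ha : (a : ℕ) < d
      · have h1 := hs2 a ha
        have h3 : s a = g a ^ 2 := by rw [hf1 a ha, Real.sq_sqrt (hs0 a)]
        have hga : 0 ≤ g a := by rw [hf1 a ha]; positivity
        rw [h3] at h1 ⊢
        by_cases hb : (b : ℕ) < d
        · exact sq_sub_mul_le_of_gap hm hga (hσ0' b) h1 (hτ2 b hb)
        · simpa [hf2 _ b hb, hτ] using sq_mul_le_of_gap hm h1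
      · have h1 : g a = 0 := hf2 _ a ha
        by_cases hb : (b : ℕ) < d
        · rw [h1, zero_sub, neg_sq]
          exact mul_le_of_gap hm (hτ2 b hb) ((hup a (not_lt.1 ha)).trans hE1)
        · have h2 : τ b = 0 := hf2 _ b hb
          rw [h1, h2, sub_zero, zero_pow two_ne_zero, zero_mul]
          positivity
  · -- the large noise regime
    -- `r²` is the bound on the perturbation of the squares, so `r` is the natural scale for an
    -- error in `|A|`.
    obtain ⟨r, hr, hr4⟩ : ∃ r : ℝ, 0 < r ∧ r ^ 4 = 4 / 3 * c ^ 2 * m ^ 4 := by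
      refine ⟨√(√(4 / 3 * c ^ 2 * m ^ 4)), by positivity, ?_⟩
      rw [show (4 : ℕ) = 2 * 2 from rfl, pow_mul, Real.sq_sqrt (by positivity),
        Real.sq_sqrt (by positivity)]
    have key := sum_mul_sq_le_of_forall_le hdn hU hV (fun a => s a ^ 2) (fun b => (τ b ^ 2) ^ 2)
      (fun a b => (g a - τ b) ^ 2) (α := 1 / (4 * r ^ 3)) (x := 3 / 4 * r) (y := 7 / 4 * r) ?_
    · refine key.trans ?_
      have h1 : 1 / (4 * r ^ 3) * ‖U * diagonal (fun a => s a ^ 2) * Uᵀ -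
          V * diagonal (fun b => (τ b ^ 2) ^ 2) * Vᵀ‖ ^ 2 ≤ 1 / (4 * r ^ 3) * r ^ 4 := by
        rw [hr4]; gcongr
      have h2 : 1 / (4 * r ^ 3) * r ^ 4 = r / 4 := by field_simp
      rw [h2] at h1
      exact (add_le_add_left h1 _).trans (large_noise_bound hm hc1 hd' hr hr4)
    · intro a b
      have h1 := sq_sub_le_without_gap (σ := τ b) (hs0 a) hr
      by_cases ha : (a : ℕ) < d
      · have h2 := hgτ a b ha
        simp only [ha, if_true]
        split_ifs <;> linarith
      · simp only [ha, if_false, add_zero, hf2 _ a ha, hg]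
        by_cases hb : (b : ℕ) < d
        · simp only [hb, if_true]
          -- For `a ≥ d > b` the estimate has `0` in place of `√s_a`; replacing `|s_a - σ_b²|` by
          -- `σ_b²` costs this extra `r`, whence `7/4 = 3/4 + 1`.
          have h3 : s a ≤ r := by
            refine le_of_pow_le_pow_left₀ four_ne_zero hr.le ?_
            rw [hr4]; exact hupE a (not_lt.1 ha)
          have h4 := neg_abs_le (s a - τ b ^ 2)
          have : (0 - τ b) ^ 2 = τ b ^ 2 := by ring
          rw [this]
          linarith
        · simp only [hb, if_false, add_zero, hτ, hf2 _ b hb, sub_zero]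
          rw [zero_pow two_ne_zero]
          positivity

end Deterministic

/-! ### Sub-Gaussian sums of products of independent bits -/

section Hoeffding

theorem HasSubgaussianMGF.measureReal_abs_ge_le {Ω : Type*} [MeasurableSpace Ω] {μ : Measure Ω}
    [IsProbabilityMeasure μ] {S : Ω → ℝ} {c : NNReal} (h : HasSubgaussianMGF S c μ) {t : ℝ}
    (ht : 0 ≤ t) : μ.real {ω | t ≤ |S ω|} ≤ 2 * Real.exp (-t ^ 2 / (2 * c)) := by
  have h1 := h.measure_ge_le ht
  have h2 := h.neg.measure_ge_le ht
  have : {ω | t ≤ |S ω|} ⊆ {ω | t ≤ S ω} ∪ {ω | t ≤ (-S) ω} := by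
    intro ω hω
    simpa [le_abs] using hω
  calc _ ≤ μ.real ({ω | t ≤ S ω} ∪ {ω | t ≤ (-S) ω}) := measureReal_mono this
    _ ≤ _ := measureReal_union_le _ _
    _ ≤ _ := by linarith

/-- A product of independent Bernoulli distributions. -/
noncomputable abbrev bernoulliProduct {κ : Type*} [Fintype κ] (p : κ → unitInterval) :
    Measure (κ → Bool) :=
  Measure.pi fun k => bernoulliMeasure true false (p k)

/-- The indicator of a bit. -/
def bitValue (b : Bool) : ℝ := if b then 1 else 0

theorem bitValue_mem_Icc (b : Bool) : bitValue b ∈ Set.Icc (0 : ℝ) 1 := by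
  cases b <;> simp [bitValue]

theorem integral_bitValue (p : unitInterval) :
    ∫ b, bitValue b ∂(bernoulliMeasure true false p) = p := by
  rw [bernoulliMeasure_def, integral_add_measure, integral_smul_nnreal_measure,
    integral_smul_nnreal_measure, integral_dirac, integral_dirac]
  · simp [bitValue, NNReal.smul_def]
  · exact Integrable.of_finite
  · exact Integrable.of_finite

variable {κ ι : Type*} [Fintype κ]

theorem iIndepFun_bernoulliProduct (p : κ → unitInterval) :
    iIndepFun (fun k (a : κ → Bool) => a k) (bernoulliProduct p) :=
  iIndepFun_pi (X := fun _ b => b) fun _ => aemeasurable_id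

theorem integral_bitValue_mul_bitValue (p : κ → unitInterval) {k l : κ} (hkl : k ≠ l) :
    ∫ a, bitValue (a k) * bitValue (a l) ∂(bernoulliProduct p) = p k * p l := by
  have hind : IndepFun (fun a : κ → Bool => bitValue (a k)) (fun a => bitValue (a l))
      (bernoulliProduct p) :=
    ((iIndepFun_bernoulliProduct p).indepFun hkl).comp (φ := bitValue) (ψ := bitValue)
      .of_discrete .of_discrete
  rw [hind.integral_fun_mul_eq_mul_integral Integrable.of_finite.aestronglyMeasurable
    Integrable.of_finite.aestronglyMeasurable]
  have heval : ∀ k, ∫ a, bitValue (a k) ∂(bernoulliProduct p) = p k := fun k => by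
    rw [integral_comp_eval (μ := fun k => bernoulliMeasure true false (p k)) (i := k)
      (f := bitValue) Integrable.of_finite.aestronglyMeasurable, integral_bitValue]
  rw [heval, heval]

/-- The centered sum of products of disjoint pairs of independent bits is sub-Gaussian. -/
theorem hasSubgaussianMGF_sum_bitValue_mul (p : κ → unitInterval) {u v : ι → κ}
    (hu : u.Injective) (hv : v.Injective) (huv : ∀ l m, u l ≠ v m) (s : Finset ι) :
    HasSubgaussianMGF
      (fun a : κ → Bool => ∑ l ∈ s, (bitValue (a (u l)) * bitValue (a (v l)) - p (u l) * p (v l)))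
      (s.card / 4) (bernoulliProduct p) := by
  classical
  induction s using Finset.induction_on with
  | empty => simp
  | insert l s hl ih =>
    have h1 : HasSubgaussianMGF
        (fun a : κ → Bool => bitValue (a (u l)) * bitValue (a (v l)) - p (u l) * p (v l))
        (1 / 4) (bernoulliProduct p) := by
      have := hasSubgaussianMGF_of_mem_Icc (μ := bernoulliProduct p) (a := 0) (b := 1)
        (X := fun a : κ → Bool => bitValue (a (u l)) * bitValue (a (v l)))
        Measurable.of_discrete.aemeasurable (ae_of_all _ fun a => by
          have h1 := bitValue_mem_Icc (a (u l))
          have h2 := bitValue_mem_Icc (a (v l))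
          exact ⟨mul_nonneg h1.1 h2.1, mul_le_one₀ h1.2 h2.1 h2.2⟩)
      rw [integral_bitValue_mul_bitValue p (huv l l)] at this
      convert this using 1
      ext
      norm_num
    simp only [Finset.sum_insert hl]
    have hcard : (((insert l s).card : NNReal) / 4) = 1 / 4 + (s.card : NNReal) / 4 := by
      rw [Finset.card_insert_of_notMem hl]; push_cast; ring
    rw [hcard]
    refine h1.add_of_indepFun ih ?_
    -- The new summand and the old sum read disjoint sets of coordinates, hence are independent.
    -- Unread coordinates are filled with `false` below.
    set S : Finset κ := {u l, v l} with hS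
    set T : Finset κ := s.image u ∪ s.image v with hT
    have hST : Disjoint S T := by
      rw [Finset.disjoint_left]
      intro k hk hk'
      simp only [hS, Finset.mem_insert, Finset.mem_singleton] at hk
      simp only [hT, Finset.mem_union, Finset.mem_image] at hk'
      rcases hk with rfl | rfl <;> rcases hk' with ⟨m, hm, h⟩ | ⟨m, hm, h⟩
      · exact hl (hu h ▸ hm)
      · exact huv _ _ h.symm
      · exact huv _ _ h
      · exact hl (hv h ▸ hm)
    have hind := (iIndepFun_bernoulliProduct p).indepFun_finset S T hST
      fun _ => Measurable.of_discrete
    have := hind.comp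
      (φ := fun b : S → Bool => (fun a : κ → Bool =>
        bitValue (a (u l)) * bitValue (a (v l)) - p (u l) * p (v l))
          fun k => if h : k ∈ S then b ⟨k, h⟩ else false)
      (ψ := fun b : T → Bool => (fun a : κ → Bool =>
        ∑ l ∈ s, (bitValue (a (u l)) * bitValue (a (v l)) - p (u l) * p (v l)))
          fun k => if h : k ∈ T then b ⟨k, h⟩ else false)
      .of_discrete .of_discrete
    convert! this using 1
    · funext a
      simp [hS]
    · funext a
      refine Finset.sum_congr rfl fun m hm => ?_
      have h1 : u m ∈ T := Finset.mem_union_left _ (Finset.mem_image_of_mem u hm)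
      have h2 : v m ∈ T := Finset.mem_union_right _ (Finset.mem_image_of_mem v hm)
      simp [h1, h2]

theorem bernoulliProduct_apply [DecidableEq κ] (p : κ → unitInterval) (S : Set (κ → Bool)) :
    bernoulliProduct p S =
      ∑ a, S.indicator (fun a => ∏ k, ENNReal.ofReal (if a k then (p k : ℝ) else 1 - p k)) a := by
  classical
  have hS : S = ((Finset.univ.filter (· ∈ S) : Finset (κ → Bool)) : Set (κ → Bool)) := by
    ext; simp
  conv_lhs => rw [hS, ← sum_measure_singleton]
  rw [Finset.sum_filter]
  refine Finset.sum_congr rfl fun a _ => ?_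
  rw [Set.indicator_apply]
  congr 1
  rw [Measure.pi_singleton]
  refine Finset.prod_congr rfl fun k _ => ?_
  have h0 := (p k).2.1
  have h1 := (p k).2.2
  rw [bernoulliMeasure_apply _ (MeasurableSet.of_discrete)]
  cases a k
  · simp [unitInterval.toNNReal, ENNReal.ofReal, Real.toNNReal_of_nonneg (sub_nonneg.2 h1)]
    rfl
  · simp [unitInterval.toNNReal, ENNReal.ofReal, Real.toNNReal_of_nonneg h0]
    rfl

end Hoeffding

/-! ### Joint law of positions and graph -/

section EdgeLaw

/-- The adjacency matrix given by its entries above the diagonal. -/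
def edgeMatrix {n : ℕ} (a : {p : Fin n × Fin n // p.1 < p.2} → Bool) :
    Matrix (Fin n) (Fin n) ℝ :=
  Matrix.of fun i j => if h : i < j then bitValue (a ⟨(i, j), h⟩) else
    if h : j < i then bitValue (a ⟨(j, i), h⟩) else 0

/-- The unordered pair of two distinct vertices. -/
def orderedPair {n : ℕ} {i j : Fin n} (h : i ≠ j) : {p : Fin n × Fin n // p.1 < p.2} :=
  if hij : i < j then ⟨(i, j), hij⟩ else ⟨(j, i), lt_of_le_of_ne (not_lt.1 hij) h.symm⟩

theorem edgeMatrix_apply_of_ne {n : ℕ} (a : {p : Fin n × Fin n // p.1 < p.2} → Bool)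
    {i j : Fin n} (h : i ≠ j) : edgeMatrix a i j = bitValue (a (orderedPair h)) := by
  unfold edgeMatrix orderedPair
  by_cases hij : i < j
  · simp [hij]
  · have : j < i := lt_of_le_of_ne (not_lt.1 hij) h.symm
    simp [hij, this]

theorem edgeMatrix_apply_self {n : ℕ} (a : {p : Fin n × Fin n // p.1 < p.2} → Bool)
    (i : Fin n) : edgeMatrix a i i = 0 := by
  simp [edgeMatrix]

theorem edgeMatrix_isSymm {n : ℕ} (a : {p : Fin n × Fin n // p.1 < p.2} → Bool) :
    (edgeMatrix a).IsSymm := by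
  ext i j
  rcases lt_trichotomy i j with h | rfl | h
  · simp [edgeMatrix, h, h.not_gt]
  · rfl
  · simp [edgeMatrix, h, h.not_gt]

theorem edgeMatrix_mem_Icc {n : ℕ} (a : {p : Fin n × Fin n // p.1 < p.2} → Bool)
    (i j : Fin n) : edgeMatrix a i j ∈ Set.Icc (0 : ℝ) 1 := by
  by_cases h : i = j
  · rw [h, edgeMatrix_apply_self]; simp
  · rw [edgeMatrix_apply_of_ne a h]; exact bitValue_mem_Icc _

variable {d n : ℕ} {Ω : Type*} [MeasurableSpace Ω] {F : Measure (EuclideanSpace ℝ (Fin d))}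
  {μ : Measure Ω} {X : Fin n → Ω → EuclideanSpace ℝ (Fin d)} {A : Ω → Matrix (Fin n) (Fin n) ℝ}

/-- The conditional probability of an edge configuration given the positions. -/
noncomputable def edgeWeight (x : Fin n → EuclideanSpace ℝ (Fin d))
    (a : {p : Fin n × Fin n // p.1 < p.2} → Bool) : ENNReal :=
  ∏ p : {p : Fin n × Fin n // p.1 < p.2},
    ENNReal.ofReal (if a p then inner ℝ (x p.1.1) (x p.1.2) else 1 - inner ℝ (x p.1.1) (x p.1.2))

theorem measurable_edgeWeight (a : {p : Fin n × Fin n // p.1 < p.2} → Bool) :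
    Measurable fun x : Fin n → EuclideanSpace ℝ (Fin d) => edgeWeight x a := by
  unfold edgeWeight
  refine Finset.measurable_prod _ fun p _ => ?_
  split_ifs <;> fun_prop

theorem IsRDPG.eq_edgeMatrix_iff (h : IsRDPG F μ X A)
    (a : {p : Fin n × Fin n // p.1 < p.2} → Bool) (ω : Ω) :
    A ω = edgeMatrix a ↔ ∀ i j, i < j → A ω i j =
      if (fun i j => if h : i < j then a ⟨(i, j), h⟩ else false : Fin n → Fin n → Bool) i j
        then 1 else 0 := by
  constructor
  · intro hA i j hij
    rw [hA]
    simp [edgeMatrix, hij, bitValue]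
  · intro hA
    ext i j
    rcases lt_trichotomy i j with hij | rfl | hij
    · rw [hA i j hij]; simp [edgeMatrix, hij, bitValue]
    · rw [h.hollow, edgeMatrix_apply_self]
    · rw [← (h.symm ω).apply i j, hA j i hij]; simp [edgeMatrix, hij, hij.not_gt, bitValue]

theorem IsRDPG.exists_eq_edgeMatrix (h : IsRDPG F μ X A) (ω : Ω) :
    ∃ a, A ω = edgeMatrix a := by
  classical
  refine ⟨fun p => decide (A ω p.1.1 p.1.2 = 1), (h.eq_edgeMatrix_iff _ ω).2 fun i j hij => ?_⟩
  rcases h.zero_or_one ω i j with h0 | h0 <;> simp [hij, h0]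

theorem edgeMatrix_injective : Function.Injective (edgeMatrix (n := n)) := by
  intro a b hab
  funext ⟨⟨i, j⟩, hij⟩
  have := congrFun (congrFun hab i) j
  simp only [edgeMatrix, Matrix.of_apply, hij, dif_pos, bitValue] at this
  cases ha : a ⟨(i, j), hij⟩ <;> cases hb : b ⟨(i, j), hij⟩ <;> simp_all

theorem IsRDPG.measurableSet_eq_edgeMatrix (h : IsRDPG F μ X A)
    (a : {p : Fin n × Fin n // p.1 < p.2} → Bool) : MeasurableSet {ω | A ω = edgeMatrix a} := by
  have : {ω | A ω = edgeMatrix a} = ⋂ i, ⋂ j, {ω | A ω i j = edgeMatrix a i j} := by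
    ext ω
    simp [← Matrix.ext_iff]
  rw [this]
  exact MeasurableSet.iInter fun i => MeasurableSet.iInter fun j =>
    measurableSet_eq_fun (h.measurable_entry i j) measurable_const

/-- There are finitely many graphs, so an event is split by the value of `A`, and measurability is
needed only in the positions, for each fixed graph. -/
theorem IsRDPG.setOf_eq_iUnion (h : IsRDPG F μ X A)
    (R : (Fin n → EuclideanSpace ℝ (Fin d)) → Matrix (Fin n) (Fin n) ℝ → Prop) :
    {ω | R (fun i => X i ω) (A ω)} =
      ⋃ a, ({ω | (fun i => X i ω) ∈ {x | R x (edgeMatrix a)}} ∩ {ω | A ω = edgeMatrix a}) := by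
  ext ω
  simp only [Set.mem_ofPred_eq, Set.mem_iUnion, Set.mem_inter_iff]
  constructor
  · intro hR
    obtain ⟨a, ha⟩ := h.exists_eq_edgeMatrix ω
    exact ⟨a, ha ▸ hR, ha⟩
  · rintro ⟨a, hR, ha⟩
    rwa [ha]

theorem IsRDPG.measurable_positions (h : IsRDPG F μ X A) :
    Measurable fun ω => (fun i => X i ω) :=
  measurable_pi_lambda _ h.measurable_position

theorem IsRDPG.measurableSet_setOf (h : IsRDPG F μ X A)
    {R : (Fin n → EuclideanSpace ℝ (Fin d)) → Matrix (Fin n) (Fin n) ℝ → Prop}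
    (hR : ∀ a, MeasurableSet {x | R x (edgeMatrix a)}) :
    MeasurableSet {ω | R (fun i => X i ω) (A ω)} := by
  rw [h.setOf_eq_iUnion]
  exact MeasurableSet.iUnion fun a =>
    (h.measurable_positions (hR a)).inter (h.measurableSet_eq_edgeMatrix a)

theorem IsRDPG.map_positions [IsProbabilityMeasure μ] (h : IsRDPG F μ X A) :
    μ.map (fun ω i => X i ω) = Measure.pi fun _ : Fin n => F := by
  rw [h.indep.map_fun_eq_pi_map fun i => (h.measurable_position i).aemeasurable]
  simp only [h.law]

/-- The joint law of the positions and the adjacency matrix. -/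
theorem IsRDPG.measure_setOf [IsProbabilityMeasure μ] (h : IsRDPG F μ X A)
    {R : (Fin n → EuclideanSpace ℝ (Fin d)) → Matrix (Fin n) (Fin n) ℝ → Prop}
    (hR : ∀ a, MeasurableSet {x | R x (edgeMatrix a)}) :
    μ {ω | R (fun i => X i ω) (A ω)} =
      ∑ a, ∫⁻ x in {x | R x (edgeMatrix a)}, edgeWeight x a ∂(Measure.pi fun _ : Fin n => F) := by
  rw [h.setOf_eq_iUnion, measure_iUnion, tsum_fintype]
  · refine Finset.sum_congr rfl fun a _ => ?_
    have e := h.cond_law _ (hR a) fun i j => if h : i < j then a ⟨(i, j), h⟩ else false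
    simp only [← h.eq_edgeMatrix_iff a] at e
    rw [e, ← h.map_positions, setLIntegral_map (hR a) (measurable_edgeWeight a)
      h.measurable_positions]
    refine lintegral_congr fun ω => ?_
    rw [edgeWeight, Finset.prod_subtype (p := fun p : Fin n × Fin n => p.1 < p.2) _ (by simp)]
    refine Finset.prod_congr rfl fun p _ => ?_
    simp [p.2]
  · intro a b hab
    rw [Function.onFun, Set.disjoint_left]
    rintro ω ⟨-, h1⟩ ⟨-, h2⟩
    exact hab (edgeMatrix_injective (h1.symm.trans h2))
  · exact fun a => (h.measurable_positions (hR a)).inter (h.measurableSet_eq_edgeMatrix a)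

end EdgeLaw

/-! ### Typical outcomes and their probability -/

section Typical

variable {d n : ℕ} {Ω : Type*} [MeasurableSpace Ω] {F : Measure (EuclideanSpace ℝ (Fin d))}
  {μ : Measure Ω} {X : Fin n → Ω → EuclideanSpace ℝ (Fin d)} {A : Ω → Matrix (Fin n) (Fin n) ℝ}
  {S : Set (EuclideanSpace ℝ (Fin d))}

/-- Positions and adjacency matrices for which the sample second moment matrix and the square of
the adjacency matrix are close to their targets. -/
def IsTypical (F : Measure (EuclideanSpace ℝ (Fin d)))
    (x : Fin n → EuclideanSpace ℝ (Fin d)) (a : Matrix (Fin n) (Fin n) ℝ) : Prop :=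
  (∀ i, ‖x i‖ ≤ 1) ∧
  (∀ k l, |∑ i, x i k * x i l - n * secondMoment F k l| ≤ 2 * √(n * Real.log n)) ∧
  frobNorm (a * a - positionMatrix x * (positionMatrix x)ᵀ *
    (positionMatrix x * (positionMatrix x)ᵀ)) ^ 2 ≤ 4 * n ^ 3 * Real.log n

theorem frobNorm_sq (M : Matrix (Fin n) (Fin d) ℝ) : frobNorm M ^ 2 = ∑ i, ∑ j, M i j ^ 2 :=
  frobenius_norm_sq M

theorem positionMatrix_mul_transpose_apply (x : Fin n → EuclideanSpace ℝ (Fin d)) (i j : Fin n) :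
    (positionMatrix x * (positionMatrix x)ᵀ) i j = inner ℝ (x i) (x j) := by
  simp [Matrix.mul_apply, positionMatrix, PiLp.inner_apply, mul_comm]

theorem continuous_positionMatrix :
    Continuous fun x : Fin n → EuclideanSpace ℝ (Fin d) => positionMatrix x := by
  refine continuous_matrix fun i k => ?_
  simp only [positionMatrix, Matrix.of_apply]
  fun_prop

theorem measurableSet_isTypical (F : Measure (EuclideanSpace ℝ (Fin d)))
    (a : Matrix (Fin n) (Fin n) ℝ) : MeasurableSet {x | IsTypical F x a} := by
  have hc := continuous_positionMatrix (d := d) (n := n)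
  refine IsClosed.measurableSet ?_
  unfold IsTypical
  simp only [frobNorm_sq, Set.ofPred_and, Set.ofPred_forall]
  refine (isClosed_iInter fun i => isClosed_le (by fun_prop) (by fun_prop)).inter
    ((isClosed_iInter fun k => isClosed_iInter fun l =>
      isClosed_le (by fun_prop) (by fun_prop)).inter (isClosed_le ?_ (by fun_prop)))
  refine continuous_finsetSum _ fun i _ => continuous_finsetSum _ fun j _ => ?_
  have : Continuous fun x : Fin n → EuclideanSpace ℝ (Fin d) => a * a -
      positionMatrix x * (positionMatrix x)ᵀ * (positionMatrix x * (positionMatrix x)ᵀ) := by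
    fun_prop
  exact (this.matrix_elem i j).pow 2

theorem IsRDPG.ae_mem (h : IsRDPG F μ X A) (hF : ∀ᵐ x ∂F, x ∈ S) : ∀ᵐ ω ∂μ, ∀ i, X i ω ∈ S := by
  rw [ae_all_iff]
  intro i
  rw [← h.law i] at hF
  exact ae_of_ae_map (h.measurable_position i).aemeasurable hF

theorem abs_apply_le_one {x : EuclideanSpace ℝ (Fin d)} (hx : ‖x‖ ≤ 1) (k : Fin d) : |x k| ≤ 1 :=
  (PiLp.norm_apply_le x k).trans hx

theorem IsRDPG.norm_le_one (hS : IsLatentSpace S) {x : EuclideanSpace ℝ (Fin d)} (hx : x ∈ S) :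
    ‖x‖ ≤ 1 := by
  simpa using hS.1 hx

/-- Concentration of the sample second moments. -/
theorem IsRDPG.measureReal_secondMoment_le [IsProbabilityMeasure μ] (h : IsRDPG F μ X A)
    (hS : IsLatentSpace S) (hF : ∀ᵐ x ∂F, x ∈ S) (hn : 1 ≤ n) (k l : Fin d) :
    μ.real {ω | 2 * √(n * Real.log n) ≤
      |∑ i, X i ω k * X i ω l - n * secondMoment F k l|} ≤ 2 / (n : ℝ) ^ 2 := by
  have hn' : (1 : ℝ) ≤ n := by exact_mod_cast hn
  have hmeas : Measurable fun x : EuclideanSpace ℝ (Fin d) => x k * x l := by fun_prop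
  have hind : iIndepFun (fun i ω => X i ω k * X i ω l - secondMoment F k l) μ :=
    h.indep.comp (fun _ x => x k * x l - secondMoment F k l) fun _ => by fun_prop
  have hsub : ∀ i ∈ (Finset.univ : Finset (Fin n)),
      HasSubgaussianMGF (fun ω => X i ω k * X i ω l - secondMoment F k l) 1 μ := by
    intro i _
    have h1 := hasSubgaussianMGF_of_mem_Icc (μ := μ) (a := -1) (b := 1)
      (X := fun ω => X i ω k * X i ω l)
      (hmeas.comp (h.measurable_position i)).aemeasurable (by
        filter_upwards [h.ae_mem hF] with ω hω
        have := IsRDPG.norm_le_one hS (hω i)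
        rw [Set.mem_Icc, ← abs_le, abs_mul]
        exact mul_le_one₀ (abs_apply_le_one this k) (abs_nonneg _) (abs_apply_le_one this l))
    have h2 : ∫ ω, X i ω k * X i ω l ∂μ = secondMoment F k l := by
      rw [secondMoment, Matrix.of_apply, ← h.law i, integral_map
        (h.measurable_position i).aemeasurable hmeas.aestronglyMeasurable]
    rw [h2] at h1
    convert h1 using 1
    ext
    norm_num
  have hsum := HasSubgaussianMGF.sum_of_iIndepFun hind hsub
  -- The summands have variance proxy `1`, so the exponent is `-t²/(2n) = -2 log n`.
  have := HasSubgaussianMGF.measureReal_abs_ge_le hsum (t := 2 * √(n * Real.log n))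
    (by positivity)
  simp only [Finset.sum_sub_distrib, Finset.sum_const, Finset.card_univ, Fintype.card_fin,
    nsmul_eq_mul, mul_one] at this
  refine this.trans (le_of_eq ?_)
  have e : -(2 * √(n * Real.log n)) ^ 2 / (2 * ((n : NNReal) : ℝ)) = -(2 * Real.log n) := by
    rw [mul_pow, Real.sq_sqrt (by positivity)]
    push_cast
    field_simp
  rw [e, Real.exp_neg, mul_comm 2 (Real.log n), Real.exp_mul, Real.exp_log (by positivity)]
  norm_num [div_eq_mul_inv]

/-- Conditional concentration of the number of common neighbours, for given positions. -/
theorem sum_edgeWeight_le {x : Fin n → EuclideanSpace ℝ (Fin d)}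
    (hx : ∀ i j, inner ℝ (x i) (x j) ∈ Set.Icc (0 : ℝ) 1) {i j : Fin n} (hij : i ≠ j) {t : ℝ}
    (ht : 0 ≤ t) :
    ∑ a, Set.indicator {a | t ≤ |∑ l : {l // l ≠ i ∧ l ≠ j}, (edgeMatrix a i l * edgeMatrix a j l -
        inner ℝ (x i) (x l) * inner ℝ (x j) (x l))|} (edgeWeight x) a ≤
      ENNReal.ofReal (2 * Real.exp (-2 * t ^ 2 / ((n - 2 : ℕ) : ℝ))) := by
  let p : {p : Fin n × Fin n // p.1 < p.2} → unitInterval := fun q => ⟨_, hx q.1.1 q.1.2⟩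
  let u : {l // l ≠ i ∧ l ≠ j} → {p : Fin n × Fin n // p.1 < p.2} := fun l =>
    orderedPair l.2.1.symm
  let v : {l // l ≠ i ∧ l ≠ j} → {p : Fin n × Fin n // p.1 < p.2} := fun l =>
    orderedPair l.2.2.symm
  -- The edges `{i, l}` and `{j, l}`, for `l` outside `{i, j}`, are pairwise distinct; this is the
  -- independence needed for the sum over `l`.
  have key : ∀ {a b c e : Fin n} (h1 : a ≠ b) (h2 : c ≠ e), orderedPair h1 = orderedPair h2 →
      (a = c ∧ b = e) ∨ (a = e ∧ b = c) := by
    intro a b c e h1 h2 he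
    unfold orderedPair at he
    split_ifs at he <;> simp [Subtype.ext_iff, Prod.ext_iff] at he <;> tauto
  have hu : u.Injective := by
    intro l m hlm
    rcases key _ _ hlm with ⟨-, h⟩ | ⟨h, -⟩
    · exact Subtype.ext h
    · exact absurd h.symm m.2.1
  have hv : v.Injective := by
    intro l m hlm
    rcases key _ _ hlm with ⟨-, h⟩ | ⟨h, -⟩
    · exact Subtype.ext h
    · exact absurd h.symm m.2.2
  have huv : ∀ l m, u l ≠ v m := by
    intro l m hlm
    rcases key _ _ hlm with ⟨h, -⟩ | ⟨h, -⟩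
    · exact hij h
    · exact m.2.1 h.symm
  have hp : ∀ {a b : Fin n} (h : a ≠ b), (p (orderedPair h) : ℝ) = inner ℝ (x a) (x b) := by
    intro a b h
    unfold orderedPair
    split_ifs
    · rfl
    · exact real_inner_comm _ _
  have hsub := HasSubgaussianMGF.measureReal_abs_ge_le
    (hasSubgaussianMGF_sum_bitValue_mul p hu hv huv Finset.univ) ht
  have hcard : (Finset.univ : Finset {l // l ≠ i ∧ l ≠ j}).card = n - 2 := by
    rw [Finset.card_univ, Fintype.card_subtype]
    have : (Finset.univ.filter fun l => l ≠ i ∧ l ≠ j) = (Finset.univ.erase i).erase j := by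
      ext l; simp [and_comm]
    rw [this, Finset.card_erase_of_mem (by simp [hij.symm]), Finset.card_erase_of_mem (by simp)]
    simp; omega
  rw [hcard] at hsub
  have hw : ∀ a, edgeWeight x a =
      ∏ k, ENNReal.ofReal (if a k then (p k : ℝ) else 1 - p k) := fun a => rfl
  have he : {a : {p : Fin n × Fin n // p.1 < p.2} → Bool |
      t ≤ |∑ l : {l // l ≠ i ∧ l ≠ j}, (edgeMatrix a i l * edgeMatrix a j l -
        inner ℝ (x i) (x l) * inner ℝ (x j) (x l))|} =
      {a | t ≤ |∑ l, (bitValue (a (u l)) * bitValue (a (v l)) - p (u l) * p (v l))|} := by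
    ext a
    simp only [Set.mem_ofPred_eq]
    have : ∀ l : {l // l ≠ i ∧ l ≠ j}, edgeMatrix a i l * edgeMatrix a j l -
        inner ℝ (x i) (x l) * inner ℝ (x j) (x l) =
        bitValue (a (u l)) * bitValue (a (v l)) - p (u l) * p (v l) := by
      intro l
      rw [edgeMatrix_apply_of_ne a l.2.1.symm, edgeMatrix_apply_of_ne a l.2.2.symm, hp, hp]
    simp only [this]
  rw [he]
  have hfun : edgeWeight x = fun a => ∏ k, ENNReal.ofReal (if a k then (p k : ℝ) else 1 - p k) :=
    funext hw
  rw [hfun, ← bernoulliProduct_apply, ← ofReal_measureReal]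
  refine ENNReal.ofReal_le_ofReal (hsub.trans (le_of_eq ?_))
  congr 2
  rw [NNReal.coe_div, NNReal.coe_natCast, NNReal.coe_ofNat, show (2 : ℝ) * (((n - 2 : ℕ) : ℝ) / 4) = ((n - 2 : ℕ) : ℝ) / 2 by ring,
    div_div_eq_mul_div]
  ring

/-- Concentration of the number of common neighbours. -/
theorem IsRDPG.measure_commonNeighbors_le [IsProbabilityMeasure F] [IsProbabilityMeasure μ]
    (h : IsRDPG F μ X A) {i j : Fin n} (hij : i ≠ j) {t : ℝ} (ht : 0 ≤ t) :
    μ {ω | (∀ i j, inner ℝ (X i ω) (X j ω) ∈ Set.Icc (0 : ℝ) 1) ∧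
      t ≤ |∑ l : {l // l ≠ i ∧ l ≠ j}, (A ω i l * A ω j l -
        inner ℝ (X i ω) (X l ω) * inner ℝ (X j ω) (X l ω))|} ≤
      ENNReal.ofReal (2 * Real.exp (-2 * t ^ 2 / ((n - 2 : ℕ) : ℝ))) := by
  have hR : ∀ a : {p : Fin n × Fin n // p.1 < p.2} → Bool,
      MeasurableSet {x : Fin n → EuclideanSpace ℝ (Fin d) |
        (∀ i j, inner ℝ (x i) (x j) ∈ Set.Icc (0 : ℝ) 1) ∧
        t ≤ |∑ l : {l // l ≠ i ∧ l ≠ j}, (edgeMatrix a i l * edgeMatrix a j l -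
        inner ℝ (x i) (x l) * inner ℝ (x j) (x l))|} := by
    intro a
    refine IsClosed.measurableSet ?_
    simp only [Set.ofPred_and, Set.ofPred_forall, Set.mem_Icc]
    refine IsClosed.inter (isClosed_iInter fun i => isClosed_iInter fun l =>
      (isClosed_le (by fun_prop) (by fun_prop)).inter (isClosed_le (by fun_prop) (by fun_prop)))
      (isClosed_le (by fun_prop) (by fun_prop))
  rw [h.measure_setOf (R := fun x a => (∀ i j, inner ℝ (x i) (x j) ∈ Set.Icc (0 : ℝ) 1) ∧
        t ≤ |∑ l : {l // l ≠ i ∧ l ≠ j}, (a i l * a j l -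
        inner ℝ (x i) (x l) * inner ℝ (x j) (x l))|) hR]
  simp only [← lintegral_indicator (hR _)]
  -- With the sum over graphs inside, the integrand is the conditional probability given the
  -- positions. The condition on inner products, part of the event, ensures that the weights are
  -- genuine probabilities wherever the integrand is nonzero.
  rw [← lintegral_finsetSum _ fun a _ => (measurable_edgeWeight a).indicator (hR a)]
  calc _ ≤ ∫⁻ _ : Fin n → EuclideanSpace ℝ (Fin d),
      ENNReal.ofReal (2 * Real.exp (-2 * t ^ 2 / ((n - 2 : ℕ) : ℝ)))
        ∂(Measure.pi fun _ : Fin n => F) := by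
        refine lintegral_mono fun x => ?_
        by_cases hx : ∀ i j, inner ℝ (x i) (x j) ∈ Set.Icc (0 : ℝ) 1
        · refine le_trans (le_of_eq ?_) (sum_edgeWeight_le hx hij ht)
          refine Finset.sum_congr rfl fun a _ => ?_
          simp only [Set.indicator_apply, Set.mem_ofPred_eq]
          simp only [hx, implies_true, true_and]
        · simp only [Set.indicator_apply, Set.mem_ofPred_eq, hx, false_and, if_false,
            Finset.sum_const_zero, zero_le]
    _ = _ := by simp

theorem abs_entry_le {a : {p : Fin n × Fin n // p.1 < p.2} → Bool}
    {x : Fin n → EuclideanSpace ℝ (Fin d)} (hx : ∀ i j, inner ℝ (x i) (x j) ∈ Set.Icc (0 : ℝ) 1)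
    (i j : Fin n) :
    |(edgeMatrix a * edgeMatrix a - positionMatrix x * (positionMatrix x)ᵀ *
      (positionMatrix x * (positionMatrix x)ᵀ)) i j| ≤ n := by
  rw [Matrix.sub_apply, Matrix.mul_apply, Matrix.mul_apply, ← Finset.sum_sub_distrib]
  refine (Finset.abs_sum_le_sum_abs _ _).trans ?_
  refine (Finset.sum_le_card_nsmul _ _ 1 fun l _ => ?_).trans (by simp)
  simp only [positionMatrix_mul_transpose_apply]
  have h1 := edgeMatrix_mem_Icc a i l
  have h2 := edgeMatrix_mem_Icc a l j
  have h3 := hx i l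
  have h4 := hx l j
  have h5 := mul_nonneg h1.1 h2.1
  have h6 := mul_nonneg h3.1 h4.1
  have h7 := mul_le_one₀ h1.2 h2.1 h2.2
  have h8 := mul_le_one₀ h3.2 h4.1 h4.2
  rw [abs_le]
  constructor <;> linarith

/-- The terms `l = i` and `l = j` vanish for the graph, whose diagonal is zero, and are at most `1`
each for `(XXᵀ)²`; this is the `2`. -/
theorem abs_entry_le_of_ne {a : {p : Fin n × Fin n // p.1 < p.2} → Bool}
    {x : Fin n → EuclideanSpace ℝ (Fin d)} (hx : ∀ i j, inner ℝ (x i) (x j) ∈ Set.Icc (0 : ℝ) 1)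
    {i j : Fin n} (hij : i ≠ j) :
    |(edgeMatrix a * edgeMatrix a - positionMatrix x * (positionMatrix x)ᵀ *
      (positionMatrix x * (positionMatrix x)ᵀ)) i j| ≤
      |∑ l : {l // l ≠ i ∧ l ≠ j}, (edgeMatrix a i l * edgeMatrix a j l -
        inner ℝ (x i) (x l) * inner ℝ (x j) (x l))| + 2 := by
  have hsplit : ∀ f : Fin n → ℝ, ∑ l, f l = ∑ l : {l // l ≠ i ∧ l ≠ j}, f l + f i + f j := by
    intro f
    rw [← Finset.add_sum_erase _ _ (Finset.mem_univ i),
      ← Finset.add_sum_erase _ _ (Finset.mem_erase.2 ⟨hij.symm, Finset.mem_univ j⟩),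
      Finset.sum_subtype (F := inferInstance) (p := fun l => l ≠ i ∧ l ≠ j) _
        (by intro l; simp [and_comm])]
    ring
  rw [Matrix.sub_apply, Matrix.mul_apply, Matrix.mul_apply, ← Finset.sum_sub_distrib, hsplit]
  simp only [positionMatrix_mul_transpose_apply, edgeMatrix_apply_self, zero_mul, mul_zero, zero_sub]
  have e : ∀ l : {l // l ≠ i ∧ l ≠ j}, edgeMatrix a i l * edgeMatrix a l j -
      inner ℝ (x i) (x l) * inner ℝ (x l) (x j) =
      edgeMatrix a i l * edgeMatrix a j l - inner ℝ (x i) (x l) * inner ℝ (x j) (x l) := by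
    intro l
    rw [(edgeMatrix_isSymm a).apply j l, real_inner_comm (x j)]
  simp only [e]
  have h1 := hx i i
  have h2 := hx i j
  have h3 := hx j j
  have h5 := mul_nonneg h1.1 h2.1
  have h6 := mul_nonneg h2.1 h3.1
  have h7 := mul_le_one₀ h1.2 h2.1 h2.2
  have h8 := mul_le_one₀ h2.2 h3.1 h3.2
  have h9 := abs_le.1 (le_refl |∑ l : {l // l ≠ i ∧ l ≠ j}, (edgeMatrix a i l * edgeMatrix a j l -
        inner ℝ (x i) (x l) * inner ℝ (x j) (x l))|)
  rw [abs_le]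
  constructor <;> linarith

theorem frobNorm_sq_le_pow_four {a : {p : Fin n × Fin n // p.1 < p.2} → Bool}
    {x : Fin n → EuclideanSpace ℝ (Fin d)} (hx : ∀ i j, inner ℝ (x i) (x j) ∈ Set.Icc (0 : ℝ) 1) :
    frobNorm (edgeMatrix a * edgeMatrix a - positionMatrix x * (positionMatrix x)ᵀ *
      (positionMatrix x * (positionMatrix x)ᵀ)) ^ 2 ≤ (n : ℝ) ^ 4 := by
  rw [frobNorm_sq]
  calc _ ≤ ∑ _i : Fin n, ∑ _j : Fin n, (n : ℝ) ^ 2 := by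
        refine Finset.sum_le_sum fun i _ => Finset.sum_le_sum fun j _ => ?_
        rw [← sq_abs]
        exact pow_le_pow_left₀ (abs_nonneg _) (abs_entry_le hx i j) 2
    _ = _ := by simp; ring

theorem frobNorm_sq_le_of_commonNeighbors {a : {p : Fin n × Fin n // p.1 < p.2} → Bool}
    {x : Fin n → EuclideanSpace ℝ (Fin d)} (hx : ∀ i j, inner ℝ (x i) (x j) ∈ Set.Icc (0 : ℝ) 1)
    {t : ℝ} (ht : ∀ i j, i ≠ j → |∑ l : {l // l ≠ i ∧ l ≠ j}, (edgeMatrix a i l * edgeMatrix a j l -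
        inner ℝ (x i) (x l) * inner ℝ (x j) (x l))| ≤ t) :
    frobNorm (edgeMatrix a * edgeMatrix a - positionMatrix x * (positionMatrix x)ᵀ *
      (positionMatrix x * (positionMatrix x)ᵀ)) ^ 2 ≤
      n * ((n - 1) * (t + 2) ^ 2 + (n : ℝ) ^ 2) := by
  rw [frobNorm_sq]
  have hsum : ∀ i : Fin n, ∑ j, (if i = j then (n : ℝ) ^ 2 else (t + 2) ^ 2) =
      (n - 1) * (t + 2) ^ 2 + (n : ℝ) ^ 2 := by
    intro i
    have : ∀ j, (if i = j then (n : ℝ) ^ 2 else (t + 2) ^ 2) =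
        (t + 2) ^ 2 + if i = j then (n : ℝ) ^ 2 - (t + 2) ^ 2 else 0 := by
      intro j; split_ifs <;> ring
    simp only [this, Finset.sum_add_distrib, Finset.sum_const, Finset.card_univ, Fintype.card_fin,
      nsmul_eq_mul, Finset.sum_ite_eq, Finset.mem_univ, if_true]
    ring
  calc _ ≤ ∑ i : Fin n, ∑ j, (if i = j then (n : ℝ) ^ 2 else (t + 2) ^ 2) := by
        gcongr with i _ j _
        rw [← sq_abs]
        split_ifs with hij
        · exact pow_le_pow_left₀ (abs_nonneg _) (abs_entry_le hx i j) 2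
        · exact pow_le_pow_left₀ (abs_nonneg _)
            ((abs_entry_le_of_ne hx hij).trans (by linarith [ht i j hij])) 2
    _ = _ := by simp only [hsum, Finset.sum_const, Finset.card_univ, Fintype.card_fin, nsmul_eq_mul]

/-- For these `n` the trivial bound `n⁴` on the squared norm is already at most `4n³ log n`;
concentration is needed only from `n = 5` on. -/
theorem le_four_mul_log {n : ℕ} (h2 : 2 ≤ n) (h4 : n ≤ 4) : (n : ℝ) ≤ 4 * Real.log n := by
  have h := Real.log_two_gt_d9
  interval_cases n
  · norm_num; linarith
  · have : 3 / 2 * Real.log 2 ≤ Real.log 3 := by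
      have : Real.log ((2 : ℝ) ^ 3) ≤ Real.log ((3 : ℝ) ^ 2) :=
        Real.log_le_log (by norm_num) (by norm_num)
      rw [Real.log_pow, Real.log_pow] at this
      push_cast at this
      linarith
    norm_num; linarith
  · have : Real.log 4 = 2 * Real.log 2 := by
      rw [show (4 : ℝ) = 2 ^ 2 by norm_num, Real.log_pow]; norm_num
    norm_num; linarith

theorem log_ge_of_five_le {n : ℕ} (hn : 5 ≤ n) : 1.6 ≤ Real.log n := by
  have h5 : Real.log 5 ≤ Real.log n := Real.log_le_log (by norm_num) (by exact_mod_cast hn)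
  refine le_trans ?_ h5
  have h8 : (8 : ℝ) ≤ Real.log (5 ^ 5) := by
    rw [Real.le_log_iff_exp_le (by norm_num)]
    calc Real.exp 8 = Real.exp 1 ^ 8 := by rw [← Real.exp_nat_mul]; norm_num
      _ ≤ 2.7182818286 ^ 8 := by
        have := Real.exp_one_lt_d9.le
        gcongr
      _ ≤ _ := by norm_num
  rw [Real.log_pow] at h8
  push_cast at h8
  linarith

theorem commonNeighbors_numeric {n : ℕ} (hn : 5 ≤ n) {t : ℝ} (ht : t ^ 2 = 2 * (n - 2) * Real.log n) :
    n * ((n - 1) * (t + 2) ^ 2 + (n : ℝ) ^ 2) ≤ 4 * n ^ 3 * Real.log n := by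
  have hL := log_ge_of_five_le hn
  set L := Real.log n
  have hn' : (5 : ℝ) ≤ n := by exact_mod_cast hn
  set N : ℝ := (n : ℝ)
  -- The cross term is absorbed by `4t ≤ t²/4 + 16`.
  have h1 : (t + 2) ^ 2 ≤ 5 / 4 * (2 * (N - 2) * L) + 20 := by
    rw [← ht]; nlinarith [sq_nonneg (t / 2 - 4)]
  have h2 : (N - 1) * (t + 2) ^ 2 ≤ (N - 1) * (5 / 4 * (2 * (N - 2) * L) + 20) := by
    gcongr; linarith
  have h3 : (N - 1) * (5 / 4 * (2 * (N - 2) * L) + 20) + N ^ 2 ≤ 4 * N ^ 2 * L := by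
    nlinarith [sq_nonneg (N - 3)]
  calc N * ((N - 1) * (t + 2) ^ 2 + N ^ 2) ≤ N * (4 * N ^ 2 * L) := by gcongr; linarith
    _ = _ := by ring

/-- The positions and the adjacency matrix are typical with high probability. -/
theorem IsRDPG.measureReal_not_isTypical_lt [IsProbabilityMeasure F] [IsProbabilityMeasure μ]
    (h : IsRDPG F μ X A) (hS : IsLatentSpace S) (hF : ∀ᵐ x ∂F, x ∈ S) (hn : 2 ≤ n) :
    μ.real {ω | ¬ IsTypical F (fun i => X i ω) (A ω)} < 2 * ((d : ℝ) ^ 2 + 1) / (n : ℝ) ^ 2 := by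
  have hn1 : (1 : ℝ) ≤ n := by exact_mod_cast (by omega : 1 ≤ n)
  have hlog : 0 ≤ Real.log n := Real.log_nonneg hn1
  let Z : Set Ω := {ω | ¬ ∀ i, X i ω ∈ S}
  have hZ : μ.real Z = 0 := by
    rw [measureReal_def, ae_iff.1 (h.ae_mem hF), ENNReal.toReal_zero]
  let M : Fin d × Fin d → Set Ω := fun q => {ω | 2 * √(n * Real.log n) ≤
      |∑ i, X i ω q.1 * X i ω q.2 - n * secondMoment F q.1 q.2|}
  have hM : μ.real (⋃ q ∈ (Finset.univ : Finset (Fin d × Fin d)), M q) ≤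
      2 * (d : ℝ) ^ 2 / (n : ℝ) ^ 2 := by
    refine (measureReal_biUnion_finset_le _ _).trans ?_
    refine (Finset.sum_le_card_nsmul _ _ (2 / (n : ℝ) ^ 2) fun q _ =>
      h.measureReal_secondMoment_le hS hF (by omega) q.1 q.2).trans (le_of_eq ?_)
    simp
    ring
  -- Chosen so that `exp(-2t²/(n - 2)) = n⁻⁴`.
  let t : ℝ := √(2 * (n - 2) * Real.log n)
  have hn2 : (2 : ℝ) ≤ n := by exact_mod_cast hn
  have ht : t ^ 2 = 2 * (n - 2) * Real.log n :=
    Real.sq_sqrt (mul_nonneg (by linarith) hlog)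
  let N : Fin n × Fin n → Set Ω := fun q =>
    {ω | (∀ i j, inner ℝ (X i ω) (X j ω) ∈ Set.Icc (0 : ℝ) 1) ∧
      t ≤ |∑ l : {l // l ≠ q.1 ∧ l ≠ q.2}, (A ω q.1 l * A ω q.2 l -
        inner ℝ (X q.1 ω) (X l ω) * inner ℝ (X q.2 ω) (X l ω))|}
  let I : Finset (Fin n × Fin n) := if 5 ≤ n then Finset.univ.offDiag else ∅
  have hN : μ.real (⋃ q ∈ I, N q) < 2 / (n : ℝ) ^ 2 := by
    by_cases h5 : 5 ≤ n
    · have hI : I = Finset.univ.offDiag := if_pos h5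
      rw [hI]
      have hcast : ((n - 2 : ℕ) : ℝ) = n - 2 := by rw [Nat.cast_sub hn]; norm_num
      have hq : ∀ q ∈ (Finset.univ : Finset (Fin n)).offDiag, μ.real (N q) ≤ 2 / (n : ℝ) ^ 4 := by
        intro q hq
        have hne : q.1 ≠ q.2 := (Finset.mem_offDiag.1 hq).2.2
        have h1 := ENNReal.toReal_mono ENNReal.ofReal_ne_top
          (h.measure_commonNeighbors_le hne (t := t) (Real.sqrt_nonneg _))
        rw [ENNReal.toReal_ofReal (by positivity)] at h1
        refine h1.trans (le_of_eq ?_)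
        have h5' : (5 : ℝ) ≤ n := by exact_mod_cast h5
        have hne0 : (n : ℝ) - 2 ≠ 0 := by linarith
        have e : -2 * t ^ 2 / ((n - 2 : ℕ) : ℝ) = -(Real.log n * (4 : ℕ)) := by
          rw [ht, hcast]; field_simp; norm_num [mul_comm]
        rw [e, Real.exp_neg, Real.exp_mul, Real.exp_log (by linarith), Real.rpow_natCast]
        ring
      refine lt_of_le_of_lt ((measureReal_biUnion_finset_le _ _).trans
        (Finset.sum_le_card_nsmul _ _ _ hq)) ?_
      rw [Finset.offDiag_card]
      simp only [Finset.card_univ, Fintype.card_fin, nsmul_eq_mul]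
      rw [Nat.cast_sub (Nat.le_mul_self n)]
      push_cast
      -- There are `n² - n < n²` ordered pairs; this is the source of the strict inequality in the
      -- final probability bound.
      rw [← mul_div_assoc, div_lt_div_iff₀ (by positivity) (by positivity)]
      have : (0 : ℝ) < n ^ 3 := by positivity
      nlinarith
    · have hI : I = ∅ := if_neg h5
      rw [hI]
      simp
      positivity
  have hsub : {ω | ¬ IsTypical F (fun i => X i ω) (A ω)} ⊆
      Z ∪ ((⋃ q ∈ (Finset.univ : Finset (Fin d × Fin d)), M q) ∪ ⋃ q ∈ I, N q) := by
    intro ω hω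
    by_contra hcon
    simp only [Set.mem_union, Set.mem_iUnion, not_or, not_exists] at hcon
    obtain ⟨hc1, hc2, hc3⟩ := hcon
    have hc1' : ∀ i, X i ω ∈ S := not_not.1 hc1
    have hx : ∀ i j, inner ℝ (X i ω) (X j ω) ∈ Set.Icc (0 : ℝ) 1 := fun i j =>
      hS.2 _ (hc1' i) _ (hc1' j)
    refine hω ⟨fun i => IsRDPG.norm_le_one hS (hc1' i), fun k l => ?_, ?_⟩
    · exact (not_le.1 (hc2 (k, l) (Finset.mem_univ _))).le
    · obtain ⟨a, ha⟩ := h.exists_eq_edgeMatrix ω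
      by_cases h5 : 5 ≤ n
      · have hI : I = Finset.univ.offDiag := if_pos h5
        rw [ha]
        refine (frobNorm_sq_le_of_commonNeighbors hx fun i j hij => ?_).trans
          (commonNeighbors_numeric h5 ht)
        have := hc3 (i, j) (by rw [hI]; simp [hij])
        simp only [N, Set.mem_ofPred_eq, ha, not_and, not_le] at this
        exact (this hx).le
      · rw [ha]
        refine (frobNorm_sq_le_pow_four hx).trans ?_
        have := le_four_mul_log hn (by omega)
        calc (n : ℝ) ^ 4 = n ^ 3 * n := by ring
          _ ≤ n ^ 3 * (4 * Real.log n) := by gcongr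
          _ = _ := by ring
  have h1 := measureReal_mono (μ := μ) hsub
  have h2 := measureReal_union_le (μ := μ) Z
    ((⋃ q ∈ (Finset.univ : Finset (Fin d × Fin d)), M q) ∪ ⋃ q ∈ I, N q)
  have h3 := measureReal_union_le (μ := μ)
    (⋃ q ∈ (Finset.univ : Finset (Fin d × Fin d)), M q) (⋃ q ∈ I, N q)
  have e : 2 * ((d : ℝ) ^ 2 + 1) / (n : ℝ) ^ 2 = 2 * (d : ℝ) ^ 2 / (n : ℝ) ^ 2 + 2 / (n : ℝ) ^ 2 := by
    ring
  rw [e]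
  linarith

end Typical

/-! ### Alignment with high probability -/

section Alignment

variable {d n : ℕ} {Ω : Type*} [MeasurableSpace Ω] {F : Measure (EuclideanSpace ℝ (Fin d))}
  {μ : Measure Ω} {X : Fin n → Ω → EuclideanSpace ℝ (Fin d)} {A : Ω → Matrix (Fin n) (Fin n) ℝ}
  {S : Set (EuclideanSpace ℝ (Fin d))} {δ : ℝ}

theorem HasSpectralGap.mul_le_quadratic (h : HasSpectralGap F δ) (y : Fin d → ℝ) :
    2 * δ * (y ⬝ᵥ y) ≤ y ⬝ᵥ (secondMoment F *ᵥ y) := by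
  have hM := secondMoment_isHermitian F
  set Q : Matrix (Fin d) (Fin d) ℝ := (hM.eigenvectorUnitary : Matrix (Fin d) (Fin d) ℝ) with hQ
  have hQQ : Q * Qᵀ = 1 := (Matrix.mem_orthogonalGroup_iff _ _).1 hM.eigenvectorUnitary.2
  have hsp : secondMoment F = Q * diagonal hM.eigenvalues * Qᵀ := by
    have := hM.spectral_theorem
    rw [Unitary.conjStarAlgAut_apply] at this
    exact this
  have hy : (Qᵀ *ᵥ y) ⬝ᵥ (Qᵀ *ᵥ y) = y ⬝ᵥ y := by
    rw [dotProduct_self_mulVec, Matrix.transpose_transpose, hQQ, Matrix.one_mulVec]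
  rw [hsp, ← Matrix.mulVec_mulVec, ← Matrix.mulVec_mulVec, Matrix.dotProduct_mulVec,
    ← Matrix.mulVec_transpose, ← hy]
  simp only [dotProduct, Matrix.mulVec_diagonal, Finset.mul_sum]
  refine Finset.sum_le_sum fun k _ => ?_
  have := (h.2 k).le
  nlinarith [mul_self_nonneg ((Qᵀ *ᵥ y) k)]

theorem abs_secondMoment_le_one [IsProbabilityMeasure F] (hS : IsLatentSpace S)
    (hF : ∀ᵐ x ∂F, x ∈ S) (k l : Fin d) : |secondMoment F k l| ≤ 1 := by
  rw [secondMoment, Matrix.of_apply, ← Real.norm_eq_abs]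
  refine (norm_integral_le_of_norm_le_const (C := 1) ?_).trans (by simp)
  filter_upwards [hF] with x hx
  have := IsRDPG.norm_le_one hS hx
  rw [norm_mul]
  exact mul_le_one₀ (abs_apply_le_one this k) (abs_nonneg _) (abs_apply_le_one this l)

/-- The trace of the second moment matrix is `E‖X‖² ≤ 1`, and each of its `d` eigenvalues exceeds
`2δ`. This lets the factor `d` in the sampling error be absorbed. -/
theorem HasSpectralGap.two_mul_card_mul_le [IsProbabilityMeasure F] (h : HasSpectralGap F δ)
    (hS : IsLatentSpace S) (hF : ∀ᵐ x ∂F, x ∈ S) : 2 * (d * δ) ≤ 1 := by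
  have htr : (secondMoment F).trace ≤ 1 := by
    simp only [Matrix.trace, Matrix.diag_apply, secondMoment, Matrix.of_apply]
    have hint : ∀ k : Fin d, Integrable (fun x : EuclideanSpace ℝ (Fin d) => x k * x k) F := by
      intro k
      refine Integrable.of_bound (by fun_prop) 1 ?_
      filter_upwards [hF] with x hx
      have := IsRDPG.norm_le_one hS hx
      rw [norm_mul]
      exact mul_le_one₀ (abs_apply_le_one this k) (abs_nonneg _) (abs_apply_le_one this k)
    rw [← integral_finsetSum _ fun k _ => hint k]
    calc _ ≤ ∫ _ : EuclideanSpace ℝ (Fin d), (1 : ℝ) ∂F := by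
          refine integral_mono_ae (integrable_finsetSum _ fun k _ => hint k)
            (integrable_const _) ?_
          filter_upwards [hF] with x hx
          have h1 := IsRDPG.norm_le_one hS hx
          have h2 : ∑ k, x k * x k = ‖x‖ ^ 2 := by
            rw [EuclideanSpace.norm_sq_eq]; simp [sq]
          rw [h2]
          exact pow_le_one₀ (norm_nonneg _) h1
      _ = 1 := by simp
  rw [(secondMoment_isHermitian F).trace_eq_sum_eigenvalues] at htr
  have : ∑ _k : Fin d, 2 * δ ≤ ∑ k, (secondMoment_isHermitian F).eigenvalues k :=
    Finset.sum_le_sum fun k _ => (h.2 k).le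
  simp at this htr
  linarith

theorem positionMatrix_transpose_mul_apply (x : Fin n → EuclideanSpace ℝ (Fin d)) (k l : Fin d) :
    ((positionMatrix x)ᵀ * positionMatrix x) k l = ∑ i, x i k * x i l := by
  simp [Matrix.mul_apply, positionMatrix]

open scoped Matrix.Norms.Frobenius in
theorem IsTypical.norm_gram_sub_le {x : Fin n → EuclideanSpace ℝ (Fin d)}
    {a : Matrix (Fin n) (Fin n) ℝ} (h : IsTypical F x a) :
    ‖(positionMatrix x)ᵀ * positionMatrix x - (n : ℝ) • secondMoment F‖ ≤
      2 * d * √(n * Real.log n) := by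
  refine abs_le_of_sq_le_sq' ?_ (by positivity) |>.2
  rw [frobenius_norm_sq]
  calc _ ≤ ∑ _k : Fin d, ∑ _l : Fin d, (2 * √(n * Real.log n)) ^ 2 := by
        refine Finset.sum_le_sum fun k _ => Finset.sum_le_sum fun l _ => ?_
        rw [← sq_abs, Matrix.sub_apply, positionMatrix_transpose_mul_apply, Matrix.smul_apply,
          smul_eq_mul]
        exact pow_le_pow_left₀ (abs_nonneg _) (h.2.1 k l) 2
    _ = _ := by simp; ring

open scoped Matrix.Norms.Frobenius in
theorem IsTypical.le_quadratic {x : Fin n → EuclideanSpace ℝ (Fin d)}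
    {a : Matrix (Fin n) (Fin n) ℝ} (h : IsTypical F x a) (hgap : HasSpectralGap F δ)
    (y : Fin d → ℝ) :
    (2 * δ * n - 2 * d * √(n * Real.log n)) * (y ⬝ᵥ y) ≤
      y ⬝ᵥ (((positionMatrix x)ᵀ * positionMatrix x) *ᵥ y) := by
  have h1 := hgap.mul_le_quadratic y
  have h2 := abs_dotProduct_mulVec_le
    ((positionMatrix x)ᵀ * positionMatrix x - (n : ℝ) • secondMoment F) y
  have h0 : 0 ≤ y ⬝ᵥ y := Finset.sum_nonneg fun i _ => mul_self_nonneg _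
  have h3 : ‖(positionMatrix x)ᵀ * positionMatrix x - (n : ℝ) • secondMoment F‖ * (y ⬝ᵥ y) ≤
      2 * d * √(n * Real.log n) * (y ⬝ᵥ y) := by
    gcongr
    exact h.norm_gram_sub_le
  rw [Matrix.sub_mulVec, dotProduct_sub, Matrix.smul_mulVec, dotProduct_smul, smul_eq_mul] at h2
  have h4 := (abs_le.1 h2).1
  have h5 : (n : ℝ) * (2 * δ * (y ⬝ᵥ y)) ≤ n * (y ⬝ᵥ (secondMoment F *ᵥ y)) := by gcongr
  linarith

/-- For typical samples with small noise the sample second moment matrix is well conditioned. -/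
theorem IsTypical.le_quadratic_of_log_le [IsProbabilityMeasure F]
    {x : Fin n → EuclideanSpace ℝ (Fin d)}
    {a : Matrix (Fin n) (Fin n) ℝ} (h : IsTypical F x a) (hgap : HasSpectralGap F δ)
    (hS : IsLatentSpace S) (hF : ∀ᵐ x ∂F, x ∈ S) (hδ : 0 < δ)
    (hn : 3 * Real.log n ≤ δ ^ 4 * n) (y : Fin d → ℝ) :
    1.42 * (δ * n) * (y ⬝ᵥ y) ≤ y ⬝ᵥ (((positionMatrix x)ᵀ * positionMatrix x) *ᵥ y) := by
  refine le_trans ?_ (h.le_quadratic hgap y)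
  have h0 : 0 ≤ y ⬝ᵥ y := Finset.sum_nonneg fun i _ => mul_self_nonneg _
  gcongr
  -- `0.58` exceeds `1/√3`; with `2dδ ≤ 1` the sampling error is at most `0.58 δn`, which leaves
  -- `1.42 = 2 - 0.58`.
  have h1 : √(n * Real.log n) ≤ 0.58 * (δ ^ 2 * n) := by
    rw [Real.sqrt_le_left (by positivity)]
    have h2 : (n : ℝ) * (3 * Real.log n) ≤ n * (δ ^ 4 * n) := by gcongr
    have h3 : (0.58 * (δ ^ 2 * n)) ^ 2 = 0.3364 * (n * (δ ^ 4 * n)) := by ring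
    have h4 : 0 ≤ n * (δ ^ 4 * n) := by positivity
    linarith
  have h2 : 2 * (d * δ) * (0.58 * (δ * n)) ≤ 1 * (0.58 * (δ * n)) := by
    gcongr
    exact hgap.two_mul_card_mul_le hS hF
  have h3 : 2 * (d : ℝ) * √(n * Real.log n) ≤ 2 * d * (0.58 * (δ ^ 2 * n)) := by gcongr
  linarith

theorem IsTypical.exists_aligns [IsProbabilityMeasure F]
    {x : Fin n → EuclideanSpace ℝ (Fin d)} {a : Matrix (Fin n) (Fin n) ℝ}
    (h : IsTypical F x a) (ha : a.IsSymm) (hgap : HasSpectralGap F δ) (hS : IsLatentSpace S)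
    (hF : ∀ᵐ x ∂F, x ∈ S) (hδ : 0 < δ) (hd : 1 ≤ d) (hdn : d ≤ n)
    {U : Matrix (Fin n) (Fin n) ℝ} {s : Fin n → ℝ} (hU : IsAbsEigendecomposition a U s) :
    ∃ W ∈ Matrix.orthogonalGroup (Fin d) ℝ, Aligns δ hdn U s x W := by
  have hn : (1 : ℝ) ≤ n := by exact_mod_cast hd.trans hdn
  -- With `m = δn` this gives `4/3 · c²m⁴ = 4n³ log n`, the bound of a typical outcome, and `4d²c²m
  -- = 12 d² log n/δ³`, the square of the claimed one.
  set c : ℝ := √(3 * Real.log n / (δ ^ 4 * n)) with hc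
  have hc2 : c ^ 2 = 3 * Real.log n / (δ ^ 4 * n) := Real.sq_sqrt (by positivity)
  obtain ⟨W, hW, hle⟩ := exists_norm_spectralEmbedding_sub_le hd hdn hU.transpose_mul_self
    hU.antitone hU.nonneg (X := positionMatrix x) (m := δ * n) (c := c) (by positivity)
    (by positivity) (by
      rw [← hU.mul_self_eq ha, hc2]
      refine h.2.2.trans (le_of_eq ?_)
      field_simp) (by
      intro hc1
      refine h.le_quadratic_of_log_le hgap hS hF hδ ?_
      have : c ^ 2 ≤ 1 := pow_le_one₀ (by positivity) hc1
      rwa [hc2, div_le_one (by positivity)] at this)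
  refine ⟨W, hW, ?_⟩
  unfold Aligns positionEstimate
  rw [frobNorm_eq_norm]
  refine abs_le_of_sq_le_sq' ?_ (by positivity) |>.2
  refine hle.trans (le_of_eq ?_)
  rw [hc2, mul_pow, Real.sq_sqrt (by positivity)]
  field_simp
  ring

theorem aligns_of_isEmpty {n : ℕ} {δ : ℝ} (hdn : 0 ≤ n) (U : Matrix (Fin n) (Fin n) ℝ)
    (s : Fin n → ℝ) (x : Fin n → EuclideanSpace ℝ (Fin 0)) (W : Matrix (Fin 0) (Fin 0) ℝ) :
    Aligns δ hdn U s x W := by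
  unfold Aligns
  have : frobNorm (positionEstimate hdn U s W - positionMatrix x) ^ 2 = 0 := by
    rw [frobNorm_sq]; simp
  rw [pow_eq_zero_iff two_ne_zero] at this
  rw [this]
  positivity

/-- With high probability, every eigendecomposition of `|A|` yields an embedding which can be
aligned with the positions. -/
theorem IsRDPG.exists_measurableSet_aligns [IsProbabilityMeasure F] [IsProbabilityMeasure μ]
    (h : IsRDPG F μ X A) (hδ : 0 < δ) (hn : 1 ≤ n) (hdn : d ≤ n) (hS : IsLatentSpace S)
    (hF : ∀ᵐ x ∂F, x ∈ S) (hgap : HasSpectralGap F δ) :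
    ∃ E : Set Ω, MeasurableSet E ∧ 1 - 2 * ((d : ℝ) ^ 2 + 1) / (n : ℝ) ^ 2 < μ.real E ∧
      ∀ ω ∈ E, ∀ (U : Matrix (Fin n) (Fin n) ℝ) (s : Fin n → ℝ),
        IsAbsEigendecomposition (A ω) U s →
          ∃ W ∈ Matrix.orthogonalGroup (Fin d) ℝ, Aligns δ hdn U s (fun i => X i ω) W := by
  rcases Nat.eq_zero_or_pos d with rfl | hd
  · refine ⟨Set.univ, MeasurableSet.univ, ?_, fun ω _ U s _ => ⟨1, one_mem _,
      aligns_of_isEmpty hdn U s _ 1⟩⟩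
    rw [probReal_univ, sub_lt_self_iff]
    positivity
  -- For `n = 1` the required probability bound is negative, and the empty event serves.
  rcases hn.eq_or_lt with rfl | hn2
  · refine ⟨∅, MeasurableSet.empty, ?_, fun ω hω => hω.elim⟩
    simp
    nlinarith
  · have hE := h.measurableSet_setOf (R := IsTypical F) fun a => measurableSet_isTypical F _
    refine ⟨_, hE, ?_, fun ω hω U s hU =>
      IsTypical.exists_aligns hω (h.symm ω) hgap hS hF hδ hd hdn hU⟩
    have h1 := h.measureReal_not_isTypical_lt hS hF hn2
    have h2 := probReal_compl_eq_one_sub (μ := μ) hE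
    have h3 : {ω | IsTypical F (fun i => X i ω) (A ω)}ᶜ =
      {ω | ¬ IsTypical F (fun i => X i ω) (A ω)} := rfl
    rw [h3] at h2
    linarith

end Alignment

/-! ### Spectral functions of `|A|` and relabelling -/

section Threshold

/-- The matrix `UᵀU'` intertwines the two diagonals, so a nonzero entry forces `s_a = s'_b` and
hence `f(s_a) = f(s'_b)`. Thus the thresholded `|A|` does not depend on the chosen
eigendecomposition. -/
theorem conj_diagonal_comp_eq {n : ℕ} {U U' : Matrix (Fin n) (Fin n) ℝ} (hU : Uᵀ * U = 1)
    (hU' : U'ᵀ * U' = 1) {s s' : Fin n → ℝ}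
    (h : U * diagonal s * Uᵀ = U' * diagonal s' * U'ᵀ) (f : ℝ → ℝ) :
    U * diagonal (fun a => f (s a)) * Uᵀ = U' * diagonal (fun a => f (s' a)) * U'ᵀ := by
  have hU2 : U * Uᵀ = 1 := mul_eq_one_comm.1 hU
  have hU2' : U' * U'ᵀ = 1 := mul_eq_one_comm.1 hU'
  have h1 : diagonal s * (Uᵀ * U') = (Uᵀ * U') * diagonal s' := by
    calc _ = (Uᵀ * U) * diagonal s * (Uᵀ * U') := by rw [hU, Matrix.one_mul]
      _ = Uᵀ * (U * diagonal s * Uᵀ) * U' := by simp only [Matrix.mul_assoc]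
      _ = (Uᵀ * U') * diagonal s' * (U'ᵀ * U') := by rw [h]; simp only [Matrix.mul_assoc]
      _ = _ := by rw [hU', Matrix.mul_one]
  have h2 : diagonal (fun a => f (s a)) * (Uᵀ * U') =
      (Uᵀ * U') * diagonal (fun a => f (s' a)) := by
    ext a b
    have h3 := congrFun (congrFun h1 a) b
    rw [Matrix.diagonal_mul, Matrix.mul_diagonal] at h3 ⊢
    by_cases hG : (Uᵀ * U') a b = 0
    · simp [hG]
    · rw [mul_comm] at h3
      rw [mul_left_cancel₀ hG h3, mul_comm]
  calc _ = U * (diagonal (fun a => f (s a)) * (Uᵀ * U')) * U'ᵀ := by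
        simp only [Matrix.mul_assoc, hU2', Matrix.mul_one]
    _ = (U * Uᵀ) * (U' * diagonal (fun a => f (s' a)) * U'ᵀ) := by
        rw [h2]; simp only [Matrix.mul_assoc]
    _ = _ := by rw [hU2, Matrix.one_mul]

/-- Hard thresholding at level `θ`. -/
noncomputable def hardThreshold (θ s : ℝ) : ℝ := if θ ≤ s then s else 0

open scoped MatrixOrder in
theorem matrixAbs_submatrix {n : ℕ} (A : Matrix (Fin n) (Fin n) ℝ) (π : Equiv.Perm (Fin n)) :
    matrixAbs (A.submatrix π π) = (matrixAbs A).submatrix π π := by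
  have h1 : (0 : Matrix (Fin n) (Fin n) ℝ) ≤ (matrixAbs A).submatrix π π := by
    rw [Matrix.nonneg_iff_posSemidef]
    refine Matrix.PosSemidef.submatrix ?_ _
    rw [← Matrix.nonneg_iff_posSemidef]
    exact CFC.sqrt_nonneg _
  refine CFC.sqrt_unique ?_ h1
  rw [Matrix.submatrix_mul_equiv, matrixAbs_mul_self, Matrix.transpose_submatrix,
    Matrix.submatrix_mul_equiv]

theorem IsAbsEigendecomposition.submatrix {n : ℕ} {A U : Matrix (Fin n) (Fin n) ℝ}
    {s : Fin n → ℝ} (h : IsAbsEigendecomposition A U s) (π : Equiv.Perm (Fin n)) :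
    IsAbsEigendecomposition (A.submatrix π π) (U.submatrix π id) s where
  orthogonal := by
    rw [Matrix.mem_orthogonalGroup_iff']
    have : (U.submatrix π id)ᵀ * U.submatrix π id = (Uᵀ * U).submatrix id id := by
      rw [Matrix.transpose_submatrix, Matrix.submatrix_mul_equiv]
    rw [this, h.transpose_mul_self, Matrix.submatrix_id_id]
  antitone := h.antitone
  nonneg := h.nonneg
  eq := by
    rw [matrixAbs_submatrix, h.eq]
    rfl

theorem IsAbsEigendecomposition.conj_threshold_submatrix {n : ℕ} (U : Matrix (Fin n) (Fin n) ℝ)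
    (e : Fin n → ℝ) (π : Equiv.Perm (Fin n)) :
    U.submatrix π id * diagonal e * (U.submatrix π id)ᵀ =
      (U * diagonal e * Uᵀ).submatrix π π := rfl

end Threshold

/-! ### A choice-free substitute for the row error -/

section RowError

open scoped Matrix.Norms.Frobenius

variable {d n : ℕ} {F : Measure (EuclideanSpace ℝ (Fin d))}
  {S : Set (EuclideanSpace ℝ (Fin d))} {δ : ℝ}

/-- The defect of `n X E[X Xᵀ] ≈ Y X`. -/
noncomputable def rowError (F : Measure (EuclideanSpace ℝ (Fin d)))
    (x : Fin n → EuclideanSpace ℝ (Fin d)) (Y : Matrix (Fin n) (Fin n) ℝ) :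
    Matrix (Fin n) (Fin d) ℝ :=
  Y * positionMatrix x - (n : ℝ) • (positionMatrix x * secondMoment F)

theorem norm_toLp_sq {m : Type*} [Fintype m] (v : m → ℝ) : ‖WithLp.toLp 2 v‖ ^ 2 = v ⬝ᵥ v := by
  rw [EuclideanSpace.norm_sq_eq]
  simp [dotProduct, sq]

theorem norm_toLp_mulVec_le {m l : Type*} [Fintype m] [Fintype l] (M : Matrix m l ℝ) (y : l → ℝ) :
    ‖WithLp.toLp 2 (M *ᵥ y)‖ ≤ ‖M‖ * ‖WithLp.toLp 2 y‖ := by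
  refine abs_le_of_sq_le_sq' ?_ (by positivity) |>.2
  rw [mul_pow, norm_toLp_sq, norm_toLp_sq]
  exact dotProduct_self_mulVec_le M y

theorem norm_toLp_vecMul_le {m l : Type*} [Fintype m] [Fintype l] (M : Matrix l m ℝ) (y : l → ℝ) :
    ‖WithLp.toLp 2 (y ᵥ* M)‖ ≤ ‖M‖ * ‖WithLp.toLp 2 y‖ := by
  rw [← Matrix.mulVec_transpose, ← Matrix.frobenius_norm_transpose M]
  exact norm_toLp_mulVec_le _ _

theorem norm_sq_eq_sum_norm_row {m l : Type*} [Fintype m] [Fintype l] (M : Matrix m l ℝ) :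
    ‖M‖ ^ 2 = ∑ i, ‖WithLp.toLp 2 (M i)‖ ^ 2 := by
  rw [frobenius_norm_sq]
  refine Finset.sum_congr rfl fun i _ => ?_
  rw [norm_toLp_sq]
  simp [dotProduct, sq]

theorem norm_row_le {m l : Type*} [Fintype m] [Fintype l] (M : Matrix m l ℝ) (i : m) :
    ‖WithLp.toLp 2 (M i)‖ ≤ ‖M‖ := by
  refine abs_le_of_sq_le_sq' ?_ (by positivity) |>.2
  rw [norm_sq_eq_sum_norm_row]
  exact Finset.single_le_sum (f := fun i => ‖WithLp.toLp 2 (M i)‖ ^ 2)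
    (fun i _ => by positivity) (Finset.mem_univ i)

theorem HasSpectralGap.mul_norm_le (h : HasSpectralGap F δ) (y : Fin d → ℝ) :
    2 * δ * ‖WithLp.toLp 2 y‖ ≤ ‖WithLp.toLp 2 (y ᵥ* secondMoment F)‖ := by
  have hsymm : y ᵥ* secondMoment F = secondMoment F *ᵥ y := by
    rw [← Matrix.mulVec_transpose]
    congr 1
    simpa using (secondMoment_isHermitian F).eq
  rw [hsymm]
  have h1 := h.mul_le_quadratic y
  rw [← norm_toLp_sq] at h1
  have h2 : y ⬝ᵥ (secondMoment F *ᵥ y) ≤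
      ‖WithLp.toLp 2 y‖ * ‖WithLp.toLp 2 (secondMoment F *ᵥ y)‖ := by
    refine abs_le_of_sq_le_sq' ?_ (by positivity) |>.2
    rw [mul_pow, norm_toLp_sq, norm_toLp_sq]
    exact dotProduct_sq_le _ _
  rcases (norm_nonneg (WithLp.toLp 2 y)).eq_or_lt with h0 | h0
  · rw [← h0, mul_zero]; positivity
  · refine le_of_mul_le_mul_left ?_ h0
    calc _ = 2 * δ * ‖WithLp.toLp 2 y‖ ^ 2 := by ring
      _ ≤ _ := h1.trans h2

theorem norm_positionMatrix_le {x : Fin n → EuclideanSpace ℝ (Fin d)} (hx : ∀ i, ‖x i‖ ≤ 1) :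
    ‖positionMatrix x‖ ≤ √n := by
  refine Real.le_sqrt_of_sq_le ?_
  rw [norm_sq_eq_sum_norm_row]
  refine (Finset.sum_le_card_nsmul _ _ 1 fun i _ => ?_).trans (by simp)
  exact pow_le_one₀ (norm_nonneg _) (hx i)

theorem norm_secondMoment_le [IsProbabilityMeasure F] (hS : IsLatentSpace S)
    (hF : ∀ᵐ x ∂F, x ∈ S) : ‖secondMoment F‖ ≤ d := by
  refine abs_le_of_sq_le_sq' ?_ (by positivity) |>.2
  rw [frobenius_norm_sq]
  calc _ ≤ ∑ _k : Fin d, ∑ _l : Fin d, (1 : ℝ) := by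
        refine Finset.sum_le_sum fun k _ => Finset.sum_le_sum fun l _ => ?_
        rw [← sq_abs]
        exact pow_le_one₀ (abs_nonneg _) (abs_secondMoment_le_one hS hF k l)
    _ = _ := by simp; ring

/-- For typical samples with small noise, thresholding `|A|` at `δ n` keeps exactly the first `d`
eigenvalues. -/
theorem IsTypical.conj_hardThreshold_eq [IsProbabilityMeasure F]
    {x : Fin n → EuclideanSpace ℝ (Fin d)} {a : Matrix (Fin n) (Fin n) ℝ}
    (h : IsTypical F x a) (ha : a.IsSymm) (hgap : HasSpectralGap F δ) (hS : IsLatentSpace S)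
    (hF : ∀ᵐ x ∂F, x ∈ S) (hδ : 0 < δ) (hn0 : 0 < n) (hdn : d ≤ n)
    (hn : 3 * Real.log n ≤ δ ^ 4 * n / 4)
    {U : Matrix (Fin n) (Fin n) ℝ} {s : Fin n → ℝ} (hU : IsAbsEigendecomposition a U s)
    {W : Matrix (Fin d) (Fin d) ℝ} (hW : W ∈ Matrix.orthogonalGroup (Fin d) ℝ) :
    U * diagonal (fun b => hardThreshold (δ * n) (s b)) * Uᵀ =
      positionEstimate hdn U s W * (positionEstimate hdn U s W)ᵀ := by
  have hm : 0 < δ * n := by positivity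
  set E := U * diagonal (fun a => s a ^ 2) * Uᵀ - positionMatrix x * (positionMatrix x)ᵀ *
    (positionMatrix x * (positionMatrix x)ᵀ) with hE
  -- The factor `1/4` in the smallness assumption makes the constant `0.6 > 1/√3` instead of
  -- `1.155`, so that `1.42² - 0.6 ≥ 1 > 0.6` places the threshold `δn` inside the gap.
  have hEle : ‖E‖ ≤ 0.6 * (δ * n) ^ 2 := by
    refine abs_le_of_sq_le_sq' ?_ (by positivity) |>.2
    have h1 := h.2.2
    rw [frobNorm_eq_norm, hU.mul_self_eq ha, ← hE] at h1
    refine h1.trans ?_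
    have h2 : 4 / 3 * (n : ℝ) ^ 3 * (3 * Real.log n) ≤ 4 / 3 * (n : ℝ) ^ 3 * (δ ^ 4 * n / 4) := by
      gcongr
    have h3 : 0 < δ ^ 4 * (n : ℝ) ^ 4 := by positivity
    linarith
  have hsmall : 3 * Real.log n ≤ δ ^ 4 * n := by
    have : 0 ≤ δ ^ 4 * n := by positivity
    linarith
  have hquad := h.le_quadratic_of_log_le hgap hS hF hδ hsmall
  have hlow : ∀ b : Fin n, (b : ℕ) < d → δ * n ≤ s b := by
    intro b hb
    have h1 := sub_sq_le_norm_of_lt hdn hU.transpose_mul_self hU.antitone hU.nonneg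
      (by positivity) hquad hb
    refine abs_le_of_sq_le_sq' ?_ (hU.nonneg b) |>.2
    rw [← hE, mul_pow] at h1
    have := pow_pos hm 2
    linarith
  have hup : ∀ b : Fin n, ¬ (b : ℕ) < d → ¬ δ * n ≤ s b := by
    intro b hb hle
    have h1 := sq_le_norm_of_le hdn hU.transpose_mul_self hU.antitone hU.nonneg
      (positionMatrix x) (not_lt.1 hb)
    rw [← hE] at h1
    have h2 : (δ * n) ^ 2 ≤ s b ^ 2 := by gcongr
    have := pow_pos hm 2
    linarith
  have hext : (fun b => hardThreshold (δ * n) (s b)) =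
      zeroExtend n fun k => s (Fin.castLE hdn k) := by
    funext b
    unfold hardThreshold zeroExtend
    by_cases hb : (b : ℕ) < d
    · simp [hb, hlow b hb]
    · simp only [hb, hup b hb, if_false, dif_neg, not_false_eq_true]
  have hWW : W * Wᵀ = 1 := (Matrix.mem_orthogonalGroup_iff _ _).1 hW
  rw [hext, ← submatrix_castLE_mul_diagonal_mul_transpose hdn]
  have hsq : diagonal (fun k => s (Fin.castLE hdn k)) =
      diagonal (fun k => √(s (Fin.castLE hdn k))) * diagonal (fun k => √(s (Fin.castLE hdn k))) := by
    rw [Matrix.diagonal_mul_diagonal]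
    congr 1
    funext k
    exact (Real.mul_self_sqrt (hU.nonneg _)).symm
  unfold positionEstimate spectralEmbedding
  rw [hsq]
  simp only [Matrix.transpose_mul, Matrix.diagonal_transpose]
  symm
  calc _ = U.submatrix id (Fin.castLE hdn) * diagonal (fun k => √(s (Fin.castLE hdn k))) *
      (W * Wᵀ) * diagonal (fun k => √(s (Fin.castLE hdn k))) *
        (U.submatrix id (Fin.castLE hdn))ᵀ := by simp only [Matrix.mul_assoc]
    _ = _ := by rw [hWW, Matrix.mul_one]; simp only [Matrix.mul_assoc]

theorem IsTypical.norm_cross_sub_le {x : Fin n → EuclideanSpace ℝ (Fin d)}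
    {a : Matrix (Fin n) (Fin n) ℝ} (h : IsTypical F x a) (hn0 : 0 < n)
    {C : Matrix (Fin n) (Fin d) ℝ} {K : ℝ}
    (hC : ‖C - positionMatrix x‖ ≤ K * √(Real.log n)) :
    ‖Cᵀ * positionMatrix x - (n : ℝ) • secondMoment F‖ ≤ (K + 2 * d) * (√n * √(Real.log n)) := by
  have e : Cᵀ * positionMatrix x - (n : ℝ) • secondMoment F =
      (C - positionMatrix x)ᵀ * positionMatrix x +
        ((positionMatrix x)ᵀ * positionMatrix x - (n : ℝ) • secondMoment F) := by
    rw [Matrix.transpose_sub, Matrix.sub_mul]; abel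
  have h1 : ‖(C - positionMatrix x)ᵀ * positionMatrix x‖ ≤ K * √(Real.log n) * √n := by
    refine (Matrix.frobenius_norm_mul _ _).trans ?_
    rw [Matrix.frobenius_norm_transpose]
    exact mul_le_mul hC (norm_positionMatrix_le h.1) (norm_nonneg _)
      ((norm_nonneg _).trans hC)
  have h2 := h.norm_gram_sub_le
  rw [Real.sqrt_mul (by positivity)] at h2
  rw [e]
  refine (norm_add_le _ _).trans ?_
  linarith

/-- The last term is the error `C - X` times a well conditioned matrix; the first is of lower order
in a single row, since `CᵀX` is close to `nE[XXᵀ]`. -/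
theorem rowError_mul_transpose_eq (x : Fin n → EuclideanSpace ℝ (Fin d))
    (C : Matrix (Fin n) (Fin d) ℝ) :
    rowError F x (C * Cᵀ) = C * (Cᵀ * positionMatrix x - (n : ℝ) • secondMoment F) +
      (n : ℝ) • ((C - positionMatrix x) * secondMoment F) := by
  unfold rowError
  rw [Matrix.mul_sub, Matrix.sub_mul, smul_sub, Matrix.mul_smul, Matrix.mul_assoc]
  abel

theorem IsTypical.norm_rowError_le [IsProbabilityMeasure F] {x : Fin n → EuclideanSpace ℝ (Fin d)}
    {a : Matrix (Fin n) (Fin n) ℝ} (h : IsTypical F x a) (hS : IsLatentSpace S)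
    (hF : ∀ᵐ x ∂F, x ∈ S) (hn0 : 0 < n)
    {C : Matrix (Fin n) (Fin d) ℝ} {K : ℝ} (hK : 0 ≤ K)
    (hC : ‖C - positionMatrix x‖ ≤ K * √(Real.log n)) :
    ‖rowError F x (C * Cᵀ)‖ ≤ ((1 + K) * (K + 2 * d) + K * d) * (n * √(Real.log n)) := by
  have hT := h.norm_cross_sub_le hn0 hC
  have hlogn : √(Real.log n) ≤ √n := by
    apply Real.sqrt_le_sqrt
    exact (Real.log_le_sub_one_of_pos (by exact_mod_cast hn0)).trans (by linarith)
  have hCn : ‖C‖ ≤ (1 + K) * √n := by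
    have h1 : ‖C‖ ≤ ‖C - positionMatrix x‖ + ‖positionMatrix x‖ := by
      simpa using norm_add_le (C - positionMatrix x) (positionMatrix x)
    have h2 := norm_positionMatrix_le h.1
    have h3 : K * √(Real.log n) ≤ K * √n := by gcongr
    linarith
  have hnn : √(n : ℝ) * √n = n := Real.mul_self_sqrt (by positivity)
  rw [rowError_mul_transpose_eq]
  have h1 : ‖C * (Cᵀ * positionMatrix x - (n : ℝ) • secondMoment F)‖ ≤
      (1 + K) * √n * ((K + 2 * d) * (√n * √(Real.log n))) :=
    (Matrix.frobenius_norm_mul _ _).trans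
      (mul_le_mul hCn hT (norm_nonneg _) (by positivity))
  have h2 : ‖(n : ℝ) • ((C - positionMatrix x) * secondMoment F)‖ ≤
      n * (K * √(Real.log n) * d) := by
    rw [norm_smul, Real.norm_of_nonneg (by positivity)]
    gcongr
    exact (Matrix.frobenius_norm_mul _ _).trans
      (mul_le_mul hC (norm_secondMoment_le hS hF) (norm_nonneg _) (by positivity))
  refine (norm_add_le _ _).trans ((add_le_add h1 h2).trans (le_of_eq ?_))
  calc _ = (1 + K) * (K + 2 * d) * ((√n * √n) * √(Real.log n)) + K * d * (n * √(Real.log n)) := by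
        ring
    _ = _ := by rw [hnn]; ring

/-- If row `i` of `C` is far from the position, then the row error is large. -/
theorem IsTypical.lt_norm_rowError {x : Fin n → EuclideanSpace ℝ (Fin d)}
    {a : Matrix (Fin n) (Fin n) ℝ} (h : IsTypical F x a) (hgap : HasSpectralGap F δ)
    (hδ : 0 < δ) (hn0 : 0 < n) (hlog : 1 ≤ Real.log n)
    {C : Matrix (Fin n) (Fin d) ℝ} {K r : ℝ} (hK : 0 ≤ K)
    (hC : ‖C - positionMatrix x‖ ≤ K * √(Real.log n))
    (hr : (K + 2 * d) * (1 + K) * (√n * Real.log n) ≤ δ * n * r) {i : Fin n}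
    (hi : r < ‖WithLp.toLp 2 ((C - positionMatrix x) i)‖) :
    δ * n * r < ‖WithLp.toLp 2 (rowError F x (C * Cᵀ) i)‖ := by
  have hn0' : (0 : ℝ) < n := by exact_mod_cast hn0
  set T := Cᵀ * positionMatrix x - (n : ℝ) • secondMoment F with hT
  have hTn : ‖T‖ ≤ _ := h.norm_cross_sub_le hn0 hC
  have hsq1 : 1 ≤ √(Real.log n) := Real.one_le_sqrt.2 hlog
  have hCi : ‖WithLp.toLp 2 (C i)‖ ≤ (1 + K) * √(Real.log n) := by
    have e : WithLp.toLp 2 (C i) = WithLp.toLp 2 ((C - positionMatrix x) i) + x i := by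
      ext k; simp [positionMatrix]
    rw [e]
    refine (norm_add_le _ _).trans ?_
    have h1 := (norm_row_le (C - positionMatrix x) i).trans hC
    have h2 := h.1 i
    linarith
  have hrow : WithLp.toLp 2 (rowError F x (C * Cᵀ) i) =
      WithLp.toLp 2 (C i ᵥ* T) +
        (n : ℝ) • WithLp.toLp 2 ((C - positionMatrix x) i ᵥ* secondMoment F) := by
    rw [rowError_mul_transpose_eq]
    ext k
    simp [Matrix.mul_apply, Matrix.vecMul, dotProduct, hT]
  have h1 := hgap.mul_norm_le ((C - positionMatrix x) i)
  have h2 : ‖WithLp.toLp 2 (C i ᵥ* T)‖ ≤ δ * n * r := by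
    -- One factor `√(log n)` comes from `T` and one from the crude bound on row `i` of `C` by its
    -- Frobenius error; `r` is assumed large enough to absorb `√n log n`.
    refine le_trans ((norm_toLp_vecMul_le T (C i)).trans
      (mul_le_mul hTn hCi (norm_nonneg _) (by positivity))) (le_trans (le_of_eq ?_) hr)
    calc _ = (K + 2 * d) * (1 + K) * (√n * (√(Real.log n) * √(Real.log n))) := by ring
      _ = _ := by rw [Real.mul_self_sqrt (by linarith)]
  have h3 : n * (2 * δ * ‖WithLp.toLp 2 ((C - positionMatrix x) i)‖) ≤
      ‖(n : ℝ) • WithLp.toLp 2 ((C - positionMatrix x) i ᵥ* secondMoment F)‖ := by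
    rw [norm_smul, Real.norm_of_nonneg hn0'.le]
    gcongr
  have h4 : δ * n * r < δ * n * ‖WithLp.toLp 2 ((C - positionMatrix x) i)‖ := by gcongr
  have h5 : ‖(n : ℝ) • WithLp.toLp 2 ((C - positionMatrix x) i ᵥ* secondMoment F)‖ ≤
      ‖WithLp.toLp 2 (rowError F x (C * Cᵀ) i)‖ + ‖WithLp.toLp 2 (C i ᵥ* T)‖ := by
    rw [hrow]
    have := norm_sub_le (WithLp.toLp 2 (C i ᵥ* T) +
        (n : ℝ) • WithLp.toLp 2 ((C - positionMatrix x) i ᵥ* secondMoment F))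
        (WithLp.toLp 2 (C i ᵥ* T))
    rwa [add_sub_cancel_left] at this
  linarith

/-- Rows of the estimate have squared norm at most `n`. -/
theorem IsAbsEigendecomposition.norm_row_sq_le {A U : Matrix (Fin n) (Fin n) ℝ} {s : Fin n → ℝ}
    (h : IsAbsEigendecomposition A U s) (hA : A.IsSymm) (hA1 : ∀ i j, A i j = 0 ∨ A i j = 1)
    (hdn : d ≤ n) {W : Matrix (Fin d) (Fin d) ℝ} (hW : W ∈ Matrix.orthogonalGroup (Fin d) ℝ)
    (i : Fin n) : ‖WithLp.toLp 2 (positionEstimate hdn U s W i)‖ ^ 2 ≤ n := by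
  have hWW : W * Wᵀ = 1 := (Matrix.mem_orthogonalGroup_iff _ _).1 hW
  have hUU : U * Uᵀ = 1 := (Matrix.mem_orthogonalGroup_iff _ _).1 h.orthogonal
  -- The sum is `tr(A²)`, and the entries of `A` are `0` or `1`.
  have htr : ∑ b, s b ^ 2 ≤ (n : ℝ) ^ 2 := by
    have h1 : (A * A).trace = ∑ b, s b ^ 2 := by
      rw [h.mul_self_eq hA, Matrix.trace_mul_comm, ← Matrix.mul_assoc, h.transpose_mul_self,
        Matrix.one_mul]
      simp [Matrix.trace]
    rw [← h1]
    calc (A * A).trace ≤ ∑ _i : Fin n, ∑ _j : Fin n, (1 : ℝ) := by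
          refine Finset.sum_le_sum fun i _ => ?_
          rw [Matrix.diag_apply, Matrix.mul_apply]
          refine Finset.sum_le_sum fun j _ => ?_
          rcases hA1 i j with h1 | h1 <;> rcases hA1 j i with h2 | h2 <;> simp [h1, h2]
      _ = _ := by simp; ring
  have hs : ∀ b, s b ≤ n := by
    intro b
    refine abs_le_of_sq_le_sq' ?_ (by positivity) |>.2
    exact (Finset.single_le_sum (f := fun b => s b ^ 2) (fun b _ => sq_nonneg _)
      (Finset.mem_univ b)).trans htr
  have hrow : (positionEstimate hdn U s W * (positionEstimate hdn U s W)ᵀ) i i =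
      ‖WithLp.toLp 2 (positionEstimate hdn U s W i)‖ ^ 2 := by
    rw [norm_toLp_sq, Matrix.mul_apply]; rfl
  rw [← hrow]
  unfold positionEstimate
  rw [Matrix.transpose_mul, Matrix.mul_assoc, ← Matrix.mul_assoc W, hWW, Matrix.one_mul,
    Matrix.mul_apply]
  unfold spectralEmbedding
  simp only [Matrix.transpose_apply, Matrix.mul_diagonal, Matrix.submatrix_apply, id]
  calc _ ≤ ∑ k : Fin d, n * (U i (Fin.castLE hdn k)) ^ 2 := by
        refine Finset.sum_le_sum fun k _ => ?_
        have e : U i (Fin.castLE hdn k) * √(s (Fin.castLE hdn k)) *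
            (U i (Fin.castLE hdn k) * √(s (Fin.castLE hdn k))) =
            s (Fin.castLE hdn k) * U i (Fin.castLE hdn k) ^ 2 := by
          rw [mul_mul_mul_comm, Real.mul_self_sqrt (h.nonneg _)]; ring
        rw [e]
        gcongr
        exact hs _
    _ = n * ∑ k : Fin d, (U i (Fin.castLE hdn k)) ^ 2 := by rw [Finset.mul_sum]
    _ ≤ n * ∑ b, U i b ^ 2 := by
        gcongr
        have := Finset.sum_le_sum_of_subset_of_nonneg
          (Finset.subset_univ (Finset.univ.map (Fin.castLEEmb hdn)))
          (f := fun b => U i b ^ 2) fun b _ _ => sq_nonneg _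
        simpa using this
    _ = n := by
        have := congrFun (congrFun hUU i) i
        rw [Matrix.mul_apply] at this
        simp only [Matrix.transpose_apply, ← sq, Matrix.one_apply_eq] at this
        rw [this, mul_one]

end RowError

/-! ### Exchangeability of the rows -/

section Exchangeability

variable {d n : ℕ} {Ω : Type*} [MeasurableSpace Ω] {F : Measure (EuclideanSpace ℝ (Fin d))}
  {μ : Measure Ω} {X : Fin n → Ω → EuclideanSpace ℝ (Fin d)} {A : Ω → Matrix (Fin n) (Fin n) ℝ}
  {S : Set (EuclideanSpace ℝ (Fin d))} {δ : ℝ}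

theorem prod_lt_perm {n : ℕ} {M : Type*} [CommMonoid M] (π : Equiv.Perm (Fin n))
    (g : Fin n → Fin n → M) (hg : ∀ i j, g i j = g j i) :
    ∏ p : Fin n × Fin n with p.1 < p.2, g (π p.1) (π p.2) =
      ∏ p : Fin n × Fin n with p.1 < p.2, g p.1 p.2 := by
  have hmem : ∀ (ρ : Equiv.Perm (Fin n)) (p : Fin n × Fin n), p.1 < p.2 →
      (if ρ p.1 < ρ p.2 then (ρ p.1, ρ p.2) else (ρ p.2, ρ p.1)).1 <
        (if ρ p.1 < ρ p.2 then (ρ p.1, ρ p.2) else (ρ p.2, ρ p.1)).2 := by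
    intro ρ p hp
    split_ifs with h
    · exact h
    · exact lt_of_le_of_ne (not_lt.1 h) fun he => hp.ne' (ρ.injective he)
  have hinv : ∀ (ρ : Equiv.Perm (Fin n)) (p : Fin n × Fin n), p.1 < p.2 →
      (fun q : Fin n × Fin n =>
        if ρ.symm q.1 < ρ.symm q.2 then (ρ.symm q.1, ρ.symm q.2) else (ρ.symm q.2, ρ.symm q.1))
        (if ρ p.1 < ρ p.2 then (ρ p.1, ρ p.2) else (ρ p.2, ρ p.1)) = p := by
    intro ρ p hp
    split_ifs with h <;> simp [hp, hp.not_gt]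
  refine Finset.prod_bij'
    (fun p _ => if π p.1 < π p.2 then (π p.1, π p.2) else (π p.2, π p.1))
    (fun q _ => if π.symm q.1 < π.symm q.2 then (π.symm q.1, π.symm q.2)
      else (π.symm q.2, π.symm q.1)) ?_ ?_ ?_ ?_ ?_
  · intro p hp
    simpa using hmem π p (by simpa using hp)
  · intro p hp
    simpa using hmem π.symm p (by simpa using hp)
  · intro p hp
    exact hinv π p (by simpa using hp)
  · intro p hp
    exact hinv π.symm p (by simpa using hp)
  · intro p hp
    split_ifs
    · rfl
    · exact hg _ _

/-- Relabelling the vertices of a random dot product graph. -/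
theorem IsRDPG.perm (h : IsRDPG F μ X A) (π : Equiv.Perm (Fin n)) :
    IsRDPG F μ (fun i => X (π i)) (fun ω => (A ω).submatrix π π) where
  measurable_position i := h.measurable_position _
  indep := h.indep.precomp π.injective
  law i := h.law _
  measurable_entry i j := h.measurable_entry _ _
  zero_or_one ω i j := h.zero_or_one ω _ _
  symm ω := (h.symm ω).submatrix π
  hollow ω i := h.hollow ω _
  cond_law B hB a := by
    -- Only the values of `a` above the diagonal matter, and `π` may reverse a pair; `a'` transports
    -- these values and is symmetric.
    set a' : Fin n → Fin n → Bool := fun k l =>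
      if π.symm k < π.symm l then a (π.symm k) (π.symm l) else a (π.symm l) (π.symm k) with ha'
    have ha'π : ∀ i j, i < j → a' (π i) (π j) = a i j := by
      intro i j hij; simp [ha', hij]
    have ha'symm : ∀ k l, k ≠ l → a' k l = a' l k := by
      intro k l hkl
      rcases lt_or_gt_of_ne (fun he => hkl (π.symm.injective he) : π.symm k ≠ π.symm l) with h1 | h1
      · simp [ha', h1, h1.not_gt]
      · simp [ha', h1, h1.not_gt]
    have hB' : MeasurableSet {x : Fin n → EuclideanSpace ℝ (Fin d) | (fun i => x (π i)) ∈ B} :=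
      (measurable_pi_lambda _ fun i => measurable_pi_apply (π i)) hB
    have key := h.cond_law _ hB' a'
    have hset : {ω | ∀ i j, i < j → (A ω).submatrix π π i j = if a i j then 1 else 0} =
        {ω | ∀ k l, k < l → A ω k l = if a' k l then 1 else 0} := by
      ext ω
      simp only [Set.mem_ofPred_eq, Matrix.submatrix_apply]
      constructor
      · intro hω k l hkl
        rcases lt_or_gt_of_ne (fun he => hkl.ne (π.symm.injective he) : π.symm k ≠ π.symm l)
          with h1 | h1
        · have := hω _ _ h1
          rw [← ha'π _ _ h1] at this
          simpa using this
        · have := hω _ _ h1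
          rw [← ha'π _ _ h1] at this
          simp only [Equiv.apply_symm_apply] at this
          rw [ha'symm k l hkl.ne, ← this]
          exact (h.symm ω).apply l k
      · intro hω i j hij
        rw [← ha'π i j hij]
        rcases lt_or_gt_of_ne (fun he => hij.ne (π.injective he) : π i ≠ π j) with h1 | h1
        · exact hω _ _ h1
        · rw [ha'symm _ _ h1.ne', ← hω _ _ h1]
          exact (h.symm ω).apply _ _
    rw [hset]
    refine key.trans (lintegral_congr fun ω => ?_)
    set g : Fin n → Fin n → ENNReal := fun k l => if k = l then 1 else
      ENNReal.ofReal (if a' k l then inner ℝ (X k ω) (X l ω) else 1 - inner ℝ (X k ω) (X l ω))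
      with hg
    have hgs : ∀ k l, g k l = g l k := by
      intro k l
      by_cases hkl : k = l
      · rw [hkl]
      · simp only [hg, hkl, Ne.symm hkl, if_false, ha'symm k l hkl, real_inner_comm (X l ω)]
    have := prod_lt_perm π g hgs
    refine Eq.trans ?_ (this.symm.trans ?_)
    · refine Finset.prod_congr rfl fun p hp => ?_
      have : p.1 < p.2 := by simpa using hp
      simp [hg, this.ne]
    · refine Finset.prod_congr rfl fun p hp => ?_
      have : p.1 < p.2 := by simpa using hp
      simp [hg, this.ne, ha'π _ _ this]

theorem IsTypical.perm {x : Fin n → EuclideanSpace ℝ (Fin d)} {a : Matrix (Fin n) (Fin n) ℝ}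
    (h : IsTypical F x a) (π : Equiv.Perm (Fin n)) :
    IsTypical F (fun i => x (π i)) (a.submatrix π π) := by
  refine ⟨fun i => h.1 _, fun k l => ?_, ?_⟩
  · rw [Equiv.sum_comp π fun i => x i k * x i l]
    exact h.2.1 k l
  · have e : a.submatrix π π * a.submatrix π π - positionMatrix (fun i => x (π i)) *
        (positionMatrix fun i => x (π i))ᵀ * (positionMatrix (fun i => x (π i)) *
          (positionMatrix fun i => x (π i))ᵀ) =
        (a * a - positionMatrix x * (positionMatrix x)ᵀ *
          (positionMatrix x * (positionMatrix x)ᵀ)).submatrix π π := by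
      have h1 : positionMatrix (fun i => x (π i)) * (positionMatrix fun i => x (π i))ᵀ =
          (positionMatrix x * (positionMatrix x)ᵀ).submatrix π π := rfl
      rw [h1, Matrix.submatrix_mul_equiv, Matrix.submatrix_mul_equiv]
      rfl
    rw [e]
    refine le_trans (le_of_eq ?_) h.2.2
    rw [frobNorm_sq, frobNorm_sq]
    simp only [Matrix.submatrix_apply]
    rw [Equiv.sum_comp π fun i => ∑ j, (a * a - positionMatrix x * (positionMatrix x)ᵀ *
          (positionMatrix x * (positionMatrix x)ᵀ)) i (π j) ^ 2]
    exact Finset.sum_congr rfl fun i _ => Equiv.sum_comp π fun j =>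
      (a * a - positionMatrix x * (positionMatrix x)ᵀ *
          (positionMatrix x * (positionMatrix x)ᵀ)) i j ^ 2

theorem rowError_perm (x : Fin n → EuclideanSpace ℝ (Fin d)) (Y : Matrix (Fin n) (Fin n) ℝ)
    (π : Equiv.Perm (Fin n)) :
    rowError F (fun i => x (π i)) (Y.submatrix π π) = (rowError F x Y).submatrix π id := by
  unfold rowError
  have h1 : Y.submatrix π π * positionMatrix (fun i => x (π i)) =
      (Y * positionMatrix x).submatrix π id := by
    have : positionMatrix (fun i => x (π i)) = (positionMatrix x).submatrix π id := rfl
    rw [this, Matrix.submatrix_mul_equiv]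
  rw [h1]
  rfl

/-- The sample is typical, and row `i` of the row error of the thresholded `|A|` exceeds `τ`. -/
def RowDeviates (F : Measure (EuclideanSpace ℝ (Fin d))) (θ τ : ℝ) (i : Fin n)
    (x : Fin n → EuclideanSpace ℝ (Fin d)) (a : Matrix (Fin n) (Fin n) ℝ) : Prop :=
  IsTypical F x a ∧ ∃ U s, IsAbsEigendecomposition a U s ∧
    τ < ‖WithLp.toLp 2 (rowError F x (U * diagonal (fun b => hardThreshold θ (s b)) * Uᵀ) i)‖

theorem RowDeviates.perm {θ τ : ℝ} {i : Fin n} {x : Fin n → EuclideanSpace ℝ (Fin d)}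
    {a : Matrix (Fin n) (Fin n) ℝ} {π : Equiv.Perm (Fin n)} (h : RowDeviates F θ τ (π i) x a) :
    RowDeviates F θ τ i (fun i => x (π i)) (a.submatrix π π) := by
  obtain ⟨h1, U, s, hU, hlt⟩ := h
  refine ⟨h1.perm π, U.submatrix π id, s, hU.submatrix π, ?_⟩
  rw [IsAbsEigendecomposition.conj_threshold_submatrix, rowError_perm]
  exact hlt

theorem RowDeviates.lt_norm {θ τ : ℝ} {i : Fin n} {x : Fin n → EuclideanSpace ℝ (Fin d)}
    {a : Matrix (Fin n) (Fin n) ℝ} (h : RowDeviates F θ τ i x a) {U : Matrix (Fin n) (Fin n) ℝ}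
    {s : Fin n → ℝ} (hU : IsAbsEigendecomposition a U s) :
    τ < ‖WithLp.toLp 2
      (rowError F x (U * diagonal (fun b => hardThreshold θ (s b)) * Uᵀ) i)‖ := by
  obtain ⟨-, U', s', hU', hlt⟩ := h
  rwa [conj_diagonal_comp_eq hU'.transpose_mul_self hU.transpose_mul_self
    (hU'.eq.symm.trans hU.eq)] at hlt

/-- For a fixed graph one eigendecomposition decides the existential condition, which is then open
in the positions. -/
theorem measurableSet_rowDeviates (θ τ : ℝ) (i : Fin n) (a : Matrix (Fin n) (Fin n) ℝ) :
    MeasurableSet {x | RowDeviates F θ τ i x a} := by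
  by_cases h : ∃ U s, IsAbsEigendecomposition a U s
  · obtain ⟨U, s, hU⟩ := h
    have : {x | RowDeviates F θ τ i x a} = {x | IsTypical F x a} ∩
        {x | τ < ‖WithLp.toLp 2
          (rowError F x (U * diagonal (fun b => hardThreshold θ (s b)) * Uᵀ) i)‖} := by
      ext x
      exact ⟨fun hx => ⟨hx.1, hx.lt_norm hU⟩, fun hx => ⟨hx.1, U, s, hU, hx.2⟩⟩
    rw [this]
    refine (measurableSet_isTypical F a).inter (IsOpen.measurableSet ?_)
    refine isOpen_lt continuous_const (Continuous.norm ?_)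
    refine (PiLp.continuous_toLp 2 _).comp ?_
    have hc := continuous_positionMatrix (d := d) (n := n)
    have : Continuous fun x => rowError F x
        (U * diagonal (fun b => hardThreshold θ (s b)) * Uᵀ) := by
      unfold rowError
      fun_prop
    exact (continuous_apply i).comp this
  · convert MeasurableSet.empty
    ext x
    simp only [Set.mem_ofPred_eq, Set.mem_empty_iff_false, iff_false]
    rintro ⟨-, U, s, hU, -⟩
    exact h ⟨U, s, hU⟩

theorem IsRDPG.measurableSet_rowDeviates (h : IsRDPG F μ X A) (θ τ : ℝ) (i : Fin n) :
    MeasurableSet {ω | RowDeviates F θ τ i (fun i => X i ω) (A ω)} :=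
  h.measurableSet_setOf (R := RowDeviates F θ τ i) fun _ => _root_.measurableSet_rowDeviates θ τ i _

theorem IsRDPG.measure_rowDeviates_eq [IsProbabilityMeasure μ] (h : IsRDPG F μ X A) (θ τ : ℝ)
    (i j : Fin n) :
    μ {ω | RowDeviates F θ τ i (fun i => X i ω) (A ω)} =
      μ {ω | RowDeviates F θ τ j (fun i => X i ω) (A ω)} := by
  have key : ∀ i j, μ {ω | RowDeviates F θ τ i (fun i => X i ω) (A ω)} ≤
      μ {ω | RowDeviates F θ τ j (fun i => X i ω) (A ω)} := by
    intro i j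
    have h1 := h.measure_setOf (R := RowDeviates F θ τ j) fun _ =>
      _root_.measurableSet_rowDeviates θ τ j _
    have h2 := (h.perm (Equiv.swap i j)).measure_setOf (R := RowDeviates F θ τ j) fun _ =>
      _root_.measurableSet_rowDeviates θ τ j _
    -- The original and the relabelled graph have the same joint law, and swapping `i` with `j`
    -- carries deviation of row `i` to row `j`.
    refine le_trans (measure_mono fun ω hω => ?_) (h2.trans h1.symm).le
    have hω' : RowDeviates F θ τ (Equiv.swap i j j) (fun i => X i ω) (A ω) := by
      rw [Equiv.swap_apply_right]; exact hω
    exact hω'.perm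
  exact le_antisymm (key i j) (key j i)

/-- Markov's inequality, averaged over the exchangeable rows. -/
theorem IsRDPG.measureReal_rowDeviates_le [IsProbabilityMeasure μ] (h : IsRDPG F μ X A)
    {θ τ R : ℝ} (hτ : 0 < τ) (hR : 0 ≤ R) {U : Ω → Matrix (Fin n) (Fin n) ℝ} {s : Ω → Fin n → ℝ}
    (hU : ∀ ω, IsAbsEigendecomposition (A ω) (U ω) (s ω))
    (hle : ∀ ω, IsTypical F (fun i => X i ω) (A ω) → ∑ i, ‖WithLp.toLp 2
      (rowError F (fun i => X i ω)
        (U ω * diagonal (fun b => hardThreshold θ (s ω b)) * (U ω)ᵀ) i)‖ ^ 2 ≤ R)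
    (i : Fin n) :
    n * μ.real {ω | RowDeviates F θ τ i (fun i => X i ω) (A ω)} ≤ R / τ ^ 2 := by
  have hsum : (n : ENNReal) * μ {ω | RowDeviates F θ τ i (fun i => X i ω) (A ω)} ≤
      ENNReal.ofReal (R / τ ^ 2) := by
    calc _ = ∑ j : Fin n, μ {ω | RowDeviates F θ τ j (fun i => X i ω) (A ω)} := by
          simp only [h.measure_rowDeviates_eq θ τ _ i]
          simp
      _ = ∑ j : Fin n, ∫⁻ ω,
          {ω | RowDeviates F θ τ j (fun i => X i ω) (A ω)}.indicator 1 ω ∂μ := by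
          refine Finset.sum_congr rfl fun j _ => ?_
          rw [lintegral_indicator_one (h.measurableSet_rowDeviates θ τ j)]
      _ = ∫⁻ ω, ∑ j : Fin n,
          {ω | RowDeviates F θ τ j (fun i => X i ω) (A ω)}.indicator 1 ω ∂μ := by
          rw [lintegral_finsetSum]
          exact fun j _ => measurable_one.indicator (h.measurableSet_rowDeviates θ τ j)
      -- Pointwise, the number of deviating rows is at most the sum of their squared errors over
      -- `τ²`; no row deviates outside the typical event. This avoids integrating the choices `U`
      -- and `s`, which need not be measurable.
      _ ≤ ∫⁻ _, ENNReal.ofReal (R / τ ^ 2) ∂μ := by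
          refine lintegral_mono fun ω => ?_
          by_cases ht : IsTypical F (fun i => X i ω) (A ω)
          · have hb := hle ω ht
            set D := rowError F (fun i => X i ω)
              (U ω * diagonal (fun b => hardThreshold θ (s ω b)) * (U ω)ᵀ)
            calc _ ≤ ∑ j : Fin n, ENNReal.ofReal (‖WithLp.toLp 2 (D j)‖ ^ 2 / τ ^ 2) := by
                  refine Finset.sum_le_sum fun j _ => ?_
                  by_cases hj : RowDeviates F θ τ j (fun i => X i ω) (A ω)
                  · have hlt := hj.lt_norm (hU ω)
                    rw [Set.indicator_of_mem (by exact hj), Pi.one_apply, ← ENNReal.ofReal_one]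
                    refine ENNReal.ofReal_le_ofReal ?_
                    rw [one_le_div (by positivity)]
                    gcongr
                  · rw [Set.indicator_of_notMem (by exact hj)]
                    exact zero_le
              _ = ENNReal.ofReal (∑ j : Fin n, ‖WithLp.toLp 2 (D j)‖ ^ 2 / τ ^ 2) := by
                  rw [ENNReal.ofReal_sum_of_nonneg fun j _ => by positivity]
              _ ≤ _ := by
                  refine ENNReal.ofReal_le_ofReal ?_
                  rw [← Finset.sum_div]
                  gcongr
          · have : ∀ j : Fin n, {ω | RowDeviates F θ τ j (fun i => X i ω) (A ω)}.indicator
                (1 : Ω → ENNReal) ω = 0 := fun j =>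
              Set.indicator_of_notMem (fun hj => ht hj.1) _
            simp only [this, Finset.sum_const_zero]
            exact zero_le
      _ = _ := by simp
  have := ENNReal.toReal_mono ENNReal.ofReal_ne_top hsum
  rwa [ENNReal.toReal_mul, ENNReal.toReal_natCast, ENNReal.toReal_ofReal (by positivity)] at this

end Exchangeability

/-! ### Consistency of individual rows -/

section RowConsistency

open scoped Matrix.Norms.Frobenius
open Filter

variable {d n : ℕ} {Ω : Type*} [MeasurableSpace Ω] {F : Measure (EuclideanSpace ℝ (Fin d))}
  {μ : Measure Ω} {X : Fin n → Ω → EuclideanSpace ℝ (Fin d)} {A : Ω → Matrix (Fin n) (Fin n) ℝ}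
  {S : Set (EuclideanSpace ℝ (Fin d))} {δ : ℝ}

theorem Aligns.norm_sub_le {hdn : d ≤ n} {U : Matrix (Fin n) (Fin n) ℝ} {s : Fin n → ℝ}
    {x : Fin n → EuclideanSpace ℝ (Fin d)} {W : Matrix (Fin d) (Fin d) ℝ}
    (h : Aligns δ hdn U s x W) (hδ : 0 < δ) :
    ‖positionEstimate hdn U s W - positionMatrix x‖ ≤
      2 * d * √(3 / δ ^ 3) * √(Real.log n) := by
  have e : 3 * Real.log n / δ ^ 3 = 3 / δ ^ 3 * Real.log n := by ring
  refine h.trans (le_of_eq ?_)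
  rw [e, Real.sqrt_mul (by positivity)]
  ring

theorem eventually_mul_log_le (a : ℝ) {b r : ℝ} (hb : 0 < b) (hr : 0 < r) :
    ∀ᶠ n : ℕ in atTop, a * Real.log n ≤ b * (n : ℝ) ^ r := by
  have h1 := (isLittleO_log_rpow_atTop hr).def (c := b / (|a| + 1)) (by positivity)
  filter_upwards [tendsto_natCast_atTop_atTop.eventually h1, eventually_ge_atTop 1] with n hn hn1
  have hn1' : (1 : ℝ) ≤ n := by exact_mod_cast hn1
  have hlog := Real.log_nonneg hn1'
  rw [Real.norm_of_nonneg hlog, Real.norm_of_nonneg (by positivity), div_mul_eq_mul_div,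
    le_div_iff₀ (by positivity)] at hn
  have h2 : a * Real.log n ≤ |a| * Real.log n := by gcongr; exact le_abs_self a
  linarith

/-- Consistency of each row of the estimate, for sufficiently large samples. -/
theorem IsRDPG.measureReal_row_error_le [IsProbabilityMeasure F] [IsProbabilityMeasure μ]
    (h : IsRDPG F μ X A) (hδ : 0 < δ) (hd : 1 ≤ d) (hdn : d ≤ n) (hS : IsLatentSpace S)
    (hF : ∀ᵐ x ∂F, x ∈ S) (hgap : HasSpectralGap F δ) {γ K : ℝ}
    (hK : K = 2 * d * √(3 / δ ^ 3))
    (hlog : 1 ≤ Real.log n) (hsmall : 3 * Real.log n ≤ δ ^ 4 * n / 4)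
    (hrow : (K + 2 * d) * (1 + K) * (√n * Real.log n) ≤ δ * n * (n : ℝ) ^ (-γ / 2))
    (hneg : γ < -1 → 4 * (n : ℝ) ≤ (n : ℝ) ^ (-γ))
    {U : Ω → Matrix (Fin n) (Fin n) ℝ} {s : Ω → Fin n → ℝ}
    (hU : ∀ ω, IsAbsEigendecomposition (A ω) (U ω) (s ω))
    {W : Ω → Matrix (Fin d) (Fin d) ℝ} (hW : ∀ ω, W ω ∈ Matrix.orthogonalGroup (Fin d) ℝ)
    (hal : ∀ ω, (∃ W' ∈ Matrix.orthogonalGroup (Fin d) ℝ,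
        Aligns δ hdn (U ω) (s ω) (fun i => X i ω) W') →
      Aligns δ hdn (U ω) (s ω) (fun i => X i ω) (W ω)) (i : Fin n) :
    μ.real {ω | (n : ℝ) ^ (-γ) <
        ‖WithLp.toLp 2 (positionEstimate hdn (U ω) (s ω) (W ω) i) - X i ω‖ ^ 2} ≤
      ((((1 + K) * (K + 2 * d) + K * d) / δ) ^ 2 + 2 * ((d : ℝ) ^ 2 + 1)) *
        ((n : ℝ) ^ (γ - 1) * Real.log n) := by
  have hn0 : 0 < n := hd.trans hdn
  have hn0' : (0 : ℝ) < n := by exact_mod_cast hn0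
  have hn1' : (1 : ℝ) ≤ n := by exact_mod_cast hn0
  have hK0 : 0 ≤ K := by rw [hK]; positivity
  -- For `γ < -1` the atypical probability, of order `n⁻²`, is too large for the claim. But then
  -- `n^(-γ) ≥ 4n`, which the squared error of a row almost surely does not exceed.
  rcases lt_or_ge γ (-1) with hγ | hγ
  · have hnull : μ {ω | ¬ ∀ i, X i ω ∈ S} = 0 := ae_iff.1 (h.ae_mem hF)
    have hsub : {ω | (n : ℝ) ^ (-γ) <
        ‖WithLp.toLp 2 (positionEstimate hdn (U ω) (s ω) (W ω) i) - X i ω‖ ^ 2} ⊆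
        {ω | ¬ ∀ i, X i ω ∈ S} := by
      intro ω hω hmem
      have h1 := (hU ω).norm_row_sq_le (h.symm ω) (h.zero_or_one ω) hdn (hW ω) i
      have h2 := IsRDPG.norm_le_one hS (hmem i)
      have h3 := norm_sub_le (WithLp.toLp 2 (positionEstimate hdn (U ω) (s ω) (W ω) i)) (X i ω)
      have h4 : ‖WithLp.toLp 2 (positionEstimate hdn (U ω) (s ω) (W ω) i)‖ ≤ √n :=
        Real.le_sqrt_of_sq_le h1
      have h5 : (1 : ℝ) ≤ √n := Real.one_le_sqrt.2 hn1'
      have h6 : ‖WithLp.toLp 2 (positionEstimate hdn (U ω) (s ω) (W ω) i) - X i ω‖ ^ 2 ≤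
          (2 * √n) ^ 2 := by
        gcongr; linarith
      rw [mul_pow, Real.sq_sqrt hn0'.le] at h6
      have := hneg hγ
      have h7 : (n : ℝ) ^ (-γ) <
        ‖WithLp.toLp 2 (positionEstimate hdn (U ω) (s ω) (W ω) i) - X i ω‖ ^ 2 := hω
      linarith
    rw [measureReal_def, measure_mono_null hsub hnull, ENNReal.toReal_zero]
    positivity
  have hn2 : 2 ≤ n := by
    by_contra hlt
    have : n = 1 := by omega
    rw [this] at hlog
    norm_num at hlog
  set K₁ := (1 + K) * (K + 2 * d) + K * d with hK₁
  set r := (n : ℝ) ^ (-γ / 2) with hr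
  have hr2 : r ^ 2 = (n : ℝ) ^ (-γ) := by
    rw [hr, ← Real.rpow_natCast, ← Real.rpow_mul hn0'.le]
    congr 1
    push_cast
    ring
  -- The event on the left involves arbitrary choices and need not be measurable; only its inclusion
  -- in events of controlled measure is used.
  have hsub : {ω | (n : ℝ) ^ (-γ) <
      ‖WithLp.toLp 2 (positionEstimate hdn (U ω) (s ω) (W ω) i) - X i ω‖ ^ 2} ⊆
      {ω | RowDeviates F (δ * n) (δ * n * r) i (fun i => X i ω) (A ω)} ∪
        {ω | ¬ IsTypical F (fun i => X i ω) (A ω)} := by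
    intro ω hω
    by_cases ht : IsTypical F (fun i => X i ω) (A ω)
    · refine Or.inl ⟨ht, U ω, s ω, hU ω, ?_⟩
      have hA := (hal ω (ht.exists_aligns (h.symm ω) hgap hS hF hδ hd hdn (hU ω))).norm_sub_le hδ
      rw [← hK] at hA
      rw [ht.conj_hardThreshold_eq (h.symm ω) hgap hS hF hδ hn0 hdn hsmall (hU ω) (hW ω)]
      refine ht.lt_norm_rowError hgap hδ hn0 hlog hK0 hA hrow ?_
      refine lt_of_pow_lt_pow_left₀ 2 (norm_nonneg _) ?_
      rw [hr2]
      exact hω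
    · exact Or.inr ht
  have hdev := h.measureReal_rowDeviates_le (θ := δ * n) (τ := δ * n * r)
    (R := (K₁ * (n * √(Real.log n))) ^ 2) (by positivity) (by positivity) hU (by
      intro ω ht
      have hA := (hal ω (ht.exists_aligns (h.symm ω) hgap hS hF hδ hd hdn (hU ω))).norm_sub_le hδ
      rw [← hK] at hA
      rw [← norm_sq_eq_sum_norm_row,
        ht.conj_hardThreshold_eq (h.symm ω) hgap hS hF hδ hn0 hdn hsmall (hU ω) (hW ω)]
      have := ht.norm_rowError_le hS hF hn0 hK0 hA
      gcongr) i
  have hpow : (n : ℝ) ^ (γ - 1) * r ^ 2 * n = 1 := by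
    rw [hr2, ← Real.rpow_add hn0', ← Real.rpow_add_one hn0'.ne']
    rw [show γ - 1 + -γ + 1 = 0 by ring, Real.rpow_zero]
  have hdev' : μ.real {ω | RowDeviates F (δ * n) (δ * n * r) i (fun i => X i ω) (A ω)} ≤
      (K₁ / δ) ^ 2 * ((n : ℝ) ^ (γ - 1) * Real.log n) := by
    refine le_of_mul_le_mul_left (hdev.trans (le_of_eq ?_)) hn0'
    rw [mul_pow, mul_pow, Real.sq_sqrt (by linarith), mul_pow, mul_pow, div_pow,
      div_eq_iff (by positivity)]
    calc K₁ ^ 2 * ((n : ℝ) ^ 2 * Real.log n) =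
        K₁ ^ 2 * ((n : ℝ) ^ 2 * Real.log n) * ((n : ℝ) ^ (γ - 1) * r ^ 2 * n) := by
          rw [hpow, mul_one]
      _ = _ := by field_simp
  have htyp := (h.measureReal_not_isTypical_lt hS hF hn2).le
  have htyp' : 2 * ((d : ℝ) ^ 2 + 1) / (n : ℝ) ^ 2 ≤
      2 * ((d : ℝ) ^ 2 + 1) * ((n : ℝ) ^ (γ - 1) * Real.log n) := by
    rw [div_eq_mul_inv]
    have h1 : ((n : ℝ) ^ 2)⁻¹ ≤ (n : ℝ) ^ (γ - 1) := by
      rw [← Real.rpow_natCast, ← Real.rpow_neg hn0'.le]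
      apply Real.rpow_le_rpow_of_exponent_le hn1'
      push_cast
      linarith
    have h2 : (n : ℝ) ^ (γ - 1) * 1 ≤ (n : ℝ) ^ (γ - 1) * Real.log n := by gcongr
    have h3 : ((n : ℝ) ^ 2)⁻¹ ≤ (n : ℝ) ^ (γ - 1) * Real.log n := by linarith
    gcongr
  have h1 := (measureReal_mono (μ := μ) hsub).trans (measureReal_union_le _ _)
  rw [add_mul]
  linarith

end RowConsistency

theorem theorem1 (d : ℕ) (δ : ℝ) (hδ : 0 < δ) :
    (∀ (n : ℕ) (_ : 1 ≤ n) (hdn : d ≤ n)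
      (S : Set (EuclideanSpace ℝ (Fin d))) (_ : IsLatentSpace S)
      (F : Measure (EuclideanSpace ℝ (Fin d))) (_ : IsProbabilityMeasure F)
      (_ : ∀ᵐ x ∂F, x ∈ S) (_ : HasSpectralGap F δ)
      (Ω : Type*) (_ : MeasurableSpace Ω) (μ : Measure Ω) (_ : IsProbabilityMeasure μ)
      (X : Fin n → Ω → EuclideanSpace ℝ (Fin d)) (A : Ω → Matrix (Fin n) (Fin n) ℝ)
      (_ : IsRDPG F μ X A),
      ∃ E : Set Ω, MeasurableSet E ∧ 1 - 2 * ((d : ℝ) ^ 2 + 1) / (n : ℝ) ^ 2 < μ.real E ∧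
        ∀ ω ∈ E, ∀ (U : Matrix (Fin n) (Fin n) ℝ) (s : Fin n → ℝ),
          IsAbsEigendecomposition (A ω) U s →
            ∃ W ∈ Matrix.orthogonalGroup (Fin d) ℝ, Aligns δ hdn U s (fun i => X i ω) W) ∧
    (∀ γ : ℝ, γ < 1 → ∃ (C : ℝ) (N : ℕ), ∀ (n : ℕ) (_ : N ≤ n) (hdn : d ≤ n)
      (S : Set (EuclideanSpace ℝ (Fin d))) (_ : IsLatentSpace S)
      (F : Measure (EuclideanSpace ℝ (Fin d))) (_ : IsProbabilityMeasure F)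
      (_ : ∀ᵐ x ∂F, x ∈ S) (_ : HasSpectralGap F δ)
      (Ω : Type*) (_ : MeasurableSpace Ω) (μ : Measure Ω) (_ : IsProbabilityMeasure μ)
      (X : Fin n → Ω → EuclideanSpace ℝ (Fin d)) (A : Ω → Matrix (Fin n) (Fin n) ℝ)
      (_ : IsRDPG F μ X A)
      (U : Ω → Matrix (Fin n) (Fin n) ℝ) (s : Ω → Fin n → ℝ)
      (_ : ∀ ω, IsAbsEigendecomposition (A ω) (U ω) (s ω))
      (W : Ω → Matrix (Fin d) (Fin d) ℝ) (_ : ∀ ω, W ω ∈ Matrix.orthogonalGroup (Fin d) ℝ)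
      (_ : ∀ ω, (∃ W' ∈ Matrix.orthogonalGroup (Fin d) ℝ,
          Aligns δ hdn (U ω) (s ω) (fun i => X i ω) W') →
        Aligns δ hdn (U ω) (s ω) (fun i => X i ω) (W ω))
      (i : Fin n),
      μ.real {ω | (n : ℝ) ^ (-γ) <
          ‖WithLp.toLp 2 (positionEstimate hdn (U ω) (s ω) (W ω) i) - X i ω‖ ^ 2} ≤
        C * ((n : ℝ) ^ (γ - 1) * Real.log n)) := by
  refine ⟨fun n hn hdn S hS F _ hF hgap Ω _ μ _ X A h =>
    h.exists_measurableSet_aligns hδ hn hdn hS hF hgap, fun γ hγ => ?_⟩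
  rcases Nat.eq_zero_or_pos d with rfl | hd
  · refine ⟨0, 0, fun n _ hdn S _ F _ _ _ Ω _ μ _ X A _ U s _ W _ _ i => ?_⟩
    have : {ω | (n : ℝ) ^ (-γ) <
        ‖WithLp.toLp 2 (positionEstimate hdn (U ω) (s ω) (W ω) i) - X i ω‖ ^ 2} = ∅ := by
      refine Set.eq_empty_of_forall_notMem fun ω hω => ?_
      have h1 : (n : ℝ) ^ (-γ) <
        ‖WithLp.toLp 2 (positionEstimate hdn (U ω) (s ω) (W ω) i) - X i ω‖ ^ 2 := hω
      rw [Subsingleton.elim (WithLp.toLp 2 (positionEstimate hdn (U ω) (s ω) (W ω) i) - X i ω) 0,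
        norm_zero, zero_pow two_ne_zero] at h1
      exact absurd h1 (not_lt.2 (by positivity))
    rw [this]
    simp
  set K : ℝ := 2 * d * √(3 / δ ^ 3) with hK
  have hev : ∀ᶠ n : ℕ in Filter.atTop, 1 ≤ Real.log n ∧ 3 * Real.log n ≤ δ ^ 4 * n / 4 ∧
      (K + 2 * d) * (1 + K) * (√n * Real.log n) ≤ δ * n * (n : ℝ) ^ (-γ / 2) ∧
      (γ < -1 → 4 * (n : ℝ) ≤ (n : ℝ) ^ (-γ)) := by
    have e1 : ∀ᶠ n : ℕ in Filter.atTop, 1 ≤ Real.log n :=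
      (Real.tendsto_log_atTop.comp tendsto_natCast_atTop_atTop).eventually_ge_atTop 1
    have e2 := eventually_mul_log_le 12 (pow_pos hδ 4) one_pos
    -- After division by `√n` the requirement is that `log n` is dominated by `n^((1-γ)/2)`; here `γ
    -- < 1` enters.
    have e3 := eventually_mul_log_le ((K + 2 * d) * (1 + K)) hδ (r := (1 - γ) / 2) (by linarith)
    have e4 : ∀ᶠ n : ℕ in Filter.atTop, γ < -1 → 4 ≤ (n : ℝ) ^ (-γ - 1) := by
      by_cases hγ1 : γ < -1
      · filter_upwards [((tendsto_rpow_atTop (y := -γ - 1) (by linarith)).comp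
          tendsto_natCast_atTop_atTop).eventually_ge_atTop 4] with n hn _
        exact hn
      · exact Filter.Eventually.of_forall fun n h => absurd h hγ1
    filter_upwards [e1, e2, e3, e4, Filter.eventually_gt_atTop 0] with n h1 h2 h3 h4 hn
    have hn0 : (0 : ℝ) < n := by exact_mod_cast hn
    refine ⟨h1, ?_, ?_, fun hγ1 => ?_⟩
    · rw [Real.rpow_one] at h2
      linarith
    · have e : √(n : ℝ) * (n : ℝ) ^ ((1 - γ) / 2) = n * (n : ℝ) ^ (-γ / 2) := by
        rw [Real.sqrt_eq_rpow, ← Real.rpow_add hn0]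
        nth_rewrite 2 [← Real.rpow_one (n : ℝ)]
        rw [← Real.rpow_add hn0]
        congr 1
        ring
      calc (K + 2 * d) * (1 + K) * (√n * Real.log n) =
          √n * ((K + 2 * d) * (1 + K) * Real.log n) := by ring
        _ ≤ √n * (δ * (n : ℝ) ^ ((1 - γ) / 2)) := by gcongr
        _ = δ * (√n * (n : ℝ) ^ ((1 - γ) / 2)) := by ring
        _ = _ := by rw [e]; ring
    · calc 4 * (n : ℝ) ≤ (n : ℝ) ^ (-γ - 1) * n := by gcongr; exact h4 hγ1
        _ = _ := by rw [← Real.rpow_add_one hn0.ne']; congr 1; ring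
  obtain ⟨N, hN⟩ := Filter.eventually_atTop.1 hev
  refine ⟨_, N, fun n hn hdn S hS F _ hF hgap Ω _ μ _ X A h U s hU W hW hal i =>
    h.measureReal_row_error_le hδ hd hdn hS hF hgap hK (hN n hn).1 (hN n hn).2.1 (hN n hn).2.2.1
      (hN n hn).2.2.2 hU hW hal i⟩
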